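/- **Setting.** Let $X$ be a complex manifold with de Rham complex $(A^{*,*}_X,\,d=\partial+\overline\partial)$ of global smooth complex forms, let $A^{\ge 2,*}_X=\bigoplus_{a\ge2}A^{a,*}_X$, and let $$\mathcal E^*:\quad 0\to\mathcal E^p\xrightarrow{\delta}\mathcal E^{p+1}\xrightarrow{\delta}\cdots\xrightarrow{\delta}\mathcal E^q\to0,\qquad p,q\in\mathbb Z,\quad \delta^2=0,$$ be a finite complex of locally free sheaves of finite rank on $X$. Bars denote degrees. Let $\mathcal A^{*,*}_X(\mathcal E^*)=\bigoplus_{a,b,r}\mathcal A^{a,b}_X(\mathcal E^r)$ be the sheaf of smooth $\mathcal E^*$-valued forms, where $\mathcal A^{a,b}_X(\mathcal E^r)$ has degree $a+b+r$, with the operators $\overline\partial(\phi\cdot e)=\overline\partial\phi\cdot e$ and $\delta(\phi\cdot e)=(-1)^{\overline\phi}\phi\cdot\delta(e)$ ($\phi$ a form, $e$ a holomorphic section). For $\mathbb C$-linear endomorphisms $S,T$ of this graded sheaf put $[S,T]=ST-(-1)^{\overline S\,\overline T}TS$. Global forms with values in $\mathcal Hom^*=\mathcal Hom^*_{\mathcal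 O_X}(\mathcal E^*,\mathcal E^*)$ are such endomorphisms, through $(\omega\cdot f)(\eta\cdot e)=(-1)^{\overline f\,\overline\eta}(\omega\wedge\eta)\cdot f(e)$; an element of $A^{a,b}_X(\mathcal Hom^n)$ has degree $a+b+n$. The source below is $A^{0,*}_X(\mathcal Hom^*)$ with the bracket $[-,-]$ and the differential $[\overline\partial+\delta,-]$; the target is $\frac{A^{*,*}_X}{A^{\ge2,*}_X}[2]$ with the differential induced by $d$ and zero bracket. A *connection of type $(1,0)$* on $\mathcal E^*$ is a $\mathbb C$-linear endomorphism $D$ of degree $1$ of the graded sheaf $\mathcal A^{*,*}_X(\mathcal E^*)$ such that, for every holomorphic section $s$ of $\mathcal E^r$ and every form $\phi$, $D(\phi\cdot s)=d\phi\cdot s+(-1)^{\overline\phi}\phi\cdot D(s)$ and $D(s)\in\mathcal A^{1,0}_X(\mathcal E^r)$. Put $\nabla=[D-\overline\partial,-]$; the *Atiyah cocycle* of $D$ is $u=[D,\overline\partial+\delta]$. A *cyclic form of degree $0$* is an $\mathcal O_X$-bilinear graded symmetric map $\langle-,-\rangle:\mathcal Hom^*\times\mathcal Hom^*\to\mathcal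 O_X$ of degree $0$ such that $\langle f,[g,h]\rangle=\langle[f,g],h\rangle$ for all $f,g,h$. It is extended to $A^{*,*}_X(\mathcal Hom^*)$, with values in $A^{*,*}_X$, by $\langle\phi\cdot f,\psi\cdot g\rangle=(-1)^{\overline f\,\overline\psi}\langle f,g\rangle\,\phi\wedge\psi$. It is *compatible* with $D$ if $\langle[D,f],g\rangle+(-1)^{\overline f}\langle f,[D,g]\rangle=d\langle f,g\rangle$ for all $f,g\in A^{*,*}_X(\mathcal Hom^*)$. An *$L_\infty$ morphism* $g:(V,\delta_V,[-,-])\rightsquigarrow(L,d,\{-,-\})$ of DG-Lie algebras is a sequence of graded skew-symmetric $n$-linear maps $g_n$ from $V$ to $L$, $n\ge1$, of degree $1-n$, such that $g_1\delta_V=dg_1$ and, for all $n\ge2$ and all homogeneous $v_1,\dots,v_n$, $$\begin{aligned}&\tfrac12\sum_{p=1}^{n-1}\ \sum_{\sigma\in S(p,n-p)}\chi(\sigma)(-1)^{(1-n+p)(\overline{v_{\sigma(1)}}+\cdots+\overline{v_{\sigma(p)}}-p)}\{g_p(v_{\sigma(1)},\dots,v_{\sigma(p)}),g_{n-p}(v_{\sigma(p+1)},\dots,v_{\sigma(n)})\}+dg_n(v_1,\dots,v_n)\\&\quad=(-1)^{n-1}\sum_{\sigma\in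 S(1,n-1)}\chi(\sigma)g_n(\delta_Vv_{\sigma(1)},v_{\sigma(2)},\dots,v_{\sigma(n)})+(-1)^{n-2}\sum_{\sigma\in S(2,n-2)}\chi(\sigma)g_{n-1}([v_{\sigma(1)},v_{\sigma(2)}],v_{\sigma(3)},\dots,v_{\sigma(n)}),\end{aligned}$$ where $S(p,n-p)$ is the set of $(p,n-p)$-shuffles and $\chi(\sigma)$ is the antisymmetric Koszul sign, $v_{\sigma(1)}\wedge\cdots\wedge v_{\sigma(n)}=\chi(\sigma)\,v_1\wedge\cdots\wedge v_n$. **Theorem.** Let $\langle-,-\rangle$ be a cyclic form of degree $0$ on $\mathcal Hom^*_{\mathcal O_X}(\mathcal E^*,\mathcal E^*)$ which is compatible with a connection $D$ of type $(1,0)$ on $\mathcal E^*$. Then source and target above are DG-Lie algebras over $\mathbb C$, $u\in A^{1,1}_X(\mathcal Hom^0)\oplus A^{1,0}_X(\mathcal Hom^1)$, $\nabla$ maps $A^{0,b}_X(\mathcal Hom^n)$ to $A^{1,b}_X(\mathcal Hom^n)$ for all $b,n$, and there is an $L_\infty$ morphism of DG-Lie algebras over $\mathbb C$ $$g:\ A^{0,*}_X(\mathcal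 Hom^*_{\mathcal O_X}(\mathcal E^*,\mathcal E^*))\rightsquigarrow\frac{A^{*,*}_X}{A^{\ge2,*}_X}[2]$$ whose components are, for homogeneous $f,g,h$, the classes of the forms $$\begin{aligned}g_1(f)&=\langle u,f\rangle=\langle f,u\rangle\in A^{1,*}_X[2],\\ g_2(f,g)&=\tfrac12\left(\langle\nabla(f),g\rangle-(-1)^{\overline f\,\overline g}\langle\nabla(g),f\rangle\right)\in A^{1,*}_X[2],\\ g_3(f,g,h)&=-\tfrac12\langle f,[g,h]\rangle\in A^{0,*}_X[2],\end{aligned}$$ and $g_n=0$ for every $n>3$. -/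

import Mathlib

set_option linter.unusedSectionVars false
open scoped Manifold ContDiff TensorProduct
open TopologicalSpace (Opens)
noncomputable section
namespace HolCx

section Forms

variable (V : Type*) [NormedAddCommGroup V] [NormedSpace ℂ V] [FiniteDimensional ℂ V]

/-- The algebra `Λ = Λ^*(Hom_ℝ(V, ℂ))` of `ℂ`-valued real-multilinear alternating forms on the
tangent space `V`. It is used at every point `x` of a manifold `X` modelled on `V`, whose tangent
space at `x` is `V` in the coordinates of the preferred chart at `x` (as for `TangentSpace`). -/
def Lam : Type _ := ExteriorAlgebra ℂ (V →L[ℝ] ℂ)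

instance : Ring (Lam V) := inferInstanceAs (Ring (ExteriorAlgebra ℂ (V →L[ℝ] ℂ)))
instance : Algebra ℂ (Lam V) := inferInstanceAs (Algebra ℂ (ExteriorAlgebra ℂ (V →L[ℝ] ℂ)))

instance : Module.Finite ℂ (V →L[ℝ] ℂ) := Module.Finite.of_restrictScalars_finite ℝ ℂ _

instance : Module.Finite ℂ (Lam V) :=
  Module.Finite.of_basis
    ((Module.finBasis ℂ (V →L[ℝ] ℂ)).ExteriorAlgebra : Module.Basis _ ℂ (ExteriorAlgebra ℂ (V →L[ℝ] ℂ)))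

/-- An auxiliary norm on the finite-dimensional space `Λ` (all norms are equivalent); it only serves
to speak of smooth `Λ`-valued functions. -/
instance : NormedAddCommGroup (Lam V) :=
  NormedAddCommGroup.induced (Lam V) (Fin (Module.finrank ℂ (Lam V)) → ℂ)
    (Module.finBasis ℂ (Lam V)).equivFun (Module.finBasis ℂ (Lam V)).equivFun.injective

instance : NormedSpace ℂ (Lam V) :=
  NormedSpace.induced ℂ (Lam V) (Fin (Module.finrank ℂ (Lam V)) → ℂ)
    (Module.finBasis ℂ (Lam V)).equivFun.toLinearMap

variable {V}
/-- A `ℂ`-valued real-linear functional on `V` as a one-form. -/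
def cov : (V →L[ℝ] ℂ) →ₗ[ℂ] Lam V := ExteriorAlgebra.ι ℂ

/-- The parity automorphism of `Λ`, multiplication by `(-1)^m` on `m`-forms. -/
def par : Lam V →ₐ[ℂ] Lam V := CliffordAlgebra.involute (Q := (0 : QuadraticForm ℂ (V →L[ℝ] ℂ)))

/-- Pull-back of forms along a `ℂ`-linear map `A`. -/
def pull (A : V →L[ℂ] V) : Lam V →ₐ[ℂ] Lam V :=
  ExteriorAlgebra.map
    { toFun := fun α : V →L[ℝ] ℂ => α.comp (A.restrictScalars ℝ)
      map_add' := fun _ _ => rfl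
      map_smul' := fun _ _ => rfl }

/-- For `s = -1` the `ℂ`-linear part, for `s = 1` the `ℂ`-antilinear part of a real-linear map:
`v ↦ (T v + s i T (i v)) / 2`. -/
def cpart (s : ℂ) {M : Type*} [NormedAddCommGroup M] [NormedSpace ℂ M] (T : V →L[ℝ] M) :
    V →L[ℝ] M :=
  (2⁻¹ : ℂ) • (T + (s * Complex.I) • T.comp (((Complex.I : ℂ) • ContinuousLinearMap.id ℂ V).restrictScalars ℝ))

/-- `∑ e_k^* ∧ T e_k` for a real basis `e_k` of `V`; it does not depend on the basis. -/
def wedge (T : V →L[ℝ] Lam V) : Lam V :=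
  ∑ k, cov (Complex.ofRealCLM.comp ((Module.finBasis ℝ V).coord k).toContinuousLinearMap)
    * T (Module.finBasis ℝ V k)

/-- On the vector space `V`, the operator `∂` (for `s = -1`) or `∂̄` (for `s = 1`) on forms. Their sum
is the exterior derivative `∑ dx_k ∧ ∂η/∂x_k`. -/
def flatD (s : ℂ) (η : V → Lam V) (y : V) : Lam V := wedge (cpart s (fderiv ℝ η y))


lemma cpart_apply (s : ℂ) {M : Type*} [NormedAddCommGroup M] [NormedSpace ℂ M] (T : V →L[ℝ] M)
    (v : V) : cpart s T v = (2⁻¹ : ℂ) • (T v + (s * Complex.I) • T (Complex.I • v)) := by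
  simp [cpart]

lemma wedge_add (T T' : V →L[ℝ] Lam V) : wedge (T + T') = wedge T + wedge T' := by
  simp [wedge, mul_add, Finset.sum_add_distrib]

lemma wedge_smul (a : ℂ) (T : V →L[ℝ] Lam V) : wedge (a • T) = a • wedge T := by
  simp [wedge, Finset.smul_sum]

lemma cpart_add (s : ℂ) {M : Type*} [NormedAddCommGroup M] [NormedSpace ℂ M] (T T' : V →L[ℝ] M) :
    cpart s (T + T') = cpart s T + cpart s T' := by
  ext v; simp only [cpart_apply, add_apply]; module

lemma cpart_smul (s : ℂ) {M : Type*} [NormedAddCommGroup M] [NormedSpace ℂ M] (a : ℂ)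
    (T : V →L[ℝ] M) : cpart s (a • T) = a • cpart s T := by
  ext v; simp only [cpart_apply, smul_apply]; module

lemma pull_cov (A : V →L[ℂ] V) (α : V →L[ℝ] ℂ) :
    pull A (cov α) = cov (α.comp (A.restrictScalars ℝ)) := by
  exact ExteriorAlgebra.map_apply_ι _ _

lemma par_cov (α : V →L[ℝ] ℂ) : par (cov α) = - cov α := CliffordAlgebra.involute_ι _

@[elab_as_elim]
lemma lam_induction {C : Lam V → Prop} (h0 : ∀ r : ℂ, C (algebraMap ℂ _ r))
    (h1 : ∀ α, C (cov α)) (hm : ∀ a b, C a → C b → C (a * b)) (ha : ∀ a b, C a → C b → C (a + b))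
    (a : Lam V) : C a := ExteriorAlgebra.induction h0 h1 hm ha a

lemma cov_mul_comm (α β : V →L[ℝ] ℂ) : cov α * cov β = - (cov β * cov α) :=
  eq_neg_of_add_eq_zero_left (ExteriorAlgebra.ι_add_mul_swap α β)

lemma cov_mul (α : V →L[ℝ] ℂ) (a : Lam V) : cov α * a = par a * cov α := by
  induction a using lam_induction with
  | h0 r => simp [Algebra.commutes]
  | h1 β => rw [cov_mul_comm, par_cov, neg_mul]
  | hm a b ha hb => rw [← mul_assoc, ha, mul_assoc, hb, map_mul, mul_assoc]
  | ha a b ha hb => rw [mul_add, ha, hb, map_add, add_mul]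

lemma pull_pull (A B : V →L[ℂ] V) (a : Lam V) : pull A (pull B a) = pull (B.comp A) a := by
  induction a using lam_induction with
  | h0 r => simp [AlgHom.commutes]
  | h1 β => simp only [pull_cov]; rfl
  | hm a b ha hb => simp only [map_mul, ha, hb]
  | ha a b ha hb => simp only [map_add, ha, hb]

lemma pull_id (a : Lam V) : pull (ContinuousLinearMap.id ℂ V) a = a := by
  induction a using lam_induction with
  | h0 r => simp [AlgHom.commutes]
  | h1 β => simp only [pull_cov]; rfl
  | hm a b ha hb => simp only [map_mul, ha, hb]
  | ha a b ha hb => simp only [map_add, ha, hb]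

lemma pull_par (A : V →L[ℂ] V) (a : Lam V) : pull A (par a) = par (pull A a) := by
  induction a using lam_induction with
  | h0 r => simp [AlgHom.commutes]
  | h1 β => simp only [pull_cov, par_cov, map_neg]
  | hm a b ha hb => simp only [map_mul, ha, hb]
  | ha a b ha hb => simp only [map_add, ha, hb]

lemma cov_eq_sum (α : V →L[ℝ] ℂ) :
    cov α = ∑ k, α (Module.finBasis ℝ V k) •
      cov (Complex.ofRealCLM.comp ((Module.finBasis ℝ V).coord k).toContinuousLinearMap) := by
  simp_rw [← map_smul, ← map_sum]
  congr 1
  ext v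
  have h := congrArg α ((Module.finBasis ℝ V).sum_repr v)
  rw [← h, map_sum]
  simp [mul_comm]

lemma pull_wedge (A : V →L[ℂ] V) (T : V →L[ℝ] Lam V) (T' : V →L[ℝ] Lam V)
    (h : ∀ v, T' v = pull A (T (A v))) : pull A (wedge T) = wedge T' := by
  simp only [wedge, map_sum, map_mul, pull_cov]
  have key : ∀ l, T' (Module.finBasis ℝ V l) = ∑ k,
      (((Module.finBasis ℝ V).coord k (A (Module.finBasis ℝ V l)) : ℝ) : ℂ) •
        pull A (T (Module.finBasis ℝ V k)) := by
    intro l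
    have h2 := congrArg (fun v => pull A (T v))
      ((Module.finBasis ℝ V).sum_repr (A (Module.finBasis ℝ V l)))
    rw [h, ← h2]
    simp only [map_sum, map_smul, Module.Basis.coord_apply]
    refine Finset.sum_congr rfl fun k _ => ?_
    rw [← Complex.coe_smul, map_smul]
  simp_rw [key, Finset.mul_sum]
  rw [Finset.sum_comm]
  refine Finset.sum_congr rfl fun k _ => ?_
  rw [cov_eq_sum, Finset.sum_mul]
  refine Finset.sum_congr rfl fun l _ => ?_
  simp

lemma wedge_symm (β : V →L[ℝ] V →L[ℝ] ℂ) (hβ : ∀ v w, β v w = β w v) (T : V →L[ℝ] Lam V)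
    (hT : ∀ v, T v = cov (β v)) : wedge T = 0 := by
  have h : wedge T = - wedge T := by
    conv_lhs => simp only [wedge, hT]
    simp_rw [cov_eq_sum (β _), Finset.mul_sum]
    rw [Finset.sum_comm]
    simp only [wedge, hT]
    simp_rw [cov_eq_sum (β _), Finset.mul_sum, ← Finset.sum_neg_distrib]
    refine Finset.sum_congr rfl fun k _ => Finset.sum_congr rfl fun l _ => ?_
    rw [mul_smul_comm, mul_smul_comm, hβ, cov_mul_comm, smul_neg]
  have h2 : (2 : ℂ) • wedge T = 0 := by
    rw [two_smul]; nth_rewrite 1 [h]; simp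
  exact (smul_eq_zero.mp h2).resolve_left two_ne_zero

def mulL : Lam V →L[ℝ] Lam V →L[ℝ] Lam V :=
  IsBilinearMap.toContinuousBilinearMap (𝕜 := ℝ) (f := fun a b : Lam V => a * b)
    { add_left := fun _ _ _ => add_mul _ _ _
      smul_left := fun c a b => by simp [← Complex.coe_smul]
      add_right := fun _ _ _ => mul_add _ _ _
      smul_right := fun c a b => by simp [← Complex.coe_smul] }

lemma mulL_apply (a b : Lam V) : mulL a b = a * b := rfl

lemma DiffMul {f g : V → Lam V} {y : V} (hf : DifferentiableAt ℝ f y) (hg : DifferentiableAt ℝ g y) :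
    DifferentiableAt ℝ (fun z => f z * g z) y ∧ ∀ v, fderiv ℝ (fun z => f z * g z) y v =
      f y * fderiv ℝ g y v + fderiv ℝ f y v * g y := by
  have := (mulL (V := V)).hasFDerivAt_of_bilinear hf.hasFDerivAt hg.hasFDerivAt
  have h2 : HasFDerivAt (fun z => f z * g z) _ y := this
  refine ⟨h2.differentiableAt, fun v => ?_⟩
  rw [h2.fderiv]
  simp [mulL_apply]

lemma flatD_mul (s : ℂ) {f g : V → Lam V} {y : V} (hf : DifferentiableAt ℝ f y)
    (hg : DifferentiableAt ℝ g y) :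
    flatD s (fun z => f z * g z) y = flatD s f y * g y + par (f y) * flatD s g y := by
  simp only [flatD, wedge, cpart_apply, (DiffMul hf hg).2, Finset.sum_mul, Finset.mul_sum,
    ← Finset.sum_add_distrib]
  refine Finset.sum_congr rfl fun k _ => ?_
  have e : ∀ (β : V →L[ℝ] ℂ) (b : Lam V), cov β * (f y * b) = par (f y) * (cov β * b) := by
    intro β b; rw [← mul_assoc, cov_mul, mul_assoc]
  simp only [mul_smul_comm, smul_mul_assoc, mul_add, add_mul, smul_add, e, mul_assoc]
  abel

lemma flatD_const (s : ℂ) (a : Lam V) (y : V) : flatD s (fun _ => a) y = 0 := by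
  simp [flatD, wedge, cpart_apply]

lemma flatD_add (s : ℂ) {f g : V → Lam V} {y : V} (hf : DifferentiableAt ℝ f y)
    (hg : DifferentiableAt ℝ g y) :
    flatD s (fun z => f z + g z) y = flatD s f y + flatD s g y := by
  simp only [flatD, fderiv_fun_add hf hg, cpart_add, wedge_add]

lemma flatD_smul (s : ℂ) (a : ℂ) {f : V → Lam V} {y : V} (hf : DifferentiableAt ℝ f y) :
    flatD s (fun z => a • f z) y = a • flatD s f y := by
  simp only [flatD, fderiv_fun_const_smul hf, cpart_smul, wedge_smul]


def pullCovL (α : V →L[ℝ] ℂ) : (V →L[ℂ] V) →ₗ[ℝ] Lam V where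
  toFun A := cov (α.comp (A.restrictScalars ℝ))
  map_add' A B := by
    rw [← map_add]; congr 1; ext v; simp
  map_smul' r A := by
    simp only [RingHom.id_apply]
    rw [← Complex.coe_smul r (cov _), ← LinearMap.map_smul]; congr 1; ext v; simp

instance : FiniteDimensional ℝ (V →L[ℂ] V) :=
  Module.Finite.trans ℂ _

lemma pull_const {Φ : V → V →L[ℂ] V} {Φ' : V →L[ℝ] V →L[ℂ] V} {y : V} (hΦ : HasFDerivAt Φ Φ' y)
    (hsymm : ∀ v w, Φ' v w = Φ' w v) (hI : ∀ v, Φ' (Complex.I • v) = Complex.I • Φ' v) (s : ℂ)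
    (a : Lam V) :
    DifferentiableAt ℝ (fun z => pull (Φ z) a) y ∧ flatD s (fun z => pull (Φ z) a) y = 0 := by
  induction a using lam_induction with
  | h0 r => simp [AlgHom.commutes, flatD_const]
  | h1 α =>
    have h : HasFDerivAt (fun z => pull (Φ z) (cov α))
        ((pullCovL α).toContinuousLinearMap.comp Φ') y := by
      simp only [pull_cov]
      exact (pullCovL α).toContinuousLinearMap.hasFDerivAt.comp y hΦ
    refine ⟨h.differentiableAt, ?_⟩
    rw [flatD, h.fderiv]
    refine wedge_symm (LinearMap.toContinuousLinearMap
      { toFun := fun v => (cpart s α).comp ((Φ' v).restrictScalars ℝ)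
        map_add' := fun v w => by ext u; simp
        map_smul' := fun r v => by ext u; simp }) ?_ _ ?_
    · intro v w
      change cpart s α (Φ' v w) = cpart s α (Φ' w v)
      rw [hsymm]
    · intro v
      rw [cpart_apply]
      change (2⁻¹ : ℂ) • (cov _ + (s * Complex.I) • cov (α.comp ((Φ' (Complex.I • v)).restrictScalars ℝ))) = cov _
      rw [← map_smul, ← map_add, ← map_smul]
      congr 1
      ext w
      change _ = cpart s α (Φ' v w)
      rw [cpart_apply, hI]
      rfl
  | hm a b ha hb =>
    simp only [map_mul]
    refine ⟨(DiffMul ha.1 hb.1).1, ?_⟩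
    rw [flatD_mul s ha.1 hb.1, ha.2, hb.2]; simp
  | ha a b ha hb =>
    simp only [map_add]
    refine ⟨ha.1.add hb.1, ?_⟩
    rw [flatD_add s ha.1 hb.1, ha.2, hb.2]; simp

lemma flatD_pull {Φ : V → V →L[ℂ] V} {Φ' : V →L[ℝ] V →L[ℂ] V} {y : V} (hΦ : HasFDerivAt Φ Φ' y)
    (hsymm : ∀ v w, Φ' v w = Φ' w v) (hI : ∀ v, Φ' (Complex.I • v) = Complex.I • Φ' v) (s : ℂ)
    {ψ : V → V} (hψ : HasFDerivAt ψ ((Φ y).restrictScalars ℝ) y) {η : V → Lam V}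
    (hη : DifferentiableAt ℝ η (ψ y)) :
    flatD s (fun z => pull (Φ z) (η (ψ z))) y = pull (Φ y) (flatD s η (ψ y)) := by
  set b := Module.finBasis ℂ (Lam V) with hb
  have hc : ∀ j, HasFDerivAt (fun z => b.repr (η (ψ z)) j)
      ((((b.coord j).toContinuousLinearMap.restrictScalars ℝ).comp (fderiv ℝ η (ψ y))).comp
        ((Φ y).restrictScalars ℝ)) y := fun j =>
    (((b.coord j).toContinuousLinearMap.restrictScalars ℝ).hasFDerivAt.comp _ hη.hasFDerivAt).comp
      y hψ
  have hG := fun j => pull_const hΦ hsymm hI s (b j)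
  have hexp : (fun z => pull (Φ z) (η (ψ z))) =
      fun z => ∑ j, b.repr (η (ψ z)) j • pull (Φ z) (b j) := by
    funext z
    conv_lhs => rw [← b.sum_repr (η (ψ z))]
    simp only [map_sum, map_smul]
  have hder : HasFDerivAt (fun z => pull (Φ z) (η (ψ z)))
      (∑ j, (b.repr (η (ψ y)) j • fderiv ℝ (fun z => pull (Φ z) (b j)) y +
        ((((b.coord j).toContinuousLinearMap.restrictScalars ℝ).comp (fderiv ℝ η (ψ y))).comp
        ((Φ y).restrictScalars ℝ)).smulRight (pull (Φ y) (b j)))) y := by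
    rw [hexp]
    exact HasFDerivAt.fun_sum fun j _ => (hc j).smul (hG j).1.hasFDerivAt
  rw [flatD, hder.fderiv, Finset.sum_add_distrib, cpart_add, wedge_add]
  have h0 : wedge (cpart s (∑ j, b.repr (η (ψ y)) j • fderiv ℝ (fun z => pull (Φ z) (b j)) y)) = 0 := by
    have hlin : ∀ T : Fin (Module.finrank ℂ (Lam V)) → V →L[ℝ] Lam V,
        wedge (cpart s (∑ j, T j)) = ∑ j, wedge (cpart s (T j)) := by
      intro T
      induction (Finset.univ : Finset (Fin (Module.finrank ℂ (Lam V)))) using Finset.induction_on with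
      | empty => simp [wedge, cpart_apply]
      | insert a t ha ih => rw [Finset.sum_insert ha, Finset.sum_insert ha, cpart_add, wedge_add, ih]
    rw [hlin]
    refine Finset.sum_eq_zero fun j _ => ?_
    have := (hG j).2
    rw [flatD] at this
    rw [cpart_smul, wedge_smul, this, smul_zero]
  rw [h0, zero_add, flatD]
  symm
  apply pull_wedge
  intro v
  have hsum : ∀ v, (∑ j, ((((b.coord j).toContinuousLinearMap.restrictScalars ℝ).comp
        (fderiv ℝ η (ψ y))).comp ((Φ y).restrictScalars ℝ)).smulRight (pull (Φ y) (b j))) v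
        = pull (Φ y) (fderiv ℝ η (ψ y) (Φ y v)) := by
    intro v
    conv_rhs => rw [← b.sum_repr (fderiv ℝ η (ψ y) (Φ y v))]
    simp only [map_sum, map_smul, sum_apply]
    rfl
  rw [cpart_apply, cpart_apply, hsum, hsum]
  simp


section Manifold

variable {X : Type*} [TopologicalSpace X] [ChartedSpace V X] [IsManifold 𝓘(ℂ, V) ω X]

/-- A form `η` (its value at `x` being given in the preferred chart at `x`), rewritten at the point `x`
in the coordinates of the preferred chart at `c`. -/
def chartRep (c : X) (η : X → Lam V) (x : X) : Lam V :=
  pull (tangentCoordChange 𝓘(ℂ, V) c x x) (η x)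

/-- The expression of the form `η` in the preferred chart at `c`, a form on an open set of `V`. -/
def inChart (c : X) (η : X → Lam V) (y : V) : Lam V :=
  chartRep c η ((extChartAt 𝓘(ℂ, V) c).symm y)

/-- The image of `S` in the preferred chart at `c`. -/
def chartDom (c : X) (S : Set X) : Set V :=
  (extChartAt 𝓘(ℂ, V) c).target ∩ (extChartAt 𝓘(ℂ, V) c).symm ⁻¹' S

/-- The form `η` is smooth on `S`: its expressions in all charts are smooth. -/
def SmoothOn (η : X → Lam V) (S : Set X) : Prop :=
  ∀ c : X, ContDiffOn ℝ ∞ (inChart c η) (chartDom (V := V) c S)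

/-- The Dolbeault operators on `X`: `∂` for `s = -1`, `∂̄` for `s = 1`. The exterior derivative is
`d = dol (-1) + dol 1`. -/
def dol (s : ℂ) (η : X → Lam V) (x : X) : Lam V :=
  flatD s (inChart x η) (extChartAt 𝓘(ℂ, V) x x)

lemma isOpen_chartDom (c : X) {S : Set X} (hS : IsOpen S) : IsOpen (chartDom (V := V) c S) :=
  (continuousOn_extChartAt_symm c).isOpen_inter_preimage (isOpen_extChartAt_target c) hS

lemma mem_chartDom {c x : X} {S : Set X} (hx : x ∈ S) (hc : x ∈ (extChartAt 𝓘(ℂ, V) c).source) :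
    extChartAt 𝓘(ℂ, V) c x ∈ chartDom (V := V) c S := by
  refine ⟨(extChartAt 𝓘(ℂ, V) c).map_source hc, ?_⟩
  change (extChartAt 𝓘(ℂ, V) c).symm _ ∈ S
  rwa [(extChartAt 𝓘(ℂ, V) c).left_inv hc]

lemma SmoothOn.differentiableAt {η : X → Lam V} {S : Set X} (h : SmoothOn η S) (hS : IsOpen S)
    {c : X} {y : V} (hy : y ∈ chartDom c S) : DifferentiableAt ℝ (inChart c η) y :=
  ((h c).contDiffAt ((isOpen_chartDom c hS).mem_nhds hy)).differentiableAt (by simp)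

lemma chartRep_change {c c' x : X} (η : X → Lam V) (hc : x ∈ (extChartAt 𝓘(ℂ, V) c).source)
    (hc' : x ∈ (extChartAt 𝓘(ℂ, V) c').source) :
    chartRep c η x = pull (tangentCoordChange 𝓘(ℂ, V) c c' x) (chartRep c' η x) := by
  rw [chartRep, chartRep, pull_pull]
  congr 2
  ext v
  exact (tangentCoordChange_comp ⟨⟨hc, hc'⟩, mem_extChartAt_source x⟩).symm

lemma chartRep_self (x : X) (η : X → Lam V) : chartRep x η x = η x := by
  rw [chartRep]
  have : tangentCoordChange 𝓘(ℂ, V) x x x = ContinuousLinearMap.id ℂ V := by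
    ext v; exact tangentCoordChange_self (mem_extChartAt_source x)
  rw [this, pull_id]

/-- The operators `∂`, `∂̄` may be computed in any chart. -/
lemma chartRep_dol (s : ℂ) {η : X → Lam V} {S : Set X} (hS : IsOpen S) (h : SmoothOn η S)
    {c x : X} (hx : x ∈ S) (hc : x ∈ (extChartAt 𝓘(ℂ, V) c).source) :
    chartRep c (dol s η) x = flatD s (inChart c η) (extChartAt 𝓘(ℂ, V) c x) := by
  set φ := extChartAt 𝓘(ℂ, V) c with hφ
  set φ' := extChartAt 𝓘(ℂ, V) x with hφ'
  set ψ : V → V := φ' ∘ φ.symm with hψ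
  set y := φ x with hy
  have hxx : x ∈ φ'.source := mem_extChartAt_source x
  have hyx : φ.symm y = x := φ.left_inv hc
  set O := (φ.symm ≫ φ').source with hO
  have hOopen : IsOpen O := by
    have : O = φ.target ∩ φ.symm ⁻¹' φ'.source := by
      rw [hO, PartialEquiv.trans_source]; rfl
    rw [this]
    exact (continuousOn_extChartAt_symm c).isOpen_inter_preimage (isOpen_extChartAt_target c)
      (isOpen_extChartAt_source x)
  have hyO : y ∈ O := by
    rw [hO, PartialEquiv.trans_source]
    exact ⟨φ.map_source hc, by change φ.symm y ∈ φ'.source; rw [hyx]; exact hxx⟩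
  have hsm : ContDiffOn ℂ ω ψ O := contDiffOn_ext_coord_change x c
  have hsmy : ContDiffAt ℂ ω ψ y := hsm.contDiffAt (hOopen.mem_nhds hyO)
  have hev : inChart c η =ᶠ[nhds y] fun z => pull (fderiv ℂ ψ z) (inChart x η (ψ z)) := by
    filter_upwards [hOopen.mem_nhds hyO] with z hz
    rw [hO, PartialEquiv.trans_source] at hz
    have h1 : φ.symm z ∈ φ.source := φ.map_target hz.1
    have h2 : φ.symm z ∈ φ'.source := hz.2
    rw [inChart, chartRep_change η h1 h2, inChart, hψ, Function.comp_apply, φ'.left_inv h2,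
      tangentCoordChange_def]
    congr 2
    simp only [modelWithCornersSelf_coe, Set.range_id, fderivWithin_univ]
    rw [← hφ, φ.right_inv hz.1]
  have hΦ : HasFDerivAt (fderiv ℂ ψ) ((fderiv ℂ (fderiv ℂ ψ) y).restrictScalars ℝ) y := by
    apply HasFDerivAt.restrictScalars ℝ
    exact ((hsmy.fderiv_right (m := 1) (by simp)).differentiableAt one_ne_zero).hasFDerivAt
  have hψ1 : HasFDerivAt ψ ((fderiv ℂ ψ y).restrictScalars ℝ) y :=
    (hsmy.differentiableAt (by simp)).hasFDerivAt.restrictScalars ℝ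
  have hψy : ψ y = φ' x := by rw [hψ, Function.comp_apply, hyx]
  have hη : DifferentiableAt ℝ (inChart x η) (ψ y) := by
    rw [hψy]; exact h.differentiableAt hS (mem_chartDom hx hxx)
  have key := flatD_pull hΦ (fun v w => hsmy.isSymmSndFDerivAt_of_omega v w)
    (fun v => by simp) s hψ1 hη
  have e1 : flatD s (inChart c η) y =
      flatD s (fun z => pull (fderiv ℂ ψ z) (inChart x η (ψ z))) y := by
    rw [flatD, flatD, hev.fderiv_eq]
  rw [e1, key, hψy, chartRep, dol, tangentCoordChange_def]
  simp only [modelWithCornersSelf_coe, Set.range_id, fderivWithin_univ]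
  rfl

lemma contDiffOn_flatD (s : ℂ) {F : V → Lam V} {T : Set V} (hT : IsOpen T)
    (hF : ContDiffOn ℝ ∞ F T) : ContDiffOn ℝ ∞ (flatD s F) T := by
  have hd : ContDiffOn ℝ ∞ (fderiv ℝ F) T := hF.fderiv_of_isOpen hT (by simp)
  have hm : ∀ (a : Lam V) (f : V → Lam V), ContDiffOn ℝ ∞ f T →
      ContDiffOn ℝ ∞ (fun y => a * f y) T := fun a f hf =>
    (mulL a).contDiff.comp_contDiffOn hf
  unfold flatD wedge
  refine ContDiffOn.sum fun k _ => hm _ _ ?_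
  simp only [cpart_apply]
  exact ((hd.clm_apply contDiffOn_const).add
    ((hd.clm_apply contDiffOn_const).const_smul _)).const_smul _

lemma SmoothOn.dol (s : ℂ) {η : X → Lam V} {S : Set X} (hS : IsOpen S) (h : SmoothOn η S) :
    SmoothOn (dol s η) S := by
  intro c
  refine (contDiffOn_flatD s (isOpen_chartDom c hS) (h c)).congr fun y hy => ?_
  rw [inChart, chartRep_dol s hS h hy.2 ((extChartAt 𝓘(ℂ, V) c).map_target hy.1),
    (extChartAt 𝓘(ℂ, V) c).right_inv hy.1]


lemma SmoothOn.mono {η : X → Lam V} {S T : Set X} (h : SmoothOn η S) (hT : T ⊆ S) :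
    SmoothOn η T := fun c => (h c).mono fun _ hy => ⟨hy.1, hT hy.2⟩

lemma SmoothOn.congr {η θ : X → Lam V} {S : Set X} (h : SmoothOn η S) (e : ∀ x ∈ S, θ x = η x) :
    SmoothOn θ S := fun c => (h c).congr fun y hy => by
  simp only [inChart, chartRep]; rw [e _ hy.2]

lemma smoothOn_const (r : ℂ) (S : Set X) : SmoothOn (fun _ : X => algebraMap ℂ (Lam V) r) S := by
  intro c
  unfold inChart; simp only [chartRep, AlgHom.commutes]
  exact contDiffOn_const

lemma smoothOn_zero (S : Set X) : SmoothOn (fun _ : X => (0 : Lam V)) S := by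
  simpa using smoothOn_const (V := V) 0 S

lemma SmoothOn.add {η θ : X → Lam V} {S : Set X} (h : SmoothOn η S) (h' : SmoothOn θ S) :
    SmoothOn (fun x => η x + θ x) S := fun c => by
  unfold inChart; simp only [chartRep, map_add]
  exact (h c).add (h' c)

lemma SmoothOn.mul {η θ : X → Lam V} {S : Set X} (h : SmoothOn η S) (h' : SmoothOn θ S) :
    SmoothOn (fun x => η x * θ x) S := fun c => by
  unfold inChart; simp only [chartRep, map_mul]
  exact ContDiffOn.clm_apply ((mulL (V := V)).contDiff.comp_contDiffOn (h c)) (h' c)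

lemma SmoothOn.smul (r : ℂ) {η : X → Lam V} {S : Set X} (h : SmoothOn η S) :
    SmoothOn (fun x => r • η x) S := fun c => by
  unfold inChart; simp only [chartRep, map_smul]
  exact (h c).const_smul r

lemma SmoothOn.par {η : X → Lam V} {S : Set X} (h : SmoothOn η S) :
    SmoothOn (fun x => par (η x)) S := fun c => by
  unfold inChart; simp only [chartRep, pull_par]
  exact (((HolCx.par (V := V)).toLinearMap.toContinuousLinearMap.restrictScalars ℝ).contDiff.comp_contDiffOn
    (h c))

lemma SmoothOn.sum {κ : Type*} (t : Finset κ) {η : κ → X → Lam V} {S : Set X}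
    (h : ∀ k ∈ t, SmoothOn (η k) S) : SmoothOn (fun x => ∑ k ∈ t, η k x) S := by
  classical
  induction t using Finset.induction_on with
  | empty => simpa using smoothOn_zero S
  | insert a t ha ih =>
    simp only [Finset.sum_insert ha]
    exact (h a (Finset.mem_insert_self _ _)).add (ih fun k hk => h k (Finset.mem_insert_of_mem hk))

lemma smoothOn_of_local {η : X → Lam V} {S : Set X}
    (h : ∀ x ∈ S, ∃ W : Set X, IsOpen W ∧ x ∈ W ∧ SmoothOn η (S ∩ W)) : SmoothOn η S := by
  intro c y hy
  obtain ⟨W, hW, hxW, hs⟩ := h _ hy.2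
  refine ((hs c) y ⟨hy.1, hy.2, hxW⟩).mono_of_mem_nhdsWithin ?_
  have h1 : chartDom (V := V) c W ∈ nhds y := (isOpen_chartDom c hW).mem_nhds ⟨hy.1, hxW⟩
  filter_upwards [self_mem_nhdsWithin, mem_nhdsWithin_of_mem_nhds h1] with z hz hz'
  exact ⟨hz.1, hz.2, hz'.2⟩

lemma dol_congr (s : ℂ) {η θ : X → Lam V} {S : Set X} (hS : IsOpen S) (e : ∀ x ∈ S, η x = θ x)
    {x : X} (hx : x ∈ S) : dol s η x = dol s θ x := by
  have : inChart x η =ᶠ[nhds (extChartAt 𝓘(ℂ, V) x x)] inChart x θ := by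
    filter_upwards [(isOpen_chartDom x hS).mem_nhds (mem_chartDom hx (mem_extChartAt_source x))]
      with y hy
    simp only [inChart, chartRep]; rw [e _ hy.2]
  rw [HolCx.dol, HolCx.dol, flatD, flatD, this.fderiv_eq]

lemma dol_mul (s : ℂ) {η θ : X → Lam V} {S : Set X} (hS : IsOpen S) (h : SmoothOn η S)
    (h' : SmoothOn θ S) {x : X} (hx : x ∈ S) :
    dol s (fun x => η x * θ x) x = dol s η x * θ x + HolCx.par (η x) * dol s θ x := by
  have hm := mem_chartDom (V := V) hx (mem_extChartAt_source x)
  have e : inChart x (fun x => η x * θ x) = fun y => inChart x η y * inChart x θ y := by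
    funext y; simp [inChart, chartRep]
  have e2 : ∀ ζ : X → Lam V, inChart x ζ (extChartAt 𝓘(ℂ, V) x x) = ζ x := fun ζ => by
    rw [inChart, extChartAt_to_inv, chartRep_self]
  rw [HolCx.dol, e, flatD_mul s (h.differentiableAt hS hm) (h'.differentiableAt hS hm), e2, e2]
  rfl

lemma dol_add (s : ℂ) {η θ : X → Lam V} {S : Set X} (hS : IsOpen S) (h : SmoothOn η S)
    (h' : SmoothOn θ S) {x : X} (hx : x ∈ S) :
    dol s (fun x => η x + θ x) x = dol s η x + dol s θ x := by
  have hm := mem_chartDom (V := V) hx (mem_extChartAt_source x)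
  have e : inChart x (fun x => η x + θ x) = fun y => inChart x η y + inChart x θ y := by
    funext y; simp [inChart, chartRep]
  rw [HolCx.dol, e, flatD_add s (h.differentiableAt hS hm) (h'.differentiableAt hS hm)]
  rfl

lemma dol_smul (s r : ℂ) {η : X → Lam V} {S : Set X} (hS : IsOpen S) (h : SmoothOn η S)
    {x : X} (hx : x ∈ S) : dol s (fun x => r • η x) x = r • dol s η x := by
  have hm := mem_chartDom (V := V) hx (mem_extChartAt_source x)
  have e : inChart x (fun x => r • η x) = fun y => r • inChart x η y := by
    funext y; simp [inChart, chartRep]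
  rw [HolCx.dol, e, flatD_smul s r (h.differentiableAt hS hm)]
  rfl

lemma dol_zero (s : ℂ) (x : X) : dol s (fun _ => (0 : Lam V)) x = 0 := by
  have e : inChart x (fun _ => (0 : Lam V)) = fun _ => 0 := by
    funext y; simp [inChart, chartRep]
  rw [HolCx.dol, e, flatD_const]

lemma dol_sum {κ : Type*} (t : Finset κ) (s : ℂ) {η : κ → X → Lam V} {S : Set X} (hS : IsOpen S)
    (h : ∀ k ∈ t, SmoothOn (η k) S) {x : X} (hx : x ∈ S) :
    dol s (fun x => ∑ k ∈ t, η k x) x = ∑ k ∈ t, dol s (η k) x := by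
  classical
  induction t using Finset.induction_on with
  | empty => simpa using dol_zero s x
  | insert a t ha ih =>
    simp only [Finset.sum_insert ha]
    rw [dol_add s hS (h a (Finset.mem_insert_self _ _))
      (SmoothOn.sum t fun k hk => h k (Finset.mem_insert_of_mem hk)) hx,
      ih fun k hk => h k (Finset.mem_insert_of_mem hk)]

abbrev HolOn (V : Type*) [NormedAddCommGroup V] [NormedSpace ℂ V] {X : Type*} [TopologicalSpace X]
    [ChartedSpace V X] (f : X → ℂ) (S : Set X) : Prop := ContMDiffOn 𝓘(ℂ, V) 𝓘(ℂ, ℂ) ω f S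

lemma HolOn.chart {f : X → ℂ} {S : Set X} (hf : HolOn V f S) (c : X) :
    ContDiffOn ℂ ω (f ∘ (extChartAt 𝓘(ℂ, V) c).symm) (chartDom (V := V) c S) := by
  have h := hf.comp ((contMDiffOn_extChartAt_symm (I := 𝓘(ℂ, V)) (n := ω) c).mono
    (Set.inter_subset_left (t := (extChartAt 𝓘(ℂ, V) c).symm ⁻¹' S))) fun y hy => hy.2
  exact contMDiffOn_iff_contDiffOn.mp h

lemma HolOn.smooth {f : X → ℂ} {S : Set X} (hf : HolOn V f S) :
    SmoothOn (fun x => algebraMap ℂ (Lam V) (f x)) S := by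
  intro c
  have h1 : ContDiffOn ℝ ∞ (f ∘ (extChartAt 𝓘(ℂ, V) c).symm) (chartDom (V := V) c S) :=
    ((hf.chart c).restrict_scalars ℝ).of_le (by simp)
  have h2 := ((Algebra.linearMap ℂ (Lam V)).toContinuousLinearMap.restrictScalars ℝ).contDiff.comp_contDiffOn h1
  refine h2.congr fun y hy => ?_
  simp [inChart, chartRep, AlgHom.commutes]

lemma HolOn.dol_eq_zero {f : X → ℂ} {S : Set X} (hf : HolOn V f S) (hS : IsOpen S) {x : X}
    (hx : x ∈ S) : dol 1 (fun x => algebraMap ℂ (Lam V) (f x)) x = 0 := by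
  have hm := mem_chartDom (V := V) hx (mem_extChartAt_source x)
  have h1 : HasFDerivAt (f ∘ (extChartAt 𝓘(ℂ, V) x).symm) _ (extChartAt 𝓘(ℂ, V) x x) :=
    (((hf.chart x).contDiffAt ((isOpen_chartDom x hS).mem_nhds hm)).differentiableAt
      (by simp)).hasFDerivAt.restrictScalars ℝ
  have h2 := ((Algebra.linearMap ℂ (Lam V)).toContinuousLinearMap.restrictScalars ℝ).hasFDerivAt.comp _ h1
  have e : inChart x (fun x => algebraMap ℂ (Lam V) (f x)) =
      ((Algebra.linearMap ℂ (Lam V)).toContinuousLinearMap.restrictScalars ℝ) ∘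
        (f ∘ (extChartAt 𝓘(ℂ, V) x).symm) := by
    funext y; simp [inChart, chartRep, AlgHom.commutes]
  rw [HolCx.dol, e, flatD, h2.fderiv]
  have : cpart 1 ((((Algebra.linearMap ℂ (Lam V)).toContinuousLinearMap.restrictScalars ℝ)).comp
      ((fderiv ℂ (f ∘ (extChartAt 𝓘(ℂ, V) x).symm) (extChartAt 𝓘(ℂ, V) x x)).restrictScalars ℝ)) = 0 := by
    ext v
    rw [cpart_apply]
    simp [← mul_assoc, ← map_mul, Algebra.smul_def]
  rw [this]
  simp [wedge]


end Manifold

/-- Functionals of type `(1,0)`: the `ℂ`-linear ones. -/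
def covHol : Submodule ℂ (V →L[ℝ] ℂ) where
  carrier := {α | ∀ v, α (Complex.I • v) = Complex.I * α v}
  zero_mem' := by simp
  add_mem' := fun {α β} hα hβ v => by simp [hα v, hβ v, mul_add]
  smul_mem' := fun r α hα v => by simp [hα v, mul_left_comm]

/-- Functionals of type `(0,1)`: the `ℂ`-antilinear ones. -/
def covAnti : Submodule ℂ (V →L[ℝ] ℂ) where
  carrier := {α | ∀ v, α (Complex.I • v) = -(Complex.I * α v)}
  zero_mem' := by simp
  add_mem' := fun {α β} hα hβ v => by simp [hα v, hβ v, mul_add, add_comm]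
  smul_mem' := fun r α hα v => by simp [hα v, mul_left_comm]

variable (V) in
/-- `Λ^{a,b}`, the forms of type `(a,b)`. -/
def typ (a b : ℕ) : Submodule ℂ (Lam V) :=
  (covHol.map cov) ^ a * (covAnti.map cov) ^ b

variable (V) in
/-- `Λ^{≥ r,*}`, the sum of the `Λ^{a,b}` with `a ≥ r`. -/
def filt (r : ℕ) : Submodule ℂ (Lam V) := ⨆ (a : ℕ) (b : ℕ) (_ : r ≤ a), typ V a b

variable (V) in
/-- The forms of total degree `m`. -/
def lamDeg (m : ℤ) : Submodule ℂ (Lam V) := ⨆ (a : ℕ) (b : ℕ) (_ : (a : ℤ) + b = m), typ V a b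

lemma pull_typ (A : V →L[ℂ] V) (a b : ℕ) {η : Lam V} (h : η ∈ typ V a b) :
    pull A η ∈ typ V a b := by
  have h1 : (covHol.map (cov (V := V))).map (pull A).toLinearMap ≤ covHol.map cov := by
    rintro _ ⟨_, ⟨α, hα, rfl⟩, rfl⟩
    refine ⟨α.comp (A.restrictScalars ℝ), fun v => ?_, (pull_cov A α).symm⟩
    simpa using hα (A v)
  have h2 : (covAnti.map (cov (V := V))).map (pull A).toLinearMap ≤ covAnti.map cov := by
    rintro _ ⟨_, ⟨α, hα, rfl⟩, rfl⟩
    refine ⟨α.comp (A.restrictScalars ℝ), fun v => ?_, (pull_cov A α).symm⟩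
    simpa using hα (A v)
  have h3 : (typ V a b).map (pull A).toLinearMap ≤ typ V a b := by
    rw [typ, Submodule.map_mul, Submodule.map_pow, Submodule.map_pow]
    exact mul_le_mul' (pow_le_pow_left' h1 a) (pow_le_pow_left' h2 b)
  exact h3 ⟨η, h, rfl⟩

lemma pull_filt (A : V →L[ℂ] V) (r : ℕ) {η : Lam V} (h : η ∈ filt V r) :
    pull A η ∈ filt V r := by
  have : filt V r ≤ (filt V r).comap (pull A).toLinearMap := by
    rw [filt]
    refine iSup_le fun a => iSup_le fun b => iSup_le fun ha x hx => ?_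
    exact Submodule.mem_iSup_of_mem a (Submodule.mem_iSup_of_mem b
      (Submodule.mem_iSup_of_mem ha (pull_typ A a b hx)))
  exact this h

lemma hol_anti_comm : (covAnti.map (cov (V := V))) * (covHol.map cov) =
    (covHol.map cov) * (covAnti.map cov) := by
  apply le_antisymm <;> rw [Submodule.mul_le] <;> rintro _ ⟨α, hα, rfl⟩ _ ⟨β, hβ, rfl⟩ <;>
    rw [cov_mul_comm] <;> exact Submodule.neg_mem _ (Submodule.mul_mem_mul ⟨β, hβ, rfl⟩ ⟨α, hα, rfl⟩)

lemma hol_mul_typ (a b : ℕ) : (covHol.map (cov (V := V))) * typ V a b = typ V (a + 1) b := by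
  rw [typ, typ, ← mul_assoc, pow_succ']

lemma anti_mul_typ (a b : ℕ) : (covAnti.map (cov (V := V))) * typ V a b = typ V a (b + 1) := by
  have h : Commute (covAnti.map (cov (V := V))) ((covHol.map cov) ^ a) :=
    Commute.pow_right hol_anti_comm a
  rw [typ, typ, ← mul_assoc, h.eq, mul_assoc, pow_succ']

lemma wedge_cpart (s : ℂ) (T : V →L[ℝ] Lam V) :
    wedge (cpart s T) = ∑ k, cov (cpart s (Complex.ofRealCLM.comp
      ((Module.finBasis ℝ V).coord k).toContinuousLinearMap)) * T (Module.finBasis ℝ V k) := by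
  set b := Module.finBasis ℝ V
  have h1 : ∀ k, cpart s (Complex.ofRealCLM.comp (b.coord k).toContinuousLinearMap) =
      (2⁻¹ : ℂ) • (Complex.ofRealCLM.comp (b.coord k).toContinuousLinearMap +
        (s * Complex.I) • (Complex.ofRealCLM.comp (b.coord k).toContinuousLinearMap).comp
          (((Complex.I : ℂ) • ContinuousLinearMap.id ℂ V).restrictScalars ℝ)) := fun k => rfl
  have h2 : ∑ k, cov (Complex.ofRealCLM.comp (b.coord k).toContinuousLinearMap) *
        T (Complex.I • b k) =
      ∑ k, cov ((Complex.ofRealCLM.comp (b.coord k).toContinuousLinearMap).comp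
          (((Complex.I : ℂ) • ContinuousLinearMap.id ℂ V).restrictScalars ℝ)) * T (b k) := by
    have key : ∀ l, T (Complex.I • b l) =
        ∑ k, ((b.coord k (Complex.I • b l) : ℝ) : ℂ) • T (b k) := by
      intro l
      have h := congrArg T (b.sum_repr (Complex.I • b l))
      rw [← h]
      simp only [map_sum, map_smul, Module.Basis.coord_apply, Complex.coe_smul]
    simp_rw [key, Finset.mul_sum]
    rw [Finset.sum_comm]
    refine Finset.sum_congr rfl fun k _ => ?_
    rw [cov_eq_sum (ContinuousLinearMap.comp _ _), Finset.sum_mul]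
    refine Finset.sum_congr rfl fun l _ => ?_
    simp [b]
  simp only [wedge, cpart_apply, h1, map_smul, map_add, mul_smul_comm, smul_mul_assoc, mul_add,
    add_mul, ← Finset.smul_sum, Finset.sum_add_distrib, smul_add]
  congr 3

lemma cpart_hol (α : V →L[ℝ] ℂ) : cpart (-1) α ∈ covHol := by
  intro v
  rw [cpart_apply, cpart_apply, smul_smul, Complex.I_mul_I]
  simp only [neg_smul, one_smul, map_neg, smul_eq_mul]
  linear_combination (2⁻¹ * α (Complex.I • v)) * Complex.I_mul_I

lemma cpart_anti (α : V →L[ℝ] ℂ) : cpart 1 α ∈ covAnti := by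
  intro v
  rw [cpart_apply, cpart_apply, smul_smul, Complex.I_mul_I]
  simp only [neg_smul, one_smul, map_neg, smul_eq_mul]
  linear_combination (2⁻¹ * α (Complex.I • v)) * Complex.I_mul_I

lemma fderiv_mem (P : Submodule ℂ (Lam V)) {F : V → Lam V} {y : V}
    (h : ∀ᶠ z in nhds y, F z ∈ P) (v : V) : fderiv ℝ F y v ∈ P := by
  by_cases hd : DifferentiableAt ℝ F y
  · obtain ⟨Q, hQ⟩ := Submodule.exists_isCompl P
    set π := ((P.subtype.comp (P.projectionOnto Q hQ)).toContinuousLinearMap.restrictScalars ℝ)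
    have h1 : F =ᶠ[nhds y] π ∘ F := by
      filter_upwards [h] with z hz
      exact ((congrArg Subtype.val (Submodule.projectionOnto_apply_left hQ ⟨F z, hz⟩))).symm
    have h2 := π.hasFDerivAt.comp y hd.hasFDerivAt
    rw [h1.fderiv_eq, h2.fderiv]
    exact ((P.projectionOnto Q hQ) _).2
  · rw [fderiv_zero_of_not_differentiableAt hd]; simp

lemma flatD_mem_hol (P : Submodule ℂ (Lam V)) {F : V → Lam V} {y : V}
    (h : ∀ᶠ z in nhds y, F z ∈ P) : flatD (-1) F y ∈ (covHol.map cov) * P := by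
  rw [flatD, wedge_cpart]
  exact Submodule.sum_mem _ fun k _ =>
    Submodule.mul_mem_mul ⟨_, cpart_hol _, rfl⟩ (fderiv_mem P h _)

lemma flatD_mem_anti (P : Submodule ℂ (Lam V)) {F : V → Lam V} {y : V}
    (h : ∀ᶠ z in nhds y, F z ∈ P) : flatD 1 F y ∈ (covAnti.map cov) * P := by
  rw [flatD, wedge_cpart]
  exact Submodule.sum_mem _ fun k _ =>
    Submodule.mul_mem_mul ⟨_, cpart_anti _, rfl⟩ (fderiv_mem P h _)

lemma hol_mul_filt (r : ℕ) : (covHol.map (cov (V := V))) * filt V r ≤ filt V r := by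
  rw [filt, Submodule.mul_iSup]
  refine iSup_le fun a => ?_
  rw [Submodule.mul_iSup]
  refine iSup_le fun b => ?_
  rw [Submodule.mul_iSup]
  refine iSup_le fun ha => ?_
  rw [hol_mul_typ]
  exact le_iSup_of_le (a + 1) (le_iSup_of_le b (le_iSup_of_le (ha.trans (Nat.le_succ a)) le_rfl))

lemma anti_mul_filt (r : ℕ) : (covAnti.map (cov (V := V))) * filt V r ≤ filt V r := by
  rw [filt, Submodule.mul_iSup]
  refine iSup_le fun a => ?_
  rw [Submodule.mul_iSup]
  refine iSup_le fun b => ?_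
  rw [Submodule.mul_iSup]
  refine iSup_le fun ha => ?_
  rw [anti_mul_typ]
  exact le_iSup_of_le a (le_iSup_of_le (b + 1) (le_iSup_of_le ha le_rfl))

section Manifold2

variable (V) (X : Type*) [TopologicalSpace X] [ChartedSpace V X] [IsManifold 𝓘(ℂ, V) ω X]
variable {X}

/-- Smooth forms `A^{*,*}(U)` on an open set `U`. A form on `U` is encoded by its extension by zero
to a (not necessarily continuous) function on `X`; smoothness is only required on `U`. -/
def Frm (U : Opens X) : Submodule ℂ (X → Lam V) where
  carrier := {η | (∀ x, x ∉ U → η x = 0) ∧ SmoothOn η (U : Set X)}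
  zero_mem' := ⟨fun _ _ => rfl, smoothOn_zero _⟩
  add_mem' := fun {η θ} h h' => ⟨fun x hx => by simp [h.1 x hx, h'.1 x hx], h.2.add h'.2⟩
  smul_mem' := fun r η h => ⟨fun x hx => by simp [h.1 x hx], h.2.smul r⟩

variable (X)

/-- The operators `∂` and `∂̄` on global forms. -/
def dolX (s : ℂ) : Frm V (⊤ : Opens X) →ₗ[ℂ] Frm V (⊤ : Opens X) where
  toFun η := ⟨dol s η.1, fun _ hx => absurd trivial hx, η.2.2.dol s isOpen_univ⟩
  map_add' η θ := Subtype.ext <| funext fun x =>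
    dol_add s isOpen_univ η.2.2 θ.2.2 (Set.mem_univ x)
  map_smul' r η := Subtype.ext <| funext fun x =>
    dol_smul s r isOpen_univ η.2.2 (Set.mem_univ x)

/-- The subspace `A^{≥ r,*}` of `A^{*,*}`. -/
def filtX (r : ℕ) : Submodule ℂ (Frm V (⊤ : Opens X)) where
  carrier := {η | ∀ x, η.1 x ∈ filt V r}
  zero_mem' := fun _ => Submodule.zero_mem _
  add_mem' := fun h h' x => Submodule.add_mem _ (h x) (h' x)
  smul_mem' := fun c _ h x => Submodule.smul_mem _ c (h x)

lemma dolX_filtX (r : ℕ) : filtX V X r ≤ (filtX V X r).comap (dolX V X (-1) + dolX V X 1) := by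
  intro η h x
  have h' : ∀ᶠ z in nhds (extChartAt 𝓘(ℂ, V) x x), inChart x η.1 z ∈ filt V r :=
    Filter.Eventually.of_forall fun z => pull_filt _ _ (h _)
  exact Submodule.add_mem _ (hol_mul_filt r (flatD_mem_hol _ h'))
    (anti_mul_filt r (flatD_mem_anti _ h'))

/-- The quotient `A^{*,*} / A^{≥ 2,*}`. -/
abbrev TruncX : Type _ := Frm V (⊤ : Opens X) ⧸ filtX V X 2

/-- The differential of `A^{*,*} / A^{≥ 2,*}` induced by `d = ∂ + ∂̄`. -/
def truncD : TruncX V X →ₗ[ℂ] TruncX V X :=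
  (filtX V X 2).mapQ (filtX V X 2) (dolX V X (-1) + dolX V X 1) (dolX_filtX V X 2)

end Manifold2

end Forms


/-- `(-1)^n` -/
def sg (n : ℤ) : ℤ := (n.negOnePow : ℤ)

section Bundles

universe u v w

/-- A holomorphic vector bundle on `X`, that is a locally free sheaf of finite rank: complex vector
spaces `Fib x`, and around each `c ∈ X` a frame on an open set `dom c ∋ c` (with the coordinates
in that frame), such that all transition functions are holomorphic. The rank is locally constant; it
may differ on different connected components. Values outside `dom c` are irrelevant. -/
structure HolBundle (V : Type u) [NormedAddCommGroup V] [NormedSpace ℂ V]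
    (X : Type v) [TopologicalSpace X] [ChartedSpace V X] where
  Fib : X → Type w
  [addCommGroup : ∀ x, AddCommGroup (Fib x)]
  [module : ∀ x, Module ℂ (Fib x)]
  dom : X → Opens X
  mem_dom : ∀ c, c ∈ dom c
  rank : X → ℕ
  frame : ∀ c x : X, Fin (rank c) → Fib x
  coord : ∀ c x : X, Fib x →ₗ[ℂ] (Fin (rank c) → ℂ)
  coord_frame : ∀ c x, x ∈ dom c → ∀ a, coord c x (frame c x a) = Pi.single a 1
  sum_coord : ∀ c x, x ∈ dom c → ∀ e : Fib x, ∑ a, coord c x e a • frame c x a = e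
  holo : ∀ c c' a b, HolOn V (fun x => coord c x (frame c' x b) a) (dom c ∩ dom c' : Set X)

attribute [instance] HolBundle.addCommGroup HolBundle.module

/-- A finite complex `(E^*, δ)` of locally free sheaves of finite rank, in degrees `p, …, q`. The map
`δ i j` is the component `E^i → E^j` of the differential, which vanishes unless `j = i + 1`. -/
structure HolComplex (V : Type u) [NormedAddCommGroup V] [NormedSpace ℂ V]
    (X : Type v) [TopologicalSpace X] [ChartedSpace V X] (p q : ℤ) where
  bdl : Finset.Icc p q → HolBundle.{u, v, w} V X
  δ : ∀ i j x, (bdl i).Fib x →ₗ[ℂ] (bdl j).Fib x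
  δ_degree : ∀ (i j : Finset.Icc p q) x, (j : ℤ) ≠ i + 1 → δ i j x = 0
  δ_holo : ∀ i j c c' a b, HolOn V
    (fun x => (bdl j).coord c x (δ i j x ((bdl i).frame c' x b)) a)
    ((bdl j).dom c ∩ (bdl i).dom c' : Set X)
  δ_comp_δ : ∀ i j k x, δ j k x ∘ₗ δ i j x = 0

variable {V : Type u} [NormedAddCommGroup V] [NormedSpace ℂ V] [FiniteDimensional ℂ V]
  {X : Type v} [TopologicalSpace X] [ChartedSpace V X] [IsManifold 𝓘(ℂ, V) ω X] {p q : ℤ}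

namespace HolComplex

/-- The fibre `⨁ E^i_x`. -/
abbrev Tot (E : HolComplex.{u, v, w} V X p q) (x : X) : Type w := ∀ i, (E.bdl i).Fib x

/-- The fibre `Λ ⊗ ⨁ E^i_x` of the `E^*`-valued forms. -/
abbrev TotForm (E : HolComplex.{u, v, w} V X p q) (x : X) : Type (max u w) :=
  TensorProduct ℂ (Lam V) (E.Tot x)

variable (E : HolComplex.{u, v, w} V X p q)

/-- The frame vector `a` of `E^i` around `c`. -/
def vec (c : X) (i : Finset.Icc p q) (a : Fin ((E.bdl i).rank c)) (x : X) : E.Tot x :=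
  Pi.single i ((E.bdl i).frame c x a)

/-- The coordinate `a` of `E^i` in the frame around `c`. -/
def covec (c : X) (i : Finset.Icc p q) (a : Fin ((E.bdl i).rank c)) (x : X) :
    E.Tot x →ₗ[ℂ] ℂ :=
  LinearMap.proj a ∘ₗ (E.bdl i).coord c x ∘ₗ LinearMap.proj i

/-- The `Λ`-valued coordinate `a` in the frame of `E^i` around `c` of an `E^*`-valued form. -/
def coef (c : X) (i : Finset.Icc p q) (a : Fin ((E.bdl i).rank c)) (x : X) :
    E.TotForm x →ₗ[ℂ] Lam V :=
  (TensorProduct.rid ℂ (Lam V)).toLinearMap ∘ₗ (E.covec c i a x).lTensor (Lam V)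

lemma coef_tmul (c : X) (i : Finset.Icc p q) (a : Fin ((E.bdl i).rank c)) (x : X) (η : Lam V)
    (e : E.Tot x) : E.coef c i a x (η ⊗ₜ e) = E.covec c i a x e • η := by
  simp [coef]

lemma covec_vec_ne (c c' : X) {i j : Finset.Icc p q} (h : i ≠ j) (a : Fin ((E.bdl i).rank c))
    (b : Fin ((E.bdl j).rank c')) (x : X) : E.covec c i a x (E.vec c' j b x) = 0 := by
  simp [covec, vec, Pi.single_eq_of_ne h]

lemma covec_vec (c c' : X) (i : Finset.Icc p q) (a : Fin ((E.bdl i).rank c))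
    (b : Fin ((E.bdl i).rank c')) (x : X) :
    E.covec c i a x (E.vec c' i b x) = (E.bdl i).coord c x ((E.bdl i).frame c' x b) a := by
  simp [covec, vec]

lemma smoothOn_covec_vec (c c' : X) (i j : Finset.Icc p q) (a : Fin ((E.bdl i).rank c))
    (b : Fin ((E.bdl j).rank c')) :
    SmoothOn (fun x => algebraMap ℂ (Lam V) (E.covec c i a x (E.vec c' j b x)))
      ((E.bdl i).dom c ∩ (E.bdl j).dom c' : Set X) := by
  by_cases h : i = j
  · subst h
    simp only [covec_vec]
    exact ((E.bdl i).holo c c' a b).smooth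
  · simp only [covec_vec_ne E c c' h, map_zero]
    exact smoothOn_zero _

lemma coef_change {c c' x : X} {i : Finset.Icc p q} (hx : x ∈ (E.bdl i).dom c')
    (a : Fin ((E.bdl i).rank c)) (t : E.TotForm x) :
    E.coef c i a x t = ∑ b, algebraMap ℂ (Lam V)
      ((E.bdl i).coord c x ((E.bdl i).frame c' x b) a) * E.coef c' i b x t := by
  induction t using TensorProduct.induction_on with
  | zero => simp
  | tmul η e =>
    simp only [coef_tmul, ← Algebra.smul_def, smul_smul, ← Finset.sum_smul]
    congr 1
    have h := congrArg (fun e' => (E.bdl i).coord c x e' a)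
      ((E.bdl i).sum_coord c' x hx (e i))
    simp only [map_sum, map_smul, Finset.sum_apply, Pi.smul_apply, smul_eq_mul] at h
    simp only [covec, LinearMap.comp_apply, LinearMap.proj_apply]
    rw [← h]
    exact Finset.sum_congr rfl fun b _ => mul_comm _ _
  | add t t' h h' => simp only [map_add, h, h', mul_add, Finset.sum_add_distrib]

/-- Smooth `E^*`-valued forms `A^{*,*}(E^*)(U)` on an open set `U`, encoded by extension by zero:
their coordinates in the local frames are smooth forms. -/
def Sec (U : Opens X) : Submodule ℂ (∀ x, E.TotForm x) where
  carrier := {s | (∀ x, x ∉ U → s x = 0) ∧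
    ∀ c i a, SmoothOn (fun x => E.coef c i a x (s x)) (U ∩ (E.bdl i).dom c : Set X)}
  zero_mem' := ⟨fun _ _ => rfl, fun c i a => by simpa using smoothOn_zero _⟩
  add_mem' := fun {s t} h h' => ⟨fun x hx => by simp [h.1 x hx, h'.1 x hx], fun c i a => by
    simpa using (h.2 c i a).add (h'.2 c i a)⟩
  smul_mem' := fun r s h => ⟨fun x hx => by simp [h.1 x hx], fun c i a => by
    simpa using (h.2 c i a).smul r⟩

open Classical in
/-- Extension by zero outside `U`. -/
def extend (U : Opens X) (s : ∀ x, E.TotForm x) (x : X) : E.TotForm x :=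
  if x ∈ U then s x else 0

lemma extend_of_mem {U : Opens X} {x : X} (hx : x ∈ U) (s : ∀ x, E.TotForm x) :
    E.extend U s x = s x := if_pos hx

lemma extend_of_notMem {U : Opens X} {x : X} (hx : x ∉ U) (s : ∀ x, E.TotForm x) :
    E.extend U s x = 0 := if_neg hx

lemma extend_mem {U : Opens X} {s : ∀ x, E.TotForm x}
    (h : ∀ c i a, SmoothOn (fun x => E.coef c i a x (s x)) (U ∩ (E.bdl i).dom c : Set X)) :
    E.extend U s ∈ E.Sec U :=
  ⟨fun _ hx => E.extend_of_notMem hx s, fun c i a => (h c i a).congr fun x hx => by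
    rw [E.extend_of_mem hx.1]⟩

/-- The frame vectors as sections of `E^i` on the domain of the frame. -/
def frameSec (c : X) (i : Finset.Icc p q) (a : Fin ((E.bdl i).rank c)) : E.Sec ((E.bdl i).dom c) :=
  ⟨E.extend ((E.bdl i).dom c) fun x => 1 ⊗ₜ E.vec c i a x, E.extend_mem fun c' j b => by
    simp only [coef_tmul, ← Algebra.algebraMap_eq_smul_one]
    exact (E.smoothOn_covec_vec c' c j i b a).mono fun x hx => ⟨hx.2, hx.1⟩⟩

/-- The product of a form and an `E^*`-valued form. -/
def smul {U : Opens X} (φ : Frm V U) (s : E.Sec U) : E.Sec U :=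
  ⟨fun x => φ.1 x • s.1 x, fun x hx => by change φ.1 x • s.1 x = 0; rw [s.2.1 x hx, smul_zero], fun c i a => by
    have h : ∀ (x : X) (η : Lam V) (t : E.TotForm x),
        E.coef c i a x (η • t) = η * E.coef c i a x t := by
      intro x η t
      induction t using TensorProduct.induction_on with
      | zero => simp
      | tmul θ e => rw [TensorProduct.smul_tmul', coef_tmul, coef_tmul, smul_eq_mul, mul_smul_comm]
      | add t t' h h' => rw [smul_add, map_add, map_add, h, h', mul_add]
    simp only [h]
    exact (φ.2.2.mono Set.inter_subset_left).mul (s.2.2 c i a)⟩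

/-- The operator `∂̄` on `E^*`-valued forms, in coordinates of a holomorphic frame. -/
def delbarAt (s : ∀ x, E.TotForm x) (x : X) : E.TotForm x :=
  ∑ i, ∑ a, dol 1 (fun x' => E.coef x i a x' (s x')) x ⊗ₜ E.vec x i a x

/-- The operator `∂̄` may be computed in any holomorphic frame. -/
lemma coef_delbarAt {U : Opens X} {s : ∀ x, E.TotForm x} (hs : s ∈ E.Sec U) {c : X}
    {i : Finset.Icc p q} (a : Fin ((E.bdl i).rank c)) {x : X}
    (hx : x ∈ (U ∩ (E.bdl i).dom c : Set X)) :
    E.coef c i a x (E.delbarAt s x) = dol 1 (fun x' => E.coef c i a x' (s x')) x := by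
  have hO : IsOpen (U ∩ (E.bdl i).dom c ∩ (E.bdl i).dom x : Set X) :=
    (U.2.inter ((E.bdl i).dom c).2).inter ((E.bdl i).dom x).2
  have hxO : x ∈ (U ∩ (E.bdl i).dom c ∩ (E.bdl i).dom x : Set X) := ⟨hx, (E.bdl i).mem_dom x⟩
  have hg : ∀ b, HolOn V (fun x' => (E.bdl i).coord c x' ((E.bdl i).frame x x' b) a)
      (U ∩ (E.bdl i).dom c ∩ (E.bdl i).dom x : Set X) := fun b =>
    ((E.bdl i).holo c x a b).mono fun y hy => ⟨hy.1.2, hy.2⟩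
  have hco : ∀ b, SmoothOn (fun x' => E.coef x i b x' (s x'))
      (U ∩ (E.bdl i).dom c ∩ (E.bdl i).dom x : Set X) := fun b =>
    (hs.2 x i b).mono fun y hy => ⟨hy.1.1, hy.2⟩
  rw [dol_congr 1 hO (fun y hy => E.coef_change (c := c) (c' := x) hy.2 a (s y)) hxO,
    dol_sum _ 1 hO (fun b _ => (hg b).smooth.mul (hco b)) hxO, delbarAt, map_sum,
    Finset.sum_eq_single i]
  · rw [map_sum]
    refine Finset.sum_congr rfl fun b _ => ?_
    rw [dol_mul 1 hO (hg b).smooth (hco b) hxO, (hg b).dol_eq_zero hO hxO, coef_tmul, covec_vec,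
      AlgHom.commutes, Algebra.smul_def, zero_mul, zero_add]
  · intro j _ hj
    rw [map_sum]
    exact Finset.sum_eq_zero fun b _ => by rw [coef_tmul, covec_vec_ne E c x hj.symm, zero_smul]
  · simp

lemma coef_dol_open (U : Opens X) (i : Finset.Icc p q) (c : X) :
    IsOpen (U ∩ (E.bdl i).dom c : Set X) := U.2.inter ((E.bdl i).dom c).2

/-- The operator `∂̄` of `A^{*,*}(E^*)(U)`. -/
def delbarOn (U : Opens X) : Module.End ℂ (E.Sec U) where
  toFun s := ⟨E.extend U (E.delbarAt s.1), E.extend_mem fun c i a =>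
    ((s.2.2 c i a).dol 1 (E.coef_dol_open U i c)).congr fun x hx => E.coef_delbarAt s.2 a hx⟩
  map_add' s t := Subtype.ext <| funext fun x => by
    by_cases hx : x ∈ U
    · have hm : ∀ i, x ∈ (U ∩ (E.bdl i).dom x : Set X) := fun i => ⟨hx, (E.bdl i).mem_dom x⟩
      have h : ∀ i a, dol 1 (fun x' => E.coef x i a x' (s.1 x' + t.1 x')) x =
          dol 1 (fun x' => E.coef x i a x' (s.1 x')) x +
            dol 1 (fun x' => E.coef x i a x' (t.1 x')) x := fun i a => by
        simp only [map_add]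
        exact dol_add 1 (E.coef_dol_open U i x) (s.2.2 x i a) (t.2.2 x i a) (hm i)
      simp only [Submodule.coe_add, Pi.add_apply, E.extend_of_mem hx, delbarAt, h,
        TensorProduct.add_tmul, Finset.sum_add_distrib]
    · simp [E.extend_of_notMem hx]
  map_smul' r s := Subtype.ext <| funext fun x => by
    by_cases hx : x ∈ U
    · have hm : ∀ i, x ∈ (U ∩ (E.bdl i).dom x : Set X) := fun i => ⟨hx, (E.bdl i).mem_dom x⟩
      have h : ∀ i a, dol 1 (fun x' => E.coef x i a x' (r • s.1 x')) x =
          r • dol 1 (fun x' => E.coef x i a x' (s.1 x')) x := fun i a => by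
        simp only [map_smul]
        exact dol_smul 1 r (E.coef_dol_open U i x) (s.2.2 x i a) (hm i)
      simp only [Submodule.coe_smul, Pi.smul_apply, E.extend_of_mem hx, delbarAt, h,
        ← TensorProduct.smul_tmul', Finset.smul_sum, RingHom.id_apply]
    · simp [E.extend_of_notMem hx]

/-- The differential `δ` on the fibre `⨁ E^i_x`. -/
def δTot (x : X) : Module.End ℂ (E.Tot x) :=
  LinearMap.pi fun j => ∑ i, E.δ i j x ∘ₗ LinearMap.proj i

/-- The `Λ`-graded-linear extension of `δ`: `δ(η ⊗ e) = (-1)^{deg η} η ⊗ δ e`. -/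
def δForm (x : X) : Module.End ℂ (E.TotForm x) :=
  TensorProduct.map (par (V := V)).toLinearMap (E.δTot x)

lemma smoothOn_δForm {U : Opens X} (s : E.Sec U) (c : X) (j : Finset.Icc p q)
    (a : Fin ((E.bdl j).rank c)) :
    SmoothOn (fun x => E.coef c j a x (E.δForm x (s.1 x))) (U ∩ (E.bdl j).dom c : Set X) := by
  have h : ∀ x (t : E.TotForm x), E.coef c j a x (E.δForm x t) = ∑ i, 
      (TensorProduct.rid ℂ (Lam V)) (TensorProduct.map (par (V := V)).toLinearMap
        (LinearMap.proj a ∘ₗ (E.bdl j).coord c x ∘ₗ E.δ i j x ∘ₗ LinearMap.proj i) t) := by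
    intro x t
    induction t using TensorProduct.induction_on with
    | zero => simp
    | tmul η e =>
      simp [δForm, coef_tmul, covec, δTot, Finset.sum_smul]
    | add t t' h h' => simp only [map_add, h, h', Finset.sum_add_distrib]
  simp only [h]
  refine SmoothOn.sum _ fun i _ => smoothOn_of_local fun x₀ hx₀ =>
    ⟨(E.bdl i).dom x₀, ((E.bdl i).dom x₀).2, (E.bdl i).mem_dom x₀, ?_⟩
  have h2 : ∀ x ∈ (U ∩ (E.bdl j).dom c ∩ (E.bdl i).dom x₀ : Set X), ∀ t : E.TotForm x,
      (TensorProduct.rid ℂ (Lam V)) (TensorProduct.map (par (V := V)).toLinearMap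
        (LinearMap.proj a ∘ₗ (E.bdl j).coord c x ∘ₗ E.δ i j x ∘ₗ LinearMap.proj i) t) =
      ∑ b, algebraMap ℂ (Lam V) ((E.bdl j).coord c x (E.δ i j x ((E.bdl i).frame x₀ x b)) a) *
        par (E.coef x₀ i b x t) := by
    intro x hx t
    induction t using TensorProduct.induction_on with
    | zero => simp
    | tmul η e =>
      simp only [coef_tmul, map_smul, TensorProduct.map_tmul, TensorProduct.rid_tmul,
        ← Algebra.smul_def, smul_smul, ← Finset.sum_smul]
      congr 1
      have h := congrArg (fun e' => (E.bdl j).coord c x (E.δ i j x e') a)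
        ((E.bdl i).sum_coord x₀ x hx.2 (e i))
      simp only [map_sum, map_smul, Finset.sum_apply, Pi.smul_apply, smul_eq_mul] at h
      simp only [covec, LinearMap.comp_apply, LinearMap.proj_apply]
      rw [← h]
      exact Finset.sum_congr rfl fun b _ => mul_comm _ _
    | add t t' h h' => simp only [map_add, h, h', mul_add, Finset.sum_add_distrib]
  refine SmoothOn.congr (SmoothOn.sum Finset.univ fun b _ => ?_) fun x hx => h2 x hx (s.1 x)
  exact ((E.δ_holo i j c x₀ a b).smooth.mono fun y hy => ⟨hy.1.2, hy.2⟩).mul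
    (((s.2.2 x₀ i b).mono fun y hy => ⟨hy.1.1, hy.2⟩).par)

/-- The operator `δ` of `A^{*,*}(E^*)(U)`. -/
def δOn (U : Opens X) : Module.End ℂ (E.Sec U) where
  toFun s := ⟨fun x => E.δForm x (s.1 x), fun x hx => by change E.δForm x (s.1 x) = 0; rw [s.2.1 x hx, map_zero],
    E.smoothOn_δForm s⟩
  map_add' s t := Subtype.ext <| funext fun x => (E.δForm x).map_add (s.1 x) (t.1 x)
  map_smul' r s := Subtype.ext <| funext fun x => (E.δForm x).map_smul r (s.1 x)

instance (U : Opens X) : Ring (Module.End ℂ (E.Sec U)) := @Module.End.instRing ℂ (E.Sec U) _ _ _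

/-- Families of `ℂ`-linear endomorphisms of the `A^{*,*}(E^*)(U)` compatible with restrictions. -/
def sheafSubalgebra : Subalgebra ℂ (∀ U : Opens X, Module.End ℂ (E.Sec U)) where
  carrier := {T | ∀ (U W : Opens X), W ≤ U → ∀ (s : E.Sec U) (t : E.Sec W),
    (∀ x ∈ W, t.1 x = s.1 x) → ∀ x ∈ W, (T W t).1 x = (T U s).1 x}
  mul_mem' := fun {T T'} h h' U W hWU s t e x hx => h U W hWU _ _ (h' U W hWU s t e) x hx
  add_mem' := fun {T T'} h h' U W hWU s t e x hx => by
    simp only [Pi.add_apply, LinearMap.add_apply, Submodule.coe_add]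
    rw [h U W hWU s t e x hx, h' U W hWU s t e x hx]
  algebraMap_mem' := fun r U W hWU s t e x hx => by
    change r • t.1 x = r • s.1 x
    rw [e x hx]

/-- The algebra of `ℂ`-linear endomorphisms of the sheaf `A^{*,*}(E^*)`. -/
def SheafEnd : Type (max u v w) := E.sheafSubalgebra

instance : Ring E.SheafEnd := inferInstanceAs (Ring E.sheafSubalgebra)
instance : Algebra ℂ E.SheafEnd := inferInstanceAs (Algebra ℂ E.sheafSubalgebra)

/-- The endomorphism of `A^{*,*}(E^*)(U)` given by an endomorphism of the sheaf. -/
def SheafEnd.on {E : HolComplex.{u, v, w} V X p q} (T : E.SheafEnd) (U : Opens X) :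
    E.Sec U →ₗ[ℂ] E.Sec U := Subtype.val T U

/-- `∂̄` as an endomorphism of the sheaf `A^{*,*}(E^*)` -/
def delbar : E.SheafEnd := ⟨E.delbarOn, fun U W hWU s t e x hx => by
  change E.extend W _ x = E.extend U _ x
  rw [E.extend_of_mem hx, E.extend_of_mem (hWU hx), delbarAt, delbarAt]
  refine Finset.sum_congr rfl fun i _ => Finset.sum_congr rfl fun a _ => ?_
  rw [dol_congr 1 W.2 (fun y hy => by rw [e y hy]) hx]⟩

/-- `δ` as an endomorphism of the sheaf `A^{*,*}(E^*)` -/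
def δOp : E.SheafEnd := ⟨E.δOn, fun U W hWU s t e x hx => by
  change E.δForm x (t.1 x) = E.δForm x (s.1 x)
  rw [e x hx]⟩



/-- The component `E^r_x` of the fibre (zero unless `p ≤ r ≤ q`). -/
def totDeg (r : ℤ) (x : X) : Submodule ℂ (E.Tot x) where
  carrier := {e | ∀ i : Finset.Icc p q, (i : ℤ) ≠ r → e i = 0}
  zero_mem' := fun _ _ => rfl
  add_mem' := fun h h' i hi => by simp [h i hi, h' i hi]
  smul_mem' := fun c _ h i hi => by simp [h i hi]

/-- `Λ^{a,b} ⊗ E^r_x`, the fibre of `A^{a,b}(E^r)`. -/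
def formTyp (a b : ℕ) (r : ℤ) (x : X) : Submodule ℂ (E.TotForm x) :=
  Submodule.map₂ (TensorProduct.mk ℂ (Lam V) (E.Tot x)) (typ V a b) (E.totDeg r x)

/-- The part of total degree `n` of the fibre, the sum of `Λ^{a,b} ⊗ E^r_x` with `a + b + r = n`. -/
def formDeg (n : ℤ) (x : X) : Submodule ℂ (E.TotForm x) :=
  ⨆ (a : ℕ) (b : ℕ) (r : ℤ) (_ : a + b + r = n), E.formTyp a b r x

/-- The endomorphism `T` of `A^{*,*}(E^*)` has degree `k` for the total grading. -/
def IsOfDegree (T : E.SheafEnd) (k : ℤ) : Prop :=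
  ∀ (U : Opens X) (s : E.Sec U) (n : ℤ), (∀ x, s.1 x ∈ E.formDeg n x) →
    ∀ x, (T.on U s).1 x ∈ E.formDeg (n + k) x

/-- The graded commutator `[S, T] = S T - (-1)^{jk} T S` of endomorphisms `S` of degree `j` and `T` of
degree `k`. -/
def comm (j k : ℤ) : E.SheafEnd →ₗ[ℂ] E.SheafEnd →ₗ[ℂ] E.SheafEnd :=
  LinearMap.mul ℂ E.SheafEnd - (sg (j * k) : ℂ) • (LinearMap.mul ℂ E.SheafEnd).flip

/-- `A^{a,b}(Hom^n(E^*, E^*))`, as the space of the endomorphisms of the sheaf `A^{*,*}(E^*)` that map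
`A^{c,d}(E^r)` to `A^{a+c,b+d}(E^{r+n})` and are linear over the forms in the graded sense,
`T(φ s) = (-1)^{(a+b+n) deg φ} φ T(s)`. Here `ω ⊗ f` acts by
`(ω ⊗ f)(η ⊗ e) = (-1)^{deg f deg η} (ω ∧ η) ⊗ f e`. -/
def AHom (a b : ℕ) (n : ℤ) : Submodule ℂ E.SheafEnd where
  carrier := {T |
    (∀ (U : Opens X) (s : E.Sec U) (c d : ℕ) (r : ℤ), (∀ x, s.1 x ∈ E.formTyp c d r x) →
      ∀ x, (T.on U s).1 x ∈ E.formTyp (a + c) (b + d) (r + n) x) ∧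
    (∀ (U : Opens X) (φ : Frm V U) (s : E.Sec U) (m : ℤ), (∀ x, φ.1 x ∈ lamDeg V m) →
      T.on U (E.smul φ s) = sg ((a + b + n) * m) • E.smul φ (T.on U s))}
  zero_mem' := ⟨fun _ _ _ _ _ _ _ => Submodule.zero_mem _, fun U φ s m _ => by
    refine Subtype.ext (funext fun x => ?_)
    change (0 : E.TotForm x) = sg ((a + b + n) * m) • (φ.1 x • (0 : E.TotForm x))
    rw [smul_zero, smul_zero]⟩
  add_mem' := fun {T T'} h h' => ⟨fun U s c d r hs x =>
    Submodule.add_mem _ (h.1 U s c d r hs x) (h'.1 U s c d r hs x), fun U φ s m hφ => by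
    refine Subtype.ext (funext fun x => ?_)
    change ((T.on U (E.smul φ s)).1 x + (T'.on U (E.smul φ s)).1 x) =
      sg ((a + b + n) * m) • (φ.1 x • ((T.on U s).1 x + (T'.on U s).1 x))
    rw [h.2 U φ s m hφ, h'.2 U φ s m hφ, smul_add, smul_add]
    rfl⟩
  smul_mem' := fun r T h => ⟨fun U s c d k hs x =>
    Submodule.smul_mem _ r (h.1 U s c d k hs x), fun U φ s m hφ => by
    refine Subtype.ext (funext fun x => ?_)
    change r • (T.on U (E.smul φ s)).1 x =
      sg ((a + b + n) * m) • (φ.1 x • (r • (T.on U s).1 x))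
    rw [h.2 U φ s m hφ, smul_comm (φ.1 x) r, smul_comm _ r]
    rfl⟩

/-- The part of total degree `k` of `A^{*,*}(Hom^*(E^*, E^*))`. -/
def AHomDeg (k : ℤ) : Submodule ℂ E.SheafEnd :=
  ⨆ (a : ℕ) (b : ℕ) (n : ℤ) (_ : a + b + n = k), E.AHom a b n

/-- The part of total degree `k` of `A^{0,*}(Hom^*(E^*, E^*))`. -/
def A0HomDeg (k : ℤ) : Submodule ℂ E.SheafEnd :=
  ⨆ (b : ℕ) (n : ℤ) (_ : b + n = k), E.AHom 0 b n

/-- `s` is a holomorphic section of `E^r` on `U`. -/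
def IsHolSec {U : Opens X} (r : ℤ) (s : E.Sec U) : Prop :=
  ∃ e : ∀ x, E.Tot x, (∀ x ∈ U, e x ∈ E.totDeg r x ∧ s.1 x = 1 ⊗ₜ e x) ∧
    ∀ c i a, HolOn V (fun x => E.covec c i a x (e x)) (U ∩ (E.bdl i).dom c : Set X)

/-- A `(1,0)`-connection: a `ℂ`-linear endomorphism `D` of degree one of the sheaf `A^{*,*}(E^*)` with
`D(φ s) = dφ s + (-1)^{deg φ} φ D(s)` and `D(s) ∈ A^{1,0}(E^r)` for forms `φ` and holomorphic
sections `s` of `E^r`, on every open set. -/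
structure Connection where
  D : E.SheafEnd
  degree : E.IsOfDegree D 1
  leibniz : ∀ (U : Opens X) (m r : ℤ) (φ : Frm V U) (s : E.Sec U),
    (∀ x, φ.1 x ∈ lamDeg V m) → E.IsHolSec r s → ∀ x ∈ U,
      (D.on U (E.smul φ s)).1 x =
        (dol (-1) φ.1 x + dol 1 φ.1 x) • s.1 x + sg m • (φ.1 x • (D.on U s).1 x)
  type : ∀ (U : Opens X) (r : ℤ) (s : E.Sec U), E.IsHolSec r s →
    ∀ x, (D.on U s).1 x ∈ E.formTyp 1 0 r x

variable {E} in
/-- `∇ = [D - ∂̄, -]`, on elements of degree `j`. -/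
def Connection.nabla (D : E.Connection) (j : ℤ) : E.SheafEnd →ₗ[ℂ] E.SheafEnd :=
  E.comm 1 j (D.D - E.delbar)

variable {E} in
/-- The Atiyah cocycle `u = [D, ∂̄ + δ]`. -/
def Connection.atiyah (D : E.Connection) : E.SheafEnd := E.comm 1 1 D.D (E.delbar + E.δOp)

/-- The fibre `Hom^n(E^*, E^*)_x`. -/
def endDeg (n : ℤ) (x : X) : Submodule ℂ (Module.End ℂ (E.Tot x)) where
  carrier := {f | ∀ r, ∀ e ∈ E.totDeg r x, f e ∈ E.totDeg (r + n) x}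
  zero_mem' := fun _ _ _ => Submodule.zero_mem _
  add_mem' := fun h h' r e he => Submodule.add_mem _ (h r e he) (h' r e he)
  smul_mem' := fun c _ h r e he => Submodule.smul_mem _ c (h r e he)

/-- The elementary endomorphism `E^j → E^i` sending the frame vector `b` of `E^j` to `a` of `E^i`. -/
def elem (c : X) (i : Finset.Icc p q) (a : Fin ((E.bdl i).rank c)) (j : Finset.Icc p q)
    (b : Fin ((E.bdl j).rank c)) (x : X) : Module.End ℂ (E.Tot x) :=
  (E.covec c j b x).smulRight (E.vec c i a x)

/-- A cyclic form of degree zero: an `O_X`-bilinear form `Hom^*(E^*, E^*) × Hom^*(E^*, E^*) → O_X` of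
degree zero, graded symmetric, with `⟨f, [g, h]⟩ = ⟨[f, g], h⟩`. Being `O_X`-bilinear, it is given
on the fibres, and it is holomorphic in holomorphic frames. -/
structure CyclicForm where
  B : ∀ x, Module.End ℂ (E.Tot x) →ₗ[ℂ] Module.End ℂ (E.Tot x) →ₗ[ℂ] ℂ
  holo : ∀ (c : X) i a j b k a' l b',
    HolOn V (fun x => B x (E.elem c i a j b x) (E.elem c k a' l b' x))
      {x | ∀ i, x ∈ (E.bdl i).dom c}
  degree : ∀ x m n, ∀ f ∈ E.endDeg m x, ∀ g ∈ E.endDeg n x, m + n ≠ 0 → B x f g = 0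
  symm : ∀ x m n, ∀ f ∈ E.endDeg m x, ∀ g ∈ E.endDeg n x, B x f g = sg (m * n) • B x g f
  cyclic : ∀ x l m n, ∀ f ∈ E.endDeg l x, ∀ g ∈ E.endDeg m x, ∀ h ∈ E.endDeg n x,
    B x f (g * h - sg (m * n) • (h * g)) = B x (f * g - sg (l * m) • (g * f)) h

/-- The matrix entries of `T ∈ A^{*,*}(Hom^*(E^*, E^*))` in the frame around `x`, at `x`; that is,
`T = ∑ (entry T i x a j b) ⊗ (elem x i a j b x)` at `x`. -/
def entry (T : E.SheafEnd) (i : Finset.Icc p q) (x : X) (a : Fin ((E.bdl i).rank x))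
    (j : Finset.Icc p q) (b : Fin ((E.bdl j).rank x)) : Lam V :=
  E.coef x i a x ((T.on ((E.bdl j).dom x) (E.frameSec x j b)).1 x)

variable {E} in
/-- The natural extension of a cyclic form to `A^{*,*}(Hom^*(E^*, E^*))`,
`⟨φ ⊗ f, ψ ⊗ g⟩ = (-1)^{deg f deg ψ} ⟨f, g⟩ φ ∧ ψ`; the endomorphism `elem x i a j b x` has degree
`i - j`. -/
def CyclicForm.pair (B : E.CyclicForm) (T S : E.SheafEnd) (x : X) : Lam V :=
  ∑ i, ∑ a, ∑ j, ∑ b, ∑ k, ∑ a', ∑ l, ∑ b',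
    B.B x (E.elem x i a j b x) (E.elem x k a' l b' x) •
      (E.entry T i x a j b * (par^[((i : ℤ) - j).natAbs] (E.entry S k x a' l b')))

variable {E} in
/-- `⟨[D, f], g⟩ + (-1)^{deg f} ⟨f, [D, g]⟩ = d⟨f, g⟩` for all `f, g ∈ A^{*,*}(Hom^*(E^*, E^*))` -/
def Connection.IsCompatible (D : E.Connection) (B : E.CyclicForm) : Prop :=
  ∀ i j, ∀ f ∈ E.AHomDeg i, ∀ g ∈ E.AHomDeg j, ∀ x,
    B.pair (E.comm 1 i D.D f) g x + sg i • B.pair f (E.comm 1 j D.D g) x =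
      dol (-1) (B.pair f g) x + dol 1 (B.pair f g) x

end HolComplex
end Bundles

section LInfinity

variable (K : Type*) [Field K]

/-- The data of a DG-Lie algebra whose homogeneous parts are subspaces `gr k` of a vector space `W`.
The differential `d i` on degree `i` and the bracket `br i j` on degrees `i`, `j` are given on all
of `W`; only their values on homogeneous elements of the right degrees matter. -/
structure DGLieData (W : Type*) [AddCommGroup W] [Module K W] where
  gr : ℤ → Submodule K W
  d : ℤ → W →ₗ[K] W
  br : ℤ → ℤ → W →ₗ[K] W →ₗ[K] W

variable {K}

/-- The axioms of a differential graded Lie algebra, on `⨁ gr k`. -/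
structure DGLieData.IsDGLie {W : Type*} [AddCommGroup W] [Module K W] (L : DGLieData K W) :
    Prop where
  indep : iSupIndep L.gr
  d_mem : ∀ i, ∀ f ∈ L.gr i, L.d i f ∈ L.gr (i + 1)
  d_d : ∀ i, ∀ f ∈ L.gr i, L.d (i + 1) (L.d i f) = 0
  br_mem : ∀ i j, ∀ f ∈ L.gr i, ∀ g ∈ L.gr j, L.br i j f g ∈ L.gr (i + j)
  skew : ∀ i j, ∀ f ∈ L.gr i, ∀ g ∈ L.gr j, L.br i j f g = -(sg (i * j) • L.br j i g f)
  leibniz : ∀ i j, ∀ f ∈ L.gr i, ∀ g ∈ L.gr j,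
    L.d (i + j) (L.br i j f g) =
      L.br (i + 1) j (L.d i f) g + sg i • L.br i (j + 1) f (L.d j g)
  jacobi : ∀ i j k, ∀ f ∈ L.gr i, ∀ g ∈ L.gr j, ∀ h ∈ L.gr k,
    L.br i (j + k) f (L.br j k g h) =
      L.br (i + j) k (L.br i j f g) h + sg (i * j) • L.br j (i + k) g (L.br i k f h)

/-- The `(P, n-P)`-shuffles: permutations `σ` with `σ 0 < ⋯ < σ (P-1)` and
`σ P < ⋯ < σ (n-1)`. -/
def shuffles (n P : ℕ) : Finset (Equiv.Perm (Fin n)) :=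
  {σ | ∀ i j : Fin n, i < j → ((j : ℕ) < P ∨ P ≤ (i : ℕ)) → σ i < σ j}

/-- The antisymmetric Koszul sign of `v_{σ 0} ∧ ⋯ ∧ v_{σ (n-1)} = ± v_0 ∧ ⋯ ∧ v_{n-1}`, `v_i` of
degree `k i`: a factor `-(-1)^{k (σ i) k (σ j)}` for every inversion of `σ`. -/
def koszul {n : ℕ} (k : Fin n → ℤ) (σ : Equiv.Perm (Fin n)) : ℤ :=
  ∏ ij : Fin n × Fin n with ij.1 < ij.2 ∧ σ ij.2 < σ ij.1, -sg (k (σ ij.1) * k (σ ij.2))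

/-- An `L_∞` morphism of DG-Lie algebras `A ⇝ L`: a sequence of graded skew-symmetric multilinear maps
`g n` on `⨁ A.gr k`, `n ≥ 1`, of degree `1 - n`, with `g 1` a morphism of complexes and, for
`n = m + 2 ≥ 2`,
`½ ∑_{p=1}^{n-1} ∑_σ χ(σ) (-1)^{(1-n+p)(k_{σ1} + ⋯ + k_{σp} - p)}
[g_p(v_{σ1}, …, v_{σp}), g_{n-p}(v_{σ(p+1)}, …, v_{σn})] + d g_n(v_1, …, v_n)`
`= (-1)^{n-1} ∑_σ χ(σ) g_n(d v_{σ1}, v_{σ2}, …, v_{σn})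
+ (-1)^{n-2} ∑_σ χ(σ) g_{n-1}([v_{σ1}, v_{σ2}], v_{σ3}, …, v_{σn})`,
the sums over the `(p, n-p)`-, `(1, n-1)`- and `(2, n-2)`-shuffles with Koszul sign `χ(σ)`
(`P = p - 1`; the summand has degree `k_{σ1} + ⋯ + k_{σp} + 1 - p` in its first entry). The value
`g 0` and the values outside `⨁ A.gr k` are irrelevant. -/
structure LInftyMorphism {W W' : Type*} [AddCommGroup W] [Module K W] [AddCommGroup W']
    [Module K W'] (A : DGLieData K W) (L : DGLieData K W') where
  g : ∀ n : ℕ, MultilinearMap K (fun _ : Fin n => W) W'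
  skew : ∀ (n : ℕ) (k : Fin n → ℤ) (v : Fin n → W), 1 ≤ n → (∀ i, v i ∈ A.gr (k i)) →
    ∀ σ : Equiv.Perm (Fin n), g n (fun i => v (σ i)) = koszul k σ • g n v
  degree : ∀ (n : ℕ) (k : Fin n → ℤ) (v : Fin n → W), 1 ≤ n → (∀ i, v i ∈ A.gr (k i)) →
    g n v ∈ L.gr (∑ i, k i + 1 - n)
  chain : ∀ (k : ℤ), ∀ v ∈ A.gr k, g 1 ![A.d k v] = L.d k (g 1 ![v])
  rel : ∀ (m : ℕ) (k : Fin (m + 2) → ℤ) (v : Fin (m + 2) → W), (∀ i, v i ∈ A.gr (k i)) →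
    (2⁻¹ : K) • (∑ P : Fin (m + 1), ∑ σ ∈ shuffles (m + 2) (P + 1),
        (koszul k σ * sg ((1 - (m + 2) + (P + 1)) *
          (∑ i : Fin (P + 1), k (σ ⟨i, by omega⟩) - (P + 1)))) •
        L.br (∑ i : Fin (P + 1), k (σ ⟨i, by omega⟩) + 1 - (P + 1))
          (∑ j : Fin (m + 1 - P), k (σ ⟨P + 1 + j, by omega⟩) + 1 - (m + 1 - P))
          (g (P + 1) fun i => v (σ ⟨i, by omega⟩))
          (g (m + 1 - P) fun j => v (σ ⟨P + 1 + j, by omega⟩))) +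
      L.d (∑ i, k i + 1 - (m + 2)) (g (m + 2) v) =
    sg (m + 1) • ∑ σ ∈ shuffles (m + 2) 1, koszul k σ •
        g (m + 2) (Fin.cons (A.d (k (σ 0)) (v (σ 0))) fun i : Fin (m + 1) => v (σ i.succ)) +
    sg m • ∑ σ ∈ shuffles (m + 2) 2, koszul k σ •
        g (m + 1) (Fin.cons (A.br (k (σ 0)) (k (σ 1)) (v (σ 0)) (v (σ 1)))
          fun i : Fin m => v (σ i.succ.succ))

end LInfinity

section Main

universe u v w

variable (V : Type u) [NormedAddCommGroup V] [NormedSpace ℂ V] [FiniteDimensional ℂ V]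
  (X : Type v) [TopologicalSpace X] [ChartedSpace V X] [IsManifold 𝓘(ℂ, V) ω X]

/-- `A^{a,b}`, the global forms of type `(a,b)`. -/
def typX (a b : ℕ) : Submodule ℂ (Frm V (⊤ : Opens X)) where
  carrier := {η | ∀ x, η.1 x ∈ typ V a b}
  zero_mem' := fun _ => Submodule.zero_mem _
  add_mem' := fun h h' x => Submodule.add_mem _ (h x) (h' x)
  smul_mem' := fun c _ h x => Submodule.smul_mem _ c (h x)

/-- The complex `(A^{*,*} / A^{≥ 2,*})[2]`, a DG-Lie algebra with zero bracket: its part of degree `k`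
consists of the classes of forms of total degree `k + 2`, and the sign `(-1)^2` of the shifted
differential is trivial. -/
def truncDGLie : DGLieData ℂ (TruncX V X) where
  gr k := ⨆ (a : ℕ) (b : ℕ) (_ : (a : ℤ) + b = k + 2), (typX V X a b).map (filtX V X 2).mkQ
  d _ := truncD V X
  br _ _ := 0

variable {V X} {p q : ℤ} (E : HolComplex.{u, v, w} V X p q)

/-- The DG-Lie algebra `A^{0,*}(Hom^*(E^*, E^*))`, with differential `[∂̄ + δ, -]` and the graded
commutator as bracket. -/
def HolComplex.dolbeaultDGLie : DGLieData ℂ E.SheafEnd where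
  gr := E.A0HomDeg
  d k := E.comm 1 k (E.delbar + E.δOp)
  br := E.comm

end Main
end HolCx

end

open HolCx

/-! Write `d = ∂̄ + δ` on the source and `N = D - ∂̄`, so that `∇ = [N, -]` and the Atiyah cocycle
becomes `u = [N, d]` (`Connection.atiyah_eq_comm`), since `[∂̄, d] = 0`. The bracket of the target
is zero, so the quadratic terms of the `L_∞` relations vanish. What remains, with Koszul signed sums
over shuffles, is: `g_1` is a chain map; `d g_2 = -∑ g_2(d -, -) + g_1([-, -])`; `d g_3 = ∑ g_3(d -,
-, -) - ∑ g_2([-, -], -)`; and `∑ g_3([-, -], -, -) = 0`. From `n = 5` on every term is zero.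

Three facts give these relations.

(1) Since `d² = 0`, the graded Jacobi identity yields the Bianchi identity `[d, u] = 0`
(`Connection.dolb_atiyah`) and the curvature formula `[d, ∇f] = -∇[d, f] + [u, f]`
(`Connection.dolb_nabla`).

(2) Cyclicity gives `⟨[δ, f], g⟩ + (-1)^f ⟨f, [δ, g]⟩ = 0`. Adding this zero to the compatibility of
`D` with the form, where `D = N + ∂̄`, yields `d⟨f, g⟩ = ⟨∇f + [d, f], g⟩ + (-1)^f ⟨f, ∇g + [d, g]⟩`
(`Connection.IsCompatible.truncD_pairQ`).

(3) `∇` raises the holomorphic form degree by one and `u` has holomorphic form degree one. In the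
quotient by `A^{≥2,*}` every pairing of total holomorphic degree two is zero, so a `∇` acting on a
pairing that already contains `u` or another `∇` disappears.

Now `d⟨u, f⟩ = ⟨u, [d, f]⟩` by (1) and (3). In `d g_2` the curvature formula produces `⟨[u, f], g⟩`
and `⟨f, [u, g]⟩`, which cyclicity turns into two equal halves of `⟨u, [f, g]⟩ = g_1([f, g])`. In `d
g_3` the pairing has holomorphic degree zero, so the three `∇`-terms survive; each occurs three
times in `∑ g_2([-, -], -)`, twice with one sign and once with the other, which leaves exactly what
is needed (`Connection.IsCompatible.truncD_pairQ_comm`). The relation for `n = 4` is the Jacobi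
identity paired with one of the arguments (`CyclicForm.pairQ_comm_comm`).

The remaining work puts these objects into the right spaces. A sheaf endomorphism is determined
locally by its values on products of homogeneous forms with frame sections (`sheafEnd_ext_homGen`);
this extends the Leibniz rule of `D` from holomorphic sections to all sections, and shows that the
commutators `∇f` and `u` are linear over the forms. An operator linear over the forms is, at each
point, a form-valued matrix independent of the frame (`IsLin.fibreAt_eq`). The extended cyclic form
thereby becomes a pairing on `Λ ⊗ End(E_x)`, where symmetry and cyclicity are sign computations,
while smoothness is visible in a fixed frame.

Finally, the homogeneous parts are independent because a homothety of the tangent spaces acts on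
degree `k` by a power of `2` that determines `k`. The same independence supplies a linear operator
equal to `(-1)^k` in degree `k`, so that formulas with degree-dependent signs define multilinear
maps on all endomorphisms. -/

namespace HolCx

/-! ### Signs `(-1)^n` -/

section Signs

lemma sg_add (m n : ℤ) : sg (m + n) = sg m * sg n := by simp [sg, Int.negOnePow_add]

@[simp] lemma sg_zero : sg 0 = 1 := by simp [sg]

@[simp] lemma sg_one : sg 1 = -1 := by simp [sg]

@[simp] lemma sg_two : sg 2 = 1 := by decide

@[simp] lemma sg_neg (n : ℤ) : sg (-n) = sg n := by simp [sg, Int.negOnePow_neg]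

lemma sg_eq (n : ℤ) : sg n = 1 ∨ sg n = -1 := by
  rcases Int.units_eq_one_or n.negOnePow with h | h <;> simp [sg, h]

lemma sg_even {n : ℤ} (h : Even n) : sg n = 1 := by simp [sg, Int.negOnePow_even n h]

lemma sg_odd {n : ℤ} (h : Odd n) : sg n = -1 := by simp [sg, Int.negOnePow_odd n h]

lemma sg_eq_one_iff {n : ℤ} : sg n = 1 ↔ Even n := by
  refine ⟨fun h => ?_, sg_even⟩
  by_contra h'
  rw [Int.not_even_iff_odd] at h'
  rw [sg_odd h'] at h
  omega

/-- The sign `(-1)^{mn}` in terms of `(-1)^m` and `(-1)^n`. -/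
def sgPair (a b : ℤ) : ℤ := if a = 1 then 1 else b

/-- Expands every sign of a product of degrees in terms of the parities of the factors, so that a
sign identity becomes a finite check over values `±1`. -/
lemma sg_mul (m n : ℤ) : sg (m * n) = sgPair (sg m) (sg n) := by
  unfold sgPair
  split_ifs with h
  · exact sg_even ((sg_eq_one_iff.1 h).mul_right n)
  · have h' : Odd m := by rw [← Int.not_even_iff_odd, ← sg_eq_one_iff]; exact h
    rcases Int.even_or_odd n with hn | hn
    · rw [sg_even hn, sg_even (hn.mul_left m)]
    · rw [sg_odd hn, sg_odd (h'.mul hn)]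

@[simp] lemma sgPair_one (b : ℤ) : sgPair 1 b = 1 := by simp [sgPair]

@[simp] lemma sgPair_neg_one (b : ℤ) : sgPair (-1) b = b := by simp [sgPair]

lemma sg_mul_self (n : ℤ) : sg n * sg n = 1 := by
  rcases sg_eq n with h | h <;> simp [h]

end Signs

/-! ### The bigraded algebra of forms at a point -/

section LamAlgebra

variable {V : Type*} [NormedAddCommGroup V] [NormedSpace ℂ V] [FiniteDimensional ℂ V]

lemma par_par (a : Lam V) : par (par a) = a := CliffordAlgebra.involute_involute a

/-- The automorphism `par` to the power `n`. -/
noncomputable def parPow (n : ℤ) : Lam V →ₐ[ℂ] Lam V := if sg n = 1 then AlgHom.id ℂ _ else par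

lemma parPow_of_even {n : ℤ} (h : sg n = 1) (a : Lam V) : parPow n a = a := by simp [parPow, h]

lemma parPow_of_odd {n : ℤ} (h : sg n = -1) (a : Lam V) : parPow n a = par a := by
  simp [parPow, h]

lemma parPow_congr {m n : ℤ} (h : sg m = sg n) : parPow (V := V) m = parPow n := by
  simp [parPow, h]

@[simp] lemma parPow_zero (a : Lam V) : parPow 0 a = a := parPow_of_even sg_zero a

lemma parPow_add (m n : ℤ) (a : Lam V) : parPow (m + n) a = parPow m (parPow n a) := by
  rcases sg_eq m with hm | hm <;> rcases sg_eq n with hn | hn <;>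
    have h := sg_add m n <;> rw [hm, hn] at h <;>
    simp only [parPow_of_even, parPow_of_odd, h, hm, hn, par_par, mul_one, mul_neg, neg_neg]

/-- The parity automorphism is an involution, so passing to the absolute value in the definition of
`CyclicForm.pair` does no harm. -/
lemma par_iterate (n : ℤ) (a : Lam V) : par^[n.natAbs] a = parPow n a := by
  have key : ∀ k : ℕ, par^[k] a = parPow (k : ℤ) a := by
    intro k
    induction k with
    | zero => simp
    | succ k ih =>
      rw [Function.iterate_succ_apply', ih, Nat.cast_succ, add_comm, parPow_add,
        parPow_of_odd sg_one]
  rw [key]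
  rcases Int.natAbs_eq n with h | h
  · rw [← h]
  · conv_rhs => rw [h]
    rw [parPow_congr (sg_neg _)]

lemma one_mem_typ : (1 : Lam V) ∈ typ V 0 0 := by
  rw [typ, pow_zero, pow_zero, one_mul]; exact Submodule.one_le.mp le_rfl

lemma typ_mul_typ (a b a' b' : ℕ) : typ V a b * typ V a' b' = typ V (a + a') (b + b') := by
  have h : Commute ((covAnti.map (cov (V := V))) ^ b) ((covHol.map cov) ^ a') :=
    Commute.pow_pow hol_anti_comm b a'
  simp only [typ]
  rw [pow_add, pow_add, mul_assoc, ← mul_assoc _ _ ((covAnti.map (cov (V := V))) ^ b'), h.eq]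
  simp only [mul_assoc]

lemma mul_mem_typ {a b a' b' : ℕ} {x y : Lam V} (hx : x ∈ typ V a b) (hy : y ∈ typ V a' b') :
    x * y ∈ typ V (a + a') (b + b') := by
  rw [← typ_mul_typ]; exact Submodule.mul_mem_mul hx hy

/-- Induction on forms of type `(a, b)` by multiplying with one-forms. -/
lemma typ_induction {C : ℕ → ℕ → Lam V → Prop} (h1 : C 0 0 1)
    (hadd : ∀ a b x y, C a b x → C a b y → C a b (x + y)) (hsmul : ∀ (r : ℂ) a b x, C a b x → C a b (r • x))
    (hhol : ∀ a b x, ∀ α ∈ covHol (V := V), C a b x → C (a + 1) b (cov α * x))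
    (hanti : ∀ a b x, ∀ α ∈ covAnti (V := V), C a b x → C a (b + 1) (cov α * x))
    {a b : ℕ} {x : Lam V} (hx : x ∈ typ V a b) : C a b x := by
  induction a generalizing x with
  | zero =>
    induction b generalizing x with
    | zero =>
      rw [typ, pow_zero, pow_zero, one_mul] at hx
      obtain ⟨r, rfl⟩ := Submodule.mem_one.1 hx
      rw [Algebra.algebraMap_eq_smul_one]
      exact hsmul _ _ _ _ h1
    | succ b ih =>
      rw [← anti_mul_typ] at hx
      induction hx using Submodule.mul_induction_on' with
      | mem_mul_mem m hm n hn =>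
        obtain ⟨α, hα, rfl⟩ := hm
        exact hanti _ _ _ _ hα (ih hn)
      | add x _ y _ hx hy => exact hadd _ _ _ _ hx hy
  | succ a ih =>
    rw [← hol_mul_typ] at hx
    induction hx using Submodule.mul_induction_on' with
    | mem_mul_mem m hm n hn =>
      obtain ⟨α, hα, rfl⟩ := hm
      exact hhol _ _ _ _ hα (ih hn)
    | add x _ y _ hx hy => exact hadd _ _ _ _ hx hy

lemma par_of_typ {a b : ℕ} {x : Lam V} (hx : x ∈ typ V a b) : par x = sg (a + b) • x := by
  refine typ_induction (C := fun a b x => par x = sg (a + b) • x) ?_ ?_ ?_ ?_ ?_ hx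
  · simp
  · intro a b x y h h'; rw [map_add, h, h', smul_add]
  · intro r a b x h; rw [map_smul, h, smul_comm]
  all_goals
    intro a b x α _ h
    rw [map_mul, par_cov, h]
    push_cast
    simp only [sg_add, sg_one, mul_neg, neg_mul, mul_one, neg_smul, mul_smul_comm, smul_neg]

lemma parPow_of_typ (n : ℤ) {a b : ℕ} {x : Lam V} (hx : x ∈ typ V a b) :
    parPow n x = sg (n * (a + b)) • x := by
  rw [sg_mul]
  rcases sg_eq n with h | h
  · rw [parPow_of_even h, h]; simp
  · rw [parPow_of_odd h, h, par_of_typ hx]; simp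

/-- One-forms are moved past `y` one at a time. Because `y` is arbitrary, the sign has to be carried
by the automorphism `parPow` acting on `y`. -/
lemma typ_mul_comm {a b : ℕ} {x : Lam V} (hx : x ∈ typ V a b) (y : Lam V) :
    x * y = parPow (a + b) y * x := by
  refine typ_induction (C := fun a b x => x * y = parPow (a + b) y * x) ?_ ?_ ?_ ?_ ?_ hx
  · simp
  · intro a b x y h h'; rw [add_mul, h, h', mul_add]
  · intro r a b x h; rw [smul_mul_assoc, h, mul_smul_comm]
  all_goals
    intro a b x α _ h
    rw [mul_assoc, h, ← mul_assoc, cov_mul, mul_assoc]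
    congr 1
    push_cast
    rw [← parPow_of_odd sg_one, ← parPow_add]
    congr 2; ring

lemma typ_mul_comm_typ {a b a' b' : ℕ} {x y : Lam V} (hx : x ∈ typ V a b) (hy : y ∈ typ V a' b') :
    x * y = sg ((a + b) * (a' + b')) • (y * x) := by
  rw [typ_mul_comm hx, parPow_of_typ _ hy, smul_mul_assoc]

lemma typ_le_lamDeg (a b : ℕ) {m : ℤ} (h : (a : ℤ) + b = m) : typ V a b ≤ lamDeg V m :=
  le_iSup_of_le a (le_iSup_of_le b (le_iSup_of_le h le_rfl))

/-- To prove a linear condition on forms of degree `m`, consider those of type `(a, b)`. -/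
lemma lamDeg_le {m : ℤ} {P : Submodule ℂ (Lam V)}
    (h : ∀ a b : ℕ, (a : ℤ) + b = m → typ V a b ≤ P) : lamDeg V m ≤ P :=
  iSup_le fun a => iSup_le fun b => iSup_le fun e => h a b e

lemma parPow_of_lamDeg (n : ℤ) {m : ℤ} {x : Lam V} (hx : x ∈ lamDeg V m) :
    parPow n x = sg (n * m) • x := by
  have h : lamDeg V m ≤ LinearMap.ker ((parPow (V := V) n).toLinearMap -
      (sg (n * m) : ℂ) • LinearMap.id) := by
    refine lamDeg_le fun a b e x hx => ?_
    rw [LinearMap.mem_ker]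
    simp [parPow_of_typ n hx, ← e, Int.cast_smul_eq_zsmul]
  have := h hx
  rw [LinearMap.mem_ker] at this
  simpa [sub_eq_zero, Int.cast_smul_eq_zsmul] using this

lemma mul_mem_lamDeg {m n : ℤ} {x y : Lam V} (hx : x ∈ lamDeg V m) (hy : y ∈ lamDeg V n) :
    x * y ∈ lamDeg V (m + n) := by
  have h : lamDeg V m * lamDeg V n ≤ lamDeg V (m + n) := by
    simp only [lamDeg, Submodule.iSup_mul, Submodule.mul_iSup]
    refine iSup_le fun a => iSup_le fun b => iSup_le fun e => iSup_le fun a' => iSup_le fun b' =>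
      iSup_le fun e' => ?_
    rw [typ_mul_typ]
    exact typ_le_lamDeg _ _ (by push_cast; omega)
  exact h (Submodule.mul_mem_mul hx hy)

lemma range_cov_eq : LinearMap.range (cov (V := V)) = covHol.map cov ⊔ covAnti.map cov := by
  refine le_antisymm ?_ ?_
  · rintro _ ⟨α, rfl⟩
    have : α = cpart (-1) α + cpart 1 α := by
      ext v; rw [add_apply, cpart_apply, cpart_apply]; module
    rw [this, map_add]
    exact Submodule.add_mem_sup ⟨_, cpart_hol α, rfl⟩ ⟨_, cpart_anti α, rfl⟩
  · exact sup_le LinearMap.map_le_range LinearMap.map_le_range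

/-- Every one-form is the sum of its `ℂ`-linear and its antilinear part, so a product of `m`
one-forms expands into types `(a, b)` with `a + b = m`. This connects the grading of the exterior
algebra with `lamDeg`. -/
lemma range_cov_pow_le (m : ℕ) : (LinearMap.range (cov (V := V))) ^ m ≤ lamDeg V m := by
  induction m with
  | zero =>
    rw [pow_zero, Submodule.one_le]
    exact typ_le_lamDeg 0 0 (by simp) one_mem_typ
  | succ m ih =>
    have h1 : (LinearMap.range (cov (V := V))) ≤ lamDeg V 1 := by
      rw [range_cov_eq]
      refine sup_le ?_ ?_
      · refine le_trans (le_of_eq ?_) (typ_le_lamDeg 1 0 (by simp))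
        rw [typ, pow_one, pow_zero, mul_one]
      · refine le_trans (le_of_eq ?_) (typ_le_lamDeg 0 1 (by simp))
        rw [typ, pow_one, pow_zero, one_mul]
    rw [pow_succ', Submodule.mul_le]
    intro x hx y hy
    have := mul_mem_lamDeg (h1 hx) (ih hy)
    rwa [add_comm, ← Nat.cast_succ] at this

section ExteriorProjection

variable {M : Type*} [AddCommGroup M] [Module ℂ M]

/-- The projection of the exterior algebra to its component of degree `m`. -/
noncomputable def extProj (m : ℕ) : ExteriorAlgebra ℂ M →ₗ[ℂ] ExteriorAlgebra ℂ M :=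
  GradedAlgebra.proj (fun i : ℕ => ⋀[ℂ]^i M) m

lemma extProj_mem (m : ℕ) (x : ExteriorAlgebra ℂ M) : extProj m x ∈ ⋀[ℂ]^m M :=
  SetLike.coe_mem (DirectSum.decompose (fun i : ℕ => ⋀[ℂ]^i M) x m)

lemma extProj_of_mem (m : ℕ) {i : ℕ} {x : ExteriorAlgebra ℂ M} (hx : x ∈ ⋀[ℂ]^i M) :
    extProj m x = if i = m then x else 0 := by
  rw [extProj, GradedAlgebra.proj_apply]
  split_ifs with h
  · subst h; exact DirectSum.decompose_of_mem_same _ hx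
  · exact DirectSum.decompose_of_mem_ne _ hx h

lemma extProj_map (A : ExteriorAlgebra ℂ M →ₐ[ℂ] ExteriorAlgebra ℂ M)
    (hA : ∀ i : ℕ, ∀ y ∈ ⋀[ℂ]^i M, A y ∈ ⋀[ℂ]^i M) (m : ℕ) (x : ExteriorAlgebra ℂ M) :
    A (extProj m x) = extProj m (A x) := by
  refine DirectSum.Decomposition.inductionOn (fun i : ℕ => ⋀[ℂ]^i M)
    (motive := fun x => A (extProj m x) = extProj m (A x)) ?_ ?_ ?_ x
  · simp
  · intro i y
    rw [extProj_of_mem m y.2, extProj_of_mem m (hA i _ y.2)]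
    split_ifs <;> simp
  · intro y z hy hz
    rw [map_add, map_add, map_add, map_add, hy, hz]

variable (M) in
-- A bound on the degrees for each vector of a finite basis gives, by linearity, one bound for all
-- elements. The uniformity in `x` is what is needed later to decompose functions on a manifold.
lemma exists_sum_extProj [Module.Finite ℂ (ExteriorAlgebra ℂ M)] :
    ∃ N : ℕ, ∀ x : ExteriorAlgebra ℂ M, ∑ m ∈ Finset.range N, extProj m x = x := by
  classical
  set b := Module.finBasis ℂ (ExteriorAlgebra ℂ M)
  have h1 : ∀ x : ExteriorAlgebra ℂ M, ∃ N : ℕ, ∀ N' ≥ N,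
      ∑ m ∈ Finset.range N', extProj m x = x := by
    intro x
    set s := DFinsupp.support (DirectSum.decompose (fun i : ℕ => ⋀[ℂ]^i M) x)
    have hs : ∑ m ∈ s, extProj m x = x :=
      DirectSum.sum_support_decompose (fun i : ℕ => ⋀[ℂ]^i M) x
    refine ⟨s.sup id + 1, fun N' hN' => ?_⟩
    refine Eq.trans ?_ hs
    symm
    refine Finset.sum_subset ?_ ?_
    · intro m hm
      have := Finset.le_sup (f := id) hm
      simp only [id] at this
      rw [Finset.mem_range]; omega
    · intro m _ hm
      have := DFinsupp.notMem_support_iff.1 hm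
      exact congrArg Subtype.val this
  choose N hN using h1
  refine ⟨Finset.univ.sup fun j => N (b j), fun x => ?_⟩
  have : ∑ m ∈ Finset.range (Finset.univ.sup fun j => N (b j)), extProj (M := M) m =
      LinearMap.id := by
    refine b.ext fun j => ?_
    rw [LinearMap.sum_apply]
    exact hN _ _ (Finset.le_sup (f := fun j => N (b j)) (Finset.mem_univ j))
  simpa using congrArg (fun f => f x) this

end ExteriorProjection

/-- The component of degree `m` of a form. -/
noncomputable def lamProj (m : ℕ) : Lam V →ₗ[ℂ] Lam V := extProj (M := V →L[ℝ] ℂ) m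

lemma lamProj_mem (m : ℕ) (x : Lam V) : lamProj m x ∈ lamDeg V m :=
  range_cov_pow_le m (extProj_mem (M := V →L[ℝ] ℂ) m x)

lemma pull_lamProj (A : V →L[ℂ] V) (m : ℕ) (x : Lam V) :
    pull A (lamProj m x) = lamProj m (pull A x) := by
  refine extProj_map (M := V →L[ℝ] ℂ) (pull A) (fun i y hy => ?_) m x
  have h : (LinearMap.range (cov (V := V)) ^ i).map (pull A).toLinearMap ≤
      LinearMap.range (cov (V := V)) ^ i := by
    rw [Submodule.map_pow]
    refine pow_le_pow_left' ?_ i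
    rintro _ ⟨_, ⟨α, rfl⟩, rfl⟩
    exact ⟨_, (pull_cov A α).symm⟩
  exact h ⟨y, hy, rfl⟩

variable (V) in
lemma exists_sum_lamProj : ∃ N : ℕ, ∀ x : Lam V, ∑ m ∈ Finset.range N, lamProj m x = x := by
  have : Module.Finite ℂ (ExteriorAlgebra ℂ (V →L[ℝ] ℂ)) :=
    inferInstanceAs (Module.Finite ℂ (Lam V))
  exact exists_sum_extProj (V →L[ℝ] ℂ)

/-- The scaling of the tangent space by a real number. -/
noncomputable def scaleMap (t : ℝ) : V →L[ℂ] V := (t : ℂ) • ContinuousLinearMap.id ℂ V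

/-- A homothety multiplies each one-form by `t`, so the degree of a form can be read off from an
eigenvalue. The independence of the gradings rests on this. -/
lemma pull_scaleMap_typ (t : ℝ) {a b : ℕ} {x : Lam V} (hx : x ∈ typ V a b) :
    pull (scaleMap t) x = (t : ℂ) ^ (a + b) • x := by
  refine typ_induction (C := fun a b x => pull (scaleMap t) x = (t : ℂ) ^ (a + b) • x)
    ?_ ?_ ?_ ?_ ?_ hx
  · simp
  · intro a b x y h h'; rw [map_add, h, h', smul_add]
  · intro r a b x h; rw [map_smul, h, smul_comm]
  all_goals
    intro a b x α _ h
    have e : α.comp ((scaleMap (V := V) t).restrictScalars ℝ) = (t : ℂ) • α := by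
      ext v; simp [scaleMap]
    rw [map_mul, h, pull_cov, e, map_smul, smul_mul_assoc, mul_smul_comm, smul_smul, ← pow_succ']
    congr 2 <;> ring

lemma pull_scaleMap_comm (t : ℝ) (A : V →L[ℂ] V) (x : Lam V) :
    pull A (pull (scaleMap t) x) = pull (scaleMap t) (pull A x) := by
  rw [pull_pull, pull_pull]; congr 1; ext v; simp [scaleMap]

end LamAlgebra

/-! ### Second-order relations and types for the operators `∂` and `∂̄` -/

section Dolbeault

variable {V : Type*} [NormedAddCommGroup V] [NormedSpace ℂ V] [FiniteDimensional ℂ V]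

/-- The left multiplications by one-forms, with a real-linear argument. -/
lemma fderiv_wedge_cpart (s : ℂ) {F : V → V →L[ℝ] Lam V} {y : V} (hF : DifferentiableAt ℝ F y)
    (v : V) : DifferentiableAt ℝ (fun z => wedge (cpart s (F z))) y ∧
      fderiv ℝ (fun z => wedge (cpart s (F z))) y v = wedge (cpart s (fderiv ℝ F y v)) := by
  let Φ : (V →L[ℝ] Lam V) →ₗ[ℝ] Lam V :=
    { toFun := fun T => wedge (cpart s T)
      map_add' := fun T T' => by rw [cpart_add, wedge_add]
      map_smul' := fun r T => by
        rw [← Complex.coe_smul, cpart_smul, wedge_smul, Complex.coe_smul]; rfl }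
  have h := Φ.toContinuousLinearMap.hasFDerivAt.comp y hF.hasFDerivAt
  have h' : HasFDerivAt (fun z => wedge (cpart s (F z))) _ y := h
  refine ⟨h'.differentiableAt, ?_⟩
  rw [h'.fderiv]; rfl

/-- Second derivatives are symmetric and one-forms anticommute. Treating both operators through a
single parameter covers `∂² = 0`, `∂̄² = 0` and `∂∂̄ + ∂̄∂ = 0` at once. -/
lemma flatD_flatD (s s' : ℂ) {η : V → Lam V} {y : V} (hη : ContDiffAt ℝ ∞ η y) :
    flatD s (flatD s' η) y + flatD s' (flatD s η) y = 0 := by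
  have h1 : DifferentiableAt ℝ (fderiv ℝ η) y :=
    (hη.fderiv_right (m := 1) (by norm_num; exact WithTop.coe_le_coe.2 le_top)).differentiableAt one_ne_zero
  have hsymm : IsSymmSndFDerivAt ℝ η y := hη.isSymmSndFDerivAt (by simp; exact WithTop.coe_le_coe.2 le_top)
  have key : ∀ s s' : ℂ, flatD s (flatD s' η) y = ∑ k, ∑ l,
      cov (cpart s (Complex.ofRealCLM.comp
        ((Module.finBasis ℝ V).coord k).toContinuousLinearMap)) *
      (cov (cpart s' (Complex.ofRealCLM.comp
        ((Module.finBasis ℝ V).coord l).toContinuousLinearMap)) *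
      fderiv ℝ (fderiv ℝ η) y (Module.finBasis ℝ V k) (Module.finBasis ℝ V l)) := by
    intro s s'
    rw [flatD, wedge_cpart]
    refine Finset.sum_congr rfl fun k _ => ?_
    have := (fderiv_wedge_cpart s' h1 (Module.finBasis ℝ V k)).2
    change fderiv ℝ (flatD s' η) y _ = _ at this
    rw [this, wedge_cpart, Finset.mul_sum]
  -- After the summation indices of one double sum are exchanged, the two sums cancel term by term.
  rw [key, key s' s, Finset.sum_comm, ← Finset.sum_add_distrib]
  refine Finset.sum_eq_zero fun k _ => ?_
  rw [← Finset.sum_add_distrib]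
  refine Finset.sum_eq_zero fun l _ => ?_
  rw [← mul_assoc, ← mul_assoc, cov_mul_comm, hsymm]
  simp

variable {X : Type*} [TopologicalSpace X] [ChartedSpace V X] [IsManifold 𝓘(ℂ, V) ω X]

/-- `dol` at `y` uses the chart centred at `y`. Independence of the chart, `chartRep_dol`, lets the
inner operator be computed in one chart on a whole neighbourhood, where the flat statement applies.
-/
lemma dol_dol (s s' : ℂ) {η : X → Lam V} {S : Set X} (hS : IsOpen S) (h : SmoothOn η S) {x : X}
    (hx : x ∈ S) : dol s (dol s' η) x + dol s' (dol s η) x = 0 := by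
  have hm := mem_chartDom (V := V) hx (mem_extChartAt_source x)
  have hn := (isOpen_chartDom (V := V) x hS).mem_nhds hm
  have e : ∀ s s' : ℂ, dol s (dol s' η) x =
      flatD s (flatD s' (inChart x η)) (extChartAt 𝓘(ℂ, V) x x) := by
    intro s s'
    rw [dol]
    have : inChart x (dol s' η) =ᶠ[nhds (extChartAt 𝓘(ℂ, V) x x)] flatD s' (inChart x η) := by
      filter_upwards [hn] with y hy
      rw [inChart, chartRep_dol s' hS h hy.2 ((extChartAt 𝓘(ℂ, V) x).map_target hy.1),
        (extChartAt 𝓘(ℂ, V) x).right_inv hy.1]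
    rw [flatD, this.fderiv_eq]; rfl
  rw [e, e]
  exact flatD_flatD s s' ((h x).contDiffAt hn)

lemma dol_hol_mem {η : X → Lam V} {S : Set X} (hS : IsOpen S) {a b : ℕ} {x : X} (hx : x ∈ S)
    (h : ∀ y ∈ S, η y ∈ typ V a b) : dol (-1) η x ∈ typ V (a + 1) b := by
  rw [← hol_mul_typ]
  refine flatD_mem_hol _ ?_
  filter_upwards [(isOpen_chartDom (V := V) x hS).mem_nhds
    (mem_chartDom hx (mem_extChartAt_source x))] with y hy
  exact pull_typ _ _ _ (h _ hy.2)

lemma dol_anti_mem {η : X → Lam V} {S : Set X} (hS : IsOpen S) {a b : ℕ} {x : X} (hx : x ∈ S)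
    (h : ∀ y ∈ S, η y ∈ typ V a b) : dol 1 η x ∈ typ V a (b + 1) := by
  rw [← anti_mul_typ]
  refine flatD_mem_anti _ ?_
  filter_upwards [(isOpen_chartDom (V := V) x hS).mem_nhds
    (mem_chartDom hx (mem_extChartAt_source x))] with y hy
  exact pull_typ _ _ _ (h _ hy.2)

/-- A linear endomorphism of `Λ` that commutes with pull-backs preserves smoothness. -/
lemma SmoothOn.comp_linear {η : X → Lam V} {S : Set X} (h : SmoothOn η S) (L : Lam V →ₗ[ℂ] Lam V)
    (hL : ∀ (A : V →L[ℂ] V) x, pull A (L x) = L (pull A x)) : SmoothOn (fun x => L (η x)) S := by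
  intro c
  unfold inChart; simp only [chartRep, hL]
  exact ((L.toContinuousLinearMap.restrictScalars ℝ).contDiff.comp_contDiffOn (h c))

end Dolbeault

end HolCx

namespace HolCx

universe u v w

/-! ### Forms on open sets -/

section FormsOnOpens

variable {V : Type u} [NormedAddCommGroup V] [NormedSpace ℂ V] [FiniteDimensional ℂ V]
  {X : Type v} [TopologicalSpace X] [ChartedSpace V X] [IsManifold 𝓘(ℂ, V) ω X]

open Classical in
/-- The form on `U` given by a function that is smooth on `U`. -/
noncomputable def frmOf (U : Opens X) (η : X → Lam V) (h : SmoothOn η (U : Set X)) : Frm V U :=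
  ⟨fun x => if x ∈ U then η x else 0, fun _ hx => if_neg hx,
    h.congr fun _ hx => if_pos hx⟩

lemma frmOf_apply {U : Opens X} {η : X → Lam V} (h : SmoothOn η (U : Set X)) {x : X} (hx : x ∈ U) :
    (frmOf U η h).1 x = η x := if_pos hx

lemma frm_ext {U : Opens X} {φ ψ : Frm V U} (h : ∀ x ∈ U, φ.1 x = ψ.1 x) : φ = ψ :=
  Subtype.ext <| funext fun x => by
    by_cases hx : x ∈ U
    · exact h x hx
    · rw [φ.2.1 x hx, ψ.2.1 x hx]

lemma frm_mem {U : Opens X} {φ : Frm V U} {P : Submodule ℂ (Lam V)} (h : ∀ x ∈ U, φ.1 x ∈ P)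
    (x : X) : φ.1 x ∈ P := by
  by_cases hx : x ∈ U
  · exact h x hx
  · rw [φ.2.1 x hx]; exact P.zero_mem

/-- Restriction of forms. -/
noncomputable def frmRestr {U W : Opens X} (h : W ≤ U) (φ : Frm V U) : Frm V W :=
  frmOf W φ.1 (φ.2.2.mono h)

lemma frmRestr_apply {U W : Opens X} (h : W ≤ U) (φ : Frm V U) {x : X} (hx : x ∈ W) :
    (frmRestr h φ).1 x = φ.1 x := frmOf_apply _ hx

/-- The exterior product of forms. -/
noncomputable def frmMul {U : Opens X} (φ ψ : Frm V U) : Frm V U :=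
  frmOf U (fun x => φ.1 x * ψ.1 x) (φ.2.2.mul ψ.2.2)

lemma frmMul_apply {U : Opens X} (φ ψ : Frm V U) {x : X} (hx : x ∈ U) :
    (frmMul φ ψ).1 x = φ.1 x * ψ.1 x := frmOf_apply _ hx

/-- The operators `∂` and `∂̄` on forms on an open set. -/
noncomputable def frmDol (s : ℂ) {U : Opens X} (φ : Frm V U) : Frm V U :=
  frmOf U (dol s φ.1) (φ.2.2.dol s U.2)

lemma frmDol_apply (s : ℂ) {U : Opens X} (φ : Frm V U) {x : X} (hx : x ∈ U) :
    (frmDol s φ).1 x = dol s φ.1 x := frmOf_apply _ hx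

lemma frmDol_frmRestr (s : ℂ) {U W : Opens X} (h : W ≤ U) (φ : Frm V U) :
    frmDol s (frmRestr h φ) = frmRestr h (frmDol s φ) := frm_ext fun x hx => by
  rw [frmDol_apply s _ hx, frmRestr_apply h _ hx, frmDol_apply s _ (h hx)]
  exact dol_congr s W.2 (fun y hy => frmRestr_apply h φ hy) hx

lemma frmDol_frmDol (s s' : ℂ) {U : Opens X} (φ : Frm V U) :
    frmDol s (frmDol s' φ) + frmDol s' (frmDol s φ) = 0 := frm_ext fun x hx => by
  change (frmDol s (frmDol s' φ)).1 x + (frmDol s' (frmDol s φ)).1 x = 0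
  rw [frmDol_apply _ _ hx, frmDol_apply _ _ hx,
    dol_congr s U.2 (fun y hy => frmDol_apply s' φ hy) hx,
    dol_congr s' U.2 (fun y hy => frmDol_apply s φ hy) hx]
  exact dol_dol s s' U.2 φ.2.2 hx

lemma frmDol_frmMul (s : ℂ) {U : Opens X} {m : ℤ} {φ : Frm V U} (hφ : ∀ x, φ.1 x ∈ lamDeg V m)
    (ψ : Frm V U) : frmDol s (frmMul φ ψ) = frmMul (frmDol s φ) ψ + sg m • frmMul φ (frmDol s ψ) :=
  frm_ext fun x hx => by
    change _ = (frmMul (frmDol s φ) ψ).1 x + sg m • (frmMul φ (frmDol s ψ)).1 x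
    have h := parPow_of_lamDeg 1 (hφ x)
    rw [parPow_of_odd sg_one, one_mul] at h
    rw [frmDol_apply s _ hx, frmMul_apply _ _ hx, frmMul_apply _ _ hx, frmDol_apply s _ hx,
      frmDol_apply s _ hx, dol_congr s U.2 (fun y hy => frmMul_apply φ ψ hy) hx,
      dol_mul s U.2 φ.2.2 ψ.2.2 hx, h, smul_mul_assoc]

lemma pull_lamDeg (A : V →L[ℂ] V) {m : ℤ} {x : Lam V} (h : x ∈ lamDeg V m) :
    pull A x ∈ lamDeg V m := by
  have : lamDeg V m ≤ (lamDeg V m).comap (pull A).toLinearMap :=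
    lamDeg_le fun a b e y hy => typ_le_lamDeg a b e (pull_typ A a b hy)
  exact this h

lemma frmDol_lamDeg_neg_one {U : Opens X} {m : ℤ} {φ : Frm V U} (hφ : ∀ x, φ.1 x ∈ lamDeg V m) :
    ∀ x, (frmDol (-1) φ).1 x ∈ lamDeg V (m + 1) := frm_mem fun x hx => by
  rw [frmDol_apply _ _ hx]
  have h1 : covHol.map (cov (V := V)) ≤ lamDeg V 1 := by
    refine le_trans (le_of_eq ?_) (typ_le_lamDeg 1 0 (by simp))
    rw [typ, pow_one, pow_zero, mul_one]
  have h2 : (covHol.map (cov (V := V))) * lamDeg V m ≤ lamDeg V (m + 1) := by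
    rw [Submodule.mul_le]
    intro y hy z hz
    rw [add_comm]
    exact mul_mem_lamDeg (h1 hy) hz
  exact h2 (flatD_mem_hol _ (Filter.Eventually.of_forall fun z => pull_lamDeg _ (hφ _)))

lemma frmDol_lamDeg_one {U : Opens X} {m : ℤ} {φ : Frm V U} (hφ : ∀ x, φ.1 x ∈ lamDeg V m) :
    ∀ x, (frmDol 1 φ).1 x ∈ lamDeg V (m + 1) := frm_mem fun x hx => by
  rw [frmDol_apply _ _ hx]
  have h1 : covAnti.map (cov (V := V)) ≤ lamDeg V 1 := by
    refine le_trans (le_of_eq ?_) (typ_le_lamDeg 0 1 (by simp))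
    rw [typ, pow_one, pow_zero, one_mul]
  have h2 : (covAnti.map (cov (V := V))) * lamDeg V m ≤ lamDeg V (m + 1) := by
    rw [Submodule.mul_le]
    intro y hy z hz
    rw [add_comm]
    exact mul_mem_lamDeg (h1 hy) hz
  exact h2 (flatD_mem_anti _ (Filter.Eventually.of_forall fun z => pull_lamDeg _ (hφ _)))

/-- The component of degree `m` of a form. -/
noncomputable def frmProj (m : ℕ) {U : Opens X} (φ : Frm V U) : Frm V U :=
  frmOf U (fun x => lamProj m (φ.1 x)) (φ.2.2.comp_linear _ fun A x => pull_lamProj A m x)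

lemma frmProj_mem (m : ℕ) {U : Opens X} (φ : Frm V U) (x : X) :
    (frmProj m φ).1 x ∈ lamDeg V m := frm_mem (fun x hx => by
  rw [frmProj, frmOf_apply _ hx]; exact lamProj_mem m _) x

/-- The bound is the pointwise one, which does not depend on the point. Rules known for homogeneous
coefficients thus extend to all coefficients. -/
lemma exists_sum_frmProj {U : Opens X} (φ : Frm V U) :
    ∃ N : ℕ, φ = ∑ m ∈ Finset.range N, frmProj m φ := by
  obtain ⟨N, hN⟩ := exists_sum_lamProj V
  refine ⟨N, frm_ext fun x hx => ?_⟩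
  rw [← hN (φ.1 x), Submodule.coe_sum, Finset.sum_apply]
  exact Finset.sum_congr rfl fun m _ => (frmOf_apply
    (φ.2.2.comp_linear _ fun A x => pull_lamProj A m x) hx).symm

end FormsOnOpens

variable {V : Type u} [NormedAddCommGroup V] [NormedSpace ℂ V] [FiniteDimensional ℂ V]
  {X : Type v} [TopologicalSpace X] [ChartedSpace V X] [IsManifold 𝓘(ℂ, V) ω X] {p q : ℤ}

namespace HolComplex

variable (E : HolComplex.{u, v, w} V X p q)

/-! ### Bundle-valued forms at a point -/

section Fibres

lemma coef_smul (c : X) (i : Finset.Icc p q) (a : Fin ((E.bdl i).rank c)) (x : X) (η : Lam V)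
    (t : E.TotForm x) : E.coef c i a x (η • t) = η * E.coef c i a x t := by
  induction t using TensorProduct.induction_on with
  | zero => simp
  | tmul θ e => rw [TensorProduct.smul_tmul', coef_tmul, coef_tmul, smul_eq_mul, mul_smul_comm]
  | add t t' h h' => rw [smul_add, map_add, map_add, h, h', mul_add]

lemma sum_covec {c x : X} (hx : ∀ i, x ∈ (E.bdl i).dom c) (e : E.Tot x) :
    ∑ i, ∑ a, E.covec c i a x e • E.vec c i a x = e := by
  funext j
  rw [Finset.sum_apply, Finset.sum_eq_single j]
  · conv_rhs => rw [← (E.bdl j).sum_coord c x (hx j) (e j)]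
    rw [Finset.sum_apply]
    refine Finset.sum_congr rfl fun a _ => ?_
    simp [covec, vec]
  · intro i _ hi
    rw [Finset.sum_apply]
    refine Finset.sum_eq_zero fun a _ => ?_
    simp [vec, Pi.single_eq_of_ne hi.symm]
  · simp

/-- The expansion of a form with values in `E^*` in a frame. -/
lemma sum_coef {c x : X} (hx : ∀ i, x ∈ (E.bdl i).dom c) (t : E.TotForm x) :
    ∑ i, ∑ a, E.coef c i a x t ⊗ₜ[ℂ] E.vec c i a x = t := by
  induction t using TensorProduct.induction_on with
  | zero => simp
  | tmul θ e =>
    simp only [coef_tmul, TensorProduct.smul_tmul]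
    simp only [← TensorProduct.tmul_sum]
    rw [E.sum_covec hx]
  | add t t' h h' => simp only [map_add, TensorProduct.add_tmul, Finset.sum_add_distrib, h, h']

lemma smul_tmul_eq {x : X} (η : Lam V) (e : E.Tot x) :
    η ⊗ₜ[ℂ] e = η • ((1 : Lam V) ⊗ₜ[ℂ] e) := by
  rw [TensorProduct.smul_tmul', smul_eq_mul, mul_one]

lemma vec_mem_totDeg (c : X) (i : Finset.Icc p q) (a : Fin ((E.bdl i).rank c)) (x : X) :
    E.vec c i a x ∈ E.totDeg i x := fun j hj => by
  have : j ≠ i := fun h => hj (by rw [h])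
  simp [vec, Pi.single_eq_of_ne this]

lemma covec_of_totDeg {c x : X} {i : Finset.Icc p q} (a : Fin ((E.bdl i).rank c)) {r : ℤ}
    (h : (i : ℤ) ≠ r) {e : E.Tot x} (he : e ∈ E.totDeg r x) : E.covec c i a x e = 0 := by
  simp [covec, he i h]

lemma tmul_mem_formTyp {a b : ℕ} {r : ℤ} {x : X} {η : Lam V} {e : E.Tot x} (hη : η ∈ typ V a b)
    (he : e ∈ E.totDeg r x) : η ⊗ₜ[ℂ] e ∈ E.formTyp a b r x :=
  Submodule.apply_mem_map₂ _ hη he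

lemma coef_mem_typ {c x : X} {i : Finset.Icc p q} (k : Fin ((E.bdl i).rank c)) {a b : ℕ} {r : ℤ}
    {t : E.TotForm x} (ht : t ∈ E.formTyp a b r x) : E.coef c i k x t ∈ typ V a b := by
  have : E.formTyp a b r x ≤ (typ V a b).comap (E.coef c i k x) := by
    refine Submodule.map₂_le.2 fun η hη e _ => ?_
    rw [Submodule.mem_comap, TensorProduct.mk_apply, coef_tmul]
    exact Submodule.smul_mem _ _ hη
  exact this ht

lemma coef_eq_zero {c x : X} {i : Finset.Icc p q} (k : Fin ((E.bdl i).rank c)) {a b : ℕ} {r : ℤ}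
    (h : (i : ℤ) ≠ r) {t : E.TotForm x} (ht : t ∈ E.formTyp a b r x) : E.coef c i k x t = 0 := by
  have : E.formTyp a b r x ≤ LinearMap.ker (E.coef c i k x) := by
    refine Submodule.map₂_le.2 fun η _ e he => ?_
    rw [LinearMap.mem_ker, TensorProduct.mk_apply, coef_tmul, E.covec_of_totDeg k h he, zero_smul]
  exact this ht

lemma smul_mem_formTyp {a b a' b' : ℕ} {r : ℤ} {x : X} {η : Lam V} {t : E.TotForm x}
    (hη : η ∈ typ V a b) (ht : t ∈ E.formTyp a' b' r x) :
    η • t ∈ E.formTyp (a + a') (b + b') r x := by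
  have : E.formTyp a' b' r x ≤
      (E.formTyp (a + a') (b + b') r x).comap (Algebra.lsmul ℂ ℂ (E.TotForm x) η) := by
    refine Submodule.map₂_le.2 fun θ hθ e he => ?_
    rw [Submodule.mem_comap, TensorProduct.mk_apply, Algebra.lsmul_coe]
    change η • (θ ⊗ₜ[ℂ] e) ∈ _
    rw [TensorProduct.smul_tmul']
    exact E.tmul_mem_formTyp (mul_mem_typ hη hθ) he
  exact this ht

end Fibres

/-! ### Sections, frames and local generation -/

section Sections

lemma sec_ext {U : Opens X} {s t : E.Sec U} (h : ∀ x ∈ U, s.1 x = t.1 x) : s = t :=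
  Subtype.ext <| funext fun x => by
    by_cases hx : x ∈ U
    · exact h x hx
    · rw [s.2.1 x hx, t.2.1 x hx]

lemma sec_mem {U : Opens X} {s : E.Sec U} {P : ∀ x, Submodule ℂ (E.TotForm x)}
    (h : ∀ x ∈ U, s.1 x ∈ P x) (x : X) : s.1 x ∈ P x := by
  by_cases hx : x ∈ U
  · exact h x hx
  · rw [s.2.1 x hx]; exact (P x).zero_mem

/-- Restriction of sections. -/
noncomputable def restr {U W : Opens X} (h : W ≤ U) : E.Sec U →ₗ[ℂ] E.Sec W where
  toFun s := ⟨E.extend W s.1, E.extend_mem fun c i a =>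
    (s.2.2 c i a).mono fun _ hx => ⟨h hx.1, hx.2⟩⟩
  map_add' s t := E.sec_ext fun x hx => by
    change E.extend W _ x = E.extend W _ x + E.extend W _ x
    rw [E.extend_of_mem hx, E.extend_of_mem hx, E.extend_of_mem hx]; rfl
  map_smul' r s := E.sec_ext fun x hx => by
    change E.extend W _ x = r • E.extend W _ x
    rw [E.extend_of_mem hx, E.extend_of_mem hx]; rfl

lemma restr_apply {U W : Opens X} (h : W ≤ U) (s : E.Sec U) {x : X} (hx : x ∈ W) :
    (E.restr h s).1 x = s.1 x := E.extend_of_mem hx _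

variable {E} in
lemma SheafEnd.on_restr (T : E.SheafEnd) {U W : Opens X} (h : W ≤ U) (s : E.Sec U) :
    T.on W (E.restr h s) = E.restr h (T.on U s) := E.sec_ext fun x hx => by
  rw [E.restr_apply h _ hx]
  exact T.2 U W h s (E.restr h s) (fun y hy => E.restr_apply h s hy) x hx

variable {E} in
lemma SheafEnd.ext' {T S : E.SheafEnd} (h : ∀ U s, T.on U s = S.on U s) : T = S :=
  Subtype.ext <| funext fun U => LinearMap.ext fun s => h U s

variable {E} in
lemma SheafEnd.mul_on (T S : E.SheafEnd) (U : Opens X) (s : E.Sec U) :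
    (T * S).on U s = T.on U (S.on U s) := rfl

variable {E} in
lemma SheafEnd.add_on (T S : E.SheafEnd) (U : Opens X) (s : E.Sec U) :
    (T + S).on U s = T.on U s + S.on U s := rfl

variable {E} in
lemma SheafEnd.sub_on (T S : E.SheafEnd) (U : Opens X) (s : E.Sec U) :
    (T - S).on U s = T.on U s - S.on U s := rfl

variable {E} in
lemma SheafEnd.smul_on (r : ℂ) (T : E.SheafEnd) (U : Opens X) (s : E.Sec U) :
    (r • T).on U s = r • T.on U s := rfl

variable {E} in
lemma SheafEnd.zero_on (U : Opens X) (s : E.Sec U) : (0 : E.SheafEnd).on U s = 0 := rfl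

lemma comm_apply (j k : ℤ) (S T : E.SheafEnd) :
    E.comm j k S T = S * T - sg (j * k) • (T * S) := by
  simp [comm, Int.cast_smul_eq_zsmul]

lemma smul_apply {U : Opens X} (φ : Frm V U) (s : E.Sec U) (x : X) :
    (E.smul φ s).1 x = φ.1 x • s.1 x := rfl

lemma smul_add' {U : Opens X} (φ : Frm V U) (s t : E.Sec U) :
    E.smul φ (s + t) = E.smul φ s + E.smul φ t :=
  Subtype.ext <| funext fun _ => smul_add _ _ _

lemma add_smul' {U : Opens X} (φ ψ : Frm V U) (s : E.Sec U) :
    E.smul (φ + ψ) s = E.smul φ s + E.smul ψ s :=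
  Subtype.ext <| funext fun _ => add_smul _ _ _

lemma smul_zero' {U : Opens X} (φ : Frm V U) : E.smul φ (0 : E.Sec U) = 0 :=
  Subtype.ext <| funext fun _ => smul_zero _

lemma zero_smul' {U : Opens X} (s : E.Sec U) : E.smul (0 : Frm V U) s = 0 :=
  Subtype.ext <| funext fun _ => zero_smul _ _

lemma smul_smul' {U : Opens X} (r : ℂ) (φ : Frm V U) (s : E.Sec U) :
    E.smul φ (r • s) = r • E.smul φ s :=
  Subtype.ext <| funext fun x => smul_comm (φ.1 x) r (s.1 x)

lemma smul_zsmul' {U : Opens X} (n : ℤ) (φ : Frm V U) (s : E.Sec U) :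
    E.smul φ (n • s) = n • E.smul φ s :=
  Subtype.ext <| funext fun x => smul_comm (φ.1 x) n (s.1 x)

lemma zsmul_smul' {U : Opens X} (n : ℤ) (φ : Frm V U) (s : E.Sec U) :
    E.smul (n • φ) s = n • E.smul φ s :=
  Subtype.ext <| funext fun x => smul_assoc n (φ.1 x) (s.1 x)

lemma sum_smul' {κ : Type*} (t : Finset κ) {U : Opens X} (φ : κ → Frm V U) (s : E.Sec U) :
    E.smul (∑ k ∈ t, φ k) s = ∑ k ∈ t, E.smul (φ k) s := by
  classical
  induction t using Finset.induction_on with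
  | empty => simp [zero_smul']
  | insert a t ha ih => rw [Finset.sum_insert ha, Finset.sum_insert ha, add_smul', ih]

lemma smul_frmMul {U : Opens X} (φ ψ : Frm V U) (s : E.Sec U) :
    E.smul φ (E.smul ψ s) = E.smul (frmMul φ ψ) s := E.sec_ext fun x hx => by
  rw [smul_apply, smul_apply, smul_apply, frmMul_apply _ _ hx, mul_smul]

lemma restr_smul {U W : Opens X} (h : W ≤ U) (φ : Frm V U) (s : E.Sec U) :
    E.restr h (E.smul φ s) = E.smul (frmRestr h φ) (E.restr h s) := E.sec_ext fun x hx => by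
  rw [E.restr_apply h _ hx, smul_apply, smul_apply, E.restr_apply h _ hx, frmRestr_apply h _ hx]

/-- An open neighbourhood of `c` on which all frames around `c` are defined. -/
noncomputable def frameDom (c : X) : Opens X := Finset.univ.inf fun i => (E.bdl i).dom c

lemma frameDom_le (c : X) (i : Finset.Icc p q) : E.frameDom c ≤ (E.bdl i).dom c :=
  Finset.inf_le (Finset.mem_univ i)

lemma mem_frameDom (c : X) : c ∈ E.frameDom c := by
  have : (c : X) ∈ ((E.frameDom c : Opens X) : Set X) := by
    rw [frameDom, Opens.coe_finset_inf]
    simp only [Finset.mem_univ, Finset.inf_set_eq_iInter, Function.comp_apply, Set.iInter_true,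
      Set.mem_iInter]
    exact fun i => (E.bdl i).mem_dom c
  exact this

lemma frameSec_apply {c x : X} {i : Finset.Icc p q} (hx : x ∈ (E.bdl i).dom c)
    (a : Fin ((E.bdl i).rank c)) : (E.frameSec c i a).1 x = 1 ⊗ₜ E.vec c i a x :=
  E.extend_of_mem hx fun x => 1 ⊗ₜ E.vec c i a x

lemma isHolSec_frame (c : X) (i : Finset.Icc p q) (a : Fin ((E.bdl i).rank c)) {W : Opens X}
    (h : W ≤ (E.bdl i).dom c) : E.IsHolSec i (E.restr h (E.frameSec c i a)) := by
  refine ⟨fun x => E.vec c i a x, fun x hx => ⟨E.vec_mem_totDeg c i a x, ?_⟩, fun c' j b => ?_⟩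
  · rw [E.restr_apply h _ hx, E.frameSec_apply (h hx)]
  · by_cases hij : j = i
    · subst hij
      simp only [covec_vec]
      exact ((E.bdl j).holo c' c b a).mono fun x hx => ⟨hx.2, h hx.1⟩
    · simp only [E.covec_vec_ne c' c hij]
      exact contMDiffOn_const

/-- The coordinates of a section in a frame. -/
noncomputable def coefFrm (c : X) (i : Finset.Icc p q) (a : Fin ((E.bdl i).rank c))
    {U W : Opens X} (hU : W ≤ U) (hW : W ≤ (E.bdl i).dom c) (s : E.Sec U) : Frm V W :=
  frmOf W (fun x => E.coef c i a x (s.1 x)) ((s.2.2 c i a).mono fun _ hx => ⟨hU hx, hW hx⟩)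

lemma coefFrm_apply (c : X) (i : Finset.Icc p q) (a : Fin ((E.bdl i).rank c))
    {U W : Opens X} (hU : W ≤ U) (hW : W ≤ (E.bdl i).dom c) (s : E.Sec U) {x : X} (hx : x ∈ W) :
    (E.coefFrm c i a hU hW s).1 x = E.coef c i a x (s.1 x) := frmOf_apply _ hx

/-- A section on a frame domain is a combination of the frame. -/
lemma restr_eq_sum (c : X) {U W : Opens X} (hU : W ≤ U) (hW : ∀ i, W ≤ (E.bdl i).dom c)
    (s : E.Sec U) : E.restr hU s = ∑ i, ∑ a,
      E.smul (E.coefFrm c i a hU (hW i) s) (E.restr (hW i) (E.frameSec c i a)) :=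
  E.sec_ext fun x hx => by
    rw [E.restr_apply hU _ hx, Submodule.coe_sum, Finset.sum_apply]
    conv_lhs => rw [← E.sum_coef (fun i => hW i hx) (s.1 x)]
    refine Finset.sum_congr rfl fun i _ => ?_
    rw [Submodule.coe_sum, Finset.sum_apply]
    refine Finset.sum_congr rfl fun a _ => ?_
    rw [smul_apply, E.coefFrm_apply c i a hU (hW i) s hx, E.restr_apply _ _ hx,
      E.frameSec_apply (hW i hx), smul_tmul_eq]

/-- The products of homogeneous forms and frame sections. -/
def homGen (W : Opens X) : Set (E.Sec W) :=
  {t | ∃ (m : ℤ) (φ : Frm V W) (c : X) (i : Finset.Icc p q) (a : Fin ((E.bdl i).rank c))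
    (h : W ≤ (E.bdl i).dom c), (∀ x, φ.1 x ∈ lamDeg V m) ∧
    t = E.smul φ (E.restr h (E.frameSec c i a))}

/-- The products of forms of type `(a, b)` and holomorphic sections of `E^r`. -/
def typGen (a b : ℕ) (r : ℤ) (W : Opens X) : Set (E.Sec W) :=
  {t | ∃ (φ : Frm V W) (e : E.Sec W), (∀ x, φ.1 x ∈ typ V a b) ∧ E.IsHolSec r e ∧
    t = E.smul φ e}

/-- On a common domain of the frames around `x` a section is a combination of frame sections, and
its coefficients split into finitely many homogeneous forms. Frames exist only locally, hence the
restriction. -/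
lemma exists_restr_mem_homGen {U : Opens X} (s : E.Sec U) {x : X} (hx : x ∈ U) :
    ∃ (W : Opens X) (h : W ≤ U), x ∈ W ∧ E.restr h s ∈ Submodule.span ℂ (E.homGen W) := by
  refine ⟨U ⊓ E.frameDom x, inf_le_left, ⟨hx, E.mem_frameDom x⟩, ?_⟩
  rw [E.restr_eq_sum x inf_le_left (fun i => inf_le_right.trans (E.frameDom_le x i)) s]
  refine Submodule.sum_mem _ fun i _ => Submodule.sum_mem _ fun a _ => ?_
  obtain ⟨N, hN⟩ := exists_sum_frmProj (E.coefFrm x i a inf_le_left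
    (inf_le_right.trans (E.frameDom_le x i)) s)
  rw [hN, sum_smul']
  exact Submodule.sum_mem _ fun m _ => Submodule.subset_span
    ⟨m, _, x, i, a, _, frmProj_mem m _, rfl⟩

/-- For a section of pure type the coordinates along frame vectors outside `E^r` vanish, and the
other coordinates have type `(a, b)` themselves. -/
lemma exists_restr_mem_typGen {U : Opens X} (s : E.Sec U) {a b : ℕ} {r : ℤ}
    (hs : ∀ x, s.1 x ∈ E.formTyp a b r x) {x : X} (hx : x ∈ U) :
    ∃ (W : Opens X) (h : W ≤ U), x ∈ W ∧
      E.restr h s ∈ Submodule.span ℂ (E.typGen a b r W) := by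
  refine ⟨U ⊓ E.frameDom x, inf_le_left, ⟨hx, E.mem_frameDom x⟩, ?_⟩
  rw [E.restr_eq_sum x inf_le_left (fun i => inf_le_right.trans (E.frameDom_le x i)) s]
  refine Submodule.sum_mem _ fun i _ => Submodule.sum_mem _ fun k _ => ?_
  by_cases hi : (i : ℤ) = r
  · refine Submodule.subset_span ⟨_, _, frm_mem fun y hy => ?_, ?_, rfl⟩
    · rw [E.coefFrm_apply _ _ _ _ _ _ hy]
      exact E.coef_mem_typ k (hs y)
    · rw [← hi]; exact E.isHolSec_frame x i k _
  · have : E.coefFrm x i k inf_le_left (inf_le_right.trans (E.frameDom_le x i)) s = 0 :=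
      frm_ext fun y hy => by
        rw [E.coefFrm_apply _ _ _ _ _ _ hy]
        exact E.coef_eq_zero k hi (hs y)
    rw [this, zero_smul']
    exact Submodule.zero_mem _

/-- Endomorphisms of the sheaf that agree on products of homogeneous forms and frame sections are
equal. -/
lemma sheafEnd_ext_homGen {T S : E.SheafEnd}
    (h : ∀ W, ∀ t ∈ E.homGen W, T.on W t = S.on W t) : T = S :=
  SheafEnd.ext' fun U s => E.sec_ext fun x hx => by
    obtain ⟨W, hW, hxW, hs⟩ := E.exists_restr_mem_homGen s hx
    have key : T.on W (E.restr hW s) = S.on W (E.restr hW s) :=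
      LinearMap.eqOn_span (f := T.on W) (g := S.on W) (h W) hs
    rw [SheafEnd.on_restr, SheafEnd.on_restr] at key
    rw [← E.restr_apply hW _ hxW, key, E.restr_apply hW _ hxW]

end Sections

end HolComplex

end HolCx

namespace HolCx

universe u v w

variable {V : Type u} [NormedAddCommGroup V] [NormedSpace ℂ V] [FiniteDimensional ℂ V]
  {X : Type v} [TopologicalSpace X] [ChartedSpace V X] [IsManifold 𝓘(ℂ, V) ω X] {p q : ℤ}

namespace HolComplex

variable {E : HolComplex.{u, v, w} V X p q}

/-! ### Operators with a type, linear operators and derivations over the forms -/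

section Operators

lemma SheafEnd.on_zsmul (T : E.SheafEnd) {U : Opens X} (n : ℤ) (s : E.Sec U) :
    T.on U (n • s) = n • T.on U s := map_zsmul (T.on U) n s

lemma SheafEnd.on_add (T : E.SheafEnd) {U : Opens X} (s t : E.Sec U) :
    T.on U (s + t) = T.on U s + T.on U t := map_add (T.on U) s t

lemma smul_sub' {U : Opens X} (φ : Frm V U) (s t : E.Sec U) :
    E.smul φ (s - t) = E.smul φ s - E.smul φ t :=
  Subtype.ext <| funext fun _ => smul_sub _ _ _

/-- `T` maps `A^{c,d}(E^r)` to `A^{a+c,b+d}(E^{r+n})`. -/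
def HasType (T : E.SheafEnd) (a b : ℕ) (n : ℤ) : Prop :=
  ∀ (U : Opens X) (s : E.Sec U) (c d : ℕ) (r : ℤ), (∀ x, s.1 x ∈ E.formTyp c d r x) →
    ∀ x, (T.on U s).1 x ∈ E.formTyp (a + c) (b + d) (r + n) x

/-- `T` is linear over the forms, as an operator of degree `k`. -/
def IsLin (T : E.SheafEnd) (k : ℤ) : Prop :=
  ∀ (U : Opens X) (φ : Frm V U) (s : E.Sec U) (m : ℤ), (∀ x, φ.1 x ∈ lamDeg V m) →
    T.on U (E.smul φ s) = sg (k * m) • E.smul φ (T.on U s)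

/-- `T` satisfies the Leibniz rule with respect to the operator `∂` or `∂̄` on forms. -/
def IsDer (s : ℂ) (T : E.SheafEnd) : Prop :=
  ∀ (U : Opens X) (φ : Frm V U) (t : E.Sec U) (m : ℤ), (∀ x, φ.1 x ∈ lamDeg V m) →
    T.on U (E.smul φ t) = E.smul (frmDol s φ) t + sg m • E.smul φ (T.on U t)

lemma mem_AHom {T : E.SheafEnd} {a b : ℕ} {n : ℤ} :
    T ∈ E.AHom a b n ↔ HasType T a b n ∧ IsLin T (a + b + n) := Iff.rfl

lemma HasType.mul {T S : E.SheafEnd} {a b a' b' : ℕ} {n n' : ℤ} (hT : HasType T a b n)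
    (hS : HasType S a' b' n') : HasType (T * S) (a + a') (b + b') (n + n') := by
  intro U s c d r hs x
  have := hT U _ _ _ _ (hS U s c d r hs) x
  rw [← add_assoc, ← add_assoc, add_assoc r, add_comm n'] at this
  exact this

lemma HasType.sub {T S : E.SheafEnd} {a b : ℕ} {n : ℤ} (hT : HasType T a b n)
    (hS : HasType S a b n) : HasType (T - S) a b n := fun U s c d r hs x =>
  Submodule.sub_mem _ (hT U s c d r hs x) (hS U s c d r hs x)

lemma HasType.zsmul {T : E.SheafEnd} {a b : ℕ} {n : ℤ} (hT : HasType T a b n) (k : ℤ) :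
    HasType (k • T) a b n := fun U s c d r hs x => by
  have : k • T = (k : ℂ) • T := (Int.cast_smul_eq_zsmul ℂ k T).symm
  rw [this]
  exact Submodule.smul_mem _ _ (hT U s c d r hs x)

lemma HasType.comm {T S : E.SheafEnd} {a b a' b' : ℕ} {n n' : ℤ} (hT : HasType T a b n)
    (hS : HasType S a' b' n') (j k : ℤ) :
    HasType (E.comm j k T S) (a + a') (b + b') (n + n') := by
  rw [comm_apply]
  refine (hT.mul hS).sub (HasType.zsmul ?_ _)
  have := hS.mul hT
  rwa [add_comm a', add_comm b', add_comm n'] at this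

lemma SheafEnd.zsmul_on (k : ℤ) (T : E.SheafEnd) (U : Opens X) (s : E.Sec U) :
    (k • T).on U s = k • T.on U s := by
  have : k • T = (k : ℂ) • T := (Int.cast_smul_eq_zsmul ℂ k T).symm
  rw [this, SheafEnd.smul_on]
  exact Int.cast_smul_eq_zsmul ℂ k (T.on U s)

lemma comm_on (j k : ℤ) (S T : E.SheafEnd) (U : Opens X) (s : E.Sec U) :
    (E.comm j k S T).on U s = S.on U (T.on U s) - sg (j * k) • T.on U (S.on U s) := by
  rw [comm_apply, SheafEnd.sub_on, SheafEnd.zsmul_on]; rfl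

lemma IsLin.mul {T S : E.SheafEnd} {k l : ℤ} (hT : IsLin T k) (hS : IsLin S l) :
    IsLin (T * S) (k + l) := by
  intro U φ s m hφ
  have h : sg ((k + l) * m) = sg (k * m) * sg (l * m) := by rw [← sg_add]; congr 1; ring
  rw [SheafEnd.mul_on, hS U φ s m hφ, SheafEnd.on_zsmul, hT U φ _ m hφ, SheafEnd.mul_on, h]
  module

lemma IsLin.sub {T S : E.SheafEnd} {k : ℤ} (hT : IsLin T k) (hS : IsLin S k) :
    IsLin (T - S) k := by
  intro U φ s m hφ
  rw [SheafEnd.sub_on, SheafEnd.sub_on, hT U φ s m hφ, hS U φ s m hφ, smul_sub']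
  module

lemma IsLin.zsmul {T : E.SheafEnd} {k : ℤ} (hT : IsLin T k) (n : ℤ) : IsLin (n • T) k := by
  intro U φ s m hφ
  rw [SheafEnd.zsmul_on, SheafEnd.zsmul_on, hT U φ s m hφ, smul_zsmul']
  module

lemma IsLin.comm {T S : E.SheafEnd} {k l : ℤ} (hT : IsLin T k) (hS : IsLin S l) (i j : ℤ) :
    IsLin (E.comm i j T S) (k + l) := by
  rw [comm_apply]
  refine (hT.mul hS).sub (IsLin.zsmul ?_ _)
  rw [add_comm]
  exact hS.mul hT

/-- The two terms in which the coefficient `φ` is differentiated cancel. The hypothesis `hs`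
supplies the degree of the differentiated coefficient, hence the sign with which `T` passes it. -/
lemma IsDer.comm_isLin {s : ℂ} (hs : ∀ (U : Opens X) (φ : Frm V U) (m : ℤ),
    (∀ x, φ.1 x ∈ lamDeg V m) → ∀ x, (frmDol s φ).1 x ∈ lamDeg V (m + 1)) {D T : E.SheafEnd}
    {k : ℤ} (hD : IsDer s D) (hT : IsLin T k) : IsLin (E.comm 1 k D T) (k + 1) := by
  intro U φ t m hφ
  rw [comm_on, comm_on, hT U φ t m hφ, SheafEnd.on_zsmul, hD U φ _ m hφ, hD U φ _ m hφ,
    SheafEnd.on_add, hT U _ t _ (hs U φ m hφ), SheafEnd.on_zsmul, hT U φ _ m hφ, smul_sub',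
    smul_zsmul']
  have h1 : sg (k * (m + 1)) = sg (k * m) * sg k := by rw [← sg_add]; congr 1; ring
  have h2 : sg ((k + 1) * m) = sg (k * m) * sg m := by rw [← sg_add]; congr 1; ring
  rw [one_mul, h1, h2]
  rcases sg_eq k with h | h <;> rcases sg_eq m with h' | h' <;>
    rcases sg_eq (k * m) with h'' | h'' <;> rw [h, h', h''] <;> module

/-- The mixed first-order terms cancel by signs, and the second-order terms cancel because the two
operators on forms anticommute (`frmDol_frmDol`). The commutator of two derivations is therefore of
order zero. -/
lemma IsDer.comm_isDer {s s' : ℂ} (hs : ∀ (U : Opens X) (φ : Frm V U) (m : ℤ),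
    (∀ x, φ.1 x ∈ lamDeg V m) → ∀ x, (frmDol s φ).1 x ∈ lamDeg V (m + 1))
    (hs' : ∀ (U : Opens X) (φ : Frm V U) (m : ℤ),
    (∀ x, φ.1 x ∈ lamDeg V m) → ∀ x, (frmDol s' φ).1 x ∈ lamDeg V (m + 1)) {D D' : E.SheafEnd}
    (hD : IsDer s D) (hD' : IsDer s' D') : IsLin (E.comm 1 1 D D') 2 := by
  intro U φ t m hφ
  have h := congrArg (fun ψ => E.smul ψ t) (frmDol_frmDol s s' φ)
  simp only [add_smul', zero_smul'] at h
  rw [comm_on, comm_on, hD U φ t m hφ, hD' U φ t m hφ, SheafEnd.on_add, SheafEnd.on_add,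
    SheafEnd.on_zsmul, SheafEnd.on_zsmul, hD U _ _ _ (hs' U φ m hφ), hD' U _ _ _ (hs U φ m hφ), hD U _ _ _ hφ, hD' U _ _ _ hφ, smul_sub',
    smul_zsmul']
  have h1 : sg (2 * m) = 1 := sg_even (even_two_mul m)
  rw [h1, one_mul, sg_one, sg_add, sg_one]
  have h' : E.smul (frmDol s (frmDol s' φ)) t = (-1 : ℤ) • E.smul (frmDol s' (frmDol s φ)) t := by
    refine (eq_neg_of_add_eq_zero_left h).trans ?_
    module
  rw [h']
  rcases sg_eq m with hm | hm <;> rw [hm] <;> module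

end Operators

/-! ### The operators `∂̄` and `δ` on sections -/

section Differentials

lemma delbar_on {U : Opens X} (s : E.Sec U) {x : X} (hx : x ∈ U) :
    (E.delbar.on U s).1 x = E.delbarAt s.1 x := E.extend_of_mem hx _

lemma δOp_on {U : Opens X} (s : E.Sec U) (x : X) :
    (E.δOp.on U s).1 x = E.δForm x (s.1 x) := rfl

variable (E) in
lemma isDer_delbar : IsDer 1 E.delbar := by
  intro U φ t m hφ
  refine E.sec_ext fun x hx => ?_
  change _ = (E.smul (frmDol 1 φ) t).1 x + sg m • (E.smul φ (E.delbar.on U t)).1 x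
  rw [smul_apply, smul_apply, delbar_on _ hx, delbar_on _ hx, frmDol_apply _ _ hx]
  conv_rhs => rw [← E.sum_coef (fun i => (E.bdl i).mem_dom x) (t.1 x)]
  have h := parPow_of_lamDeg 1 (hφ x)
  rw [parPow_of_odd sg_one, one_mul] at h
  simp only [delbarAt, Finset.smul_sum, ← Finset.sum_add_distrib]
  refine Finset.sum_congr rfl fun i _ => Finset.sum_congr rfl fun a _ => ?_
  simp only [smul_apply, coef_smul]
  rw [dol_mul 1 (E.coef_dol_open U i x) (φ.2.2.mono Set.inter_subset_left) (t.2.2 x i a)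
    ⟨hx, (E.bdl i).mem_dom x⟩, h, TensorProduct.add_tmul, TensorProduct.smul_tmul',
    TensorProduct.smul_tmul', TensorProduct.smul_tmul', smul_eq_mul, smul_eq_mul, smul_mul_assoc]

variable (E) in
lemma hasType_delbar : HasType E.delbar 0 1 0 := by
  intro U s c d r hs
  refine E.sec_mem fun x hx => ?_
  rw [delbar_on _ hx, delbarAt, zero_add, add_comm 1, add_zero]
  refine Submodule.sum_mem _ fun i _ => Submodule.sum_mem _ fun a _ => ?_
  by_cases hi : (i : ℤ) = r
  · refine E.tmul_mem_formTyp ?_ (by rw [← hi]; exact E.vec_mem_totDeg x i a x)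
    exact dol_anti_mem U.2 hx fun y _ => E.coef_mem_typ a (hs y)
  · have : (fun x' => E.coef x i a x' (s.1 x')) = fun _ => 0 :=
      funext fun y => E.coef_eq_zero a hi (hs y)
    rw [this, dol_zero, TensorProduct.zero_tmul]
    exact Submodule.zero_mem _

lemma delbar_holSec {U : Opens X} {r : ℤ} {s : E.Sec U} (hs : E.IsHolSec r s) :
    E.delbar.on U s = 0 := by
  obtain ⟨e, he, hol⟩ := hs
  refine E.sec_ext fun x hx => ?_
  rw [delbar_on _ hx, delbarAt]
  refine Finset.sum_eq_zero fun i _ => Finset.sum_eq_zero fun a _ => ?_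
  have hxO : x ∈ (U ∩ (E.bdl i).dom x : Set X) := ⟨hx, (E.bdl i).mem_dom x⟩
  rw [dol_congr 1 (E.coef_dol_open U i x)
    (θ := fun y => algebraMap ℂ (Lam V) (E.covec x i a y (e y))) (fun y hy => by
      rw [(he y hy.1).2, coef_tmul, Algebra.algebraMap_eq_smul_one]) hxO,
    (hol x i a).dol_eq_zero (E.coef_dol_open U i x) hxO, TensorProduct.zero_tmul]

lemma δForm_smul (x : X) (η : Lam V) (t : E.TotForm x) :
    E.δForm x (η • t) = par η • E.δForm x t := by
  induction t using TensorProduct.induction_on with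
  | zero => simp
  | tmul θ e => simp [TensorProduct.smul_tmul', δForm]
  | add t t' h h' => rw [smul_add, map_add, map_add, h, h', smul_add]

lemma δTot_apply (x : X) (e : E.Tot x) (j : Finset.Icc p q) :
    E.δTot x e j = ∑ i, E.δ i j x (e i) := by simp [δTot]

lemma δTot_mem {x : X} {r : ℤ} {e : E.Tot x} (he : e ∈ E.totDeg r x) :
    E.δTot x e ∈ E.totDeg (r + 1) x := fun j hj => by
  rw [δTot_apply]
  refine Finset.sum_eq_zero fun i _ => ?_
  by_cases hi : (i : ℤ) = r
  · rw [E.δ_degree i j x (by rw [hi]; exact hj), LinearMap.zero_apply]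
  · rw [he i hi, map_zero]

variable (E) in
lemma δOp_mem : E.δOp ∈ E.AHom 0 0 1 := by
  refine mem_AHom.2 ⟨fun U s c d r hs x => ?_, fun U φ s m hφ => E.sec_ext fun x _ => ?_⟩
  · rw [δOp_on, zero_add, zero_add]
    have : E.formTyp c d r x ≤ (E.formTyp c d (r + 1) x).comap (E.δForm x) := by
      refine Submodule.map₂_le.2 fun η hη e he => ?_
      rw [Submodule.mem_comap, TensorProduct.mk_apply, δForm, TensorProduct.map_tmul]
      refine E.tmul_mem_formTyp ?_ (δTot_mem he)
      change par η ∈ _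
      rw [par_of_typ hη]
      exact (typ V c d).toAddSubgroup.zsmul_mem hη _
    exact this (hs x)
  · have h := parPow_of_lamDeg 1 (hφ x)
    rw [parPow_of_odd sg_one, one_mul] at h
    change _ = sg _ • (E.smul φ (E.δOp.on U s)).1 x
    rw [δOp_on, smul_apply, smul_apply, δForm_smul, h, δOp_on]
    simp only [Nat.cast_zero, zero_add, one_mul]
    exact smul_assoc _ _ _

/-- Gives `∂̄(δe) = 0` for a frame section `e`, the only place where holomorphy of `δ` enters the
relation `[∂̄, δ] = 0`. -/
lemma δOp_frame_isHolSec (c : X) (i : Finset.Icc p q) (a : Fin ((E.bdl i).rank c)) {W : Opens X}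
    (h : W ≤ (E.bdl i).dom c) :
    E.IsHolSec (i + 1) (E.δOp.on W (E.restr h (E.frameSec c i a))) := by
  refine ⟨fun x => E.δTot x (E.vec c i a x), fun x hx => ⟨δTot_mem (E.vec_mem_totDeg c i a x), ?_⟩,
    fun c' j b => ?_⟩
  · rw [δOp_on, E.restr_apply h _ hx, E.frameSec_apply (h hx)]
    simp [δForm]
  · have : (fun x => E.covec c' j b x (E.δTot x (E.vec c i a x))) =
        fun x => (E.bdl j).coord c' x (E.δ i j x ((E.bdl i).frame c x a)) b := by
      funext x
      simp only [covec, LinearMap.comp_apply, LinearMap.proj_apply, δTot_apply]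
      rw [Finset.sum_eq_single i]
      · simp [vec]
      · intro k _ hk
        simp [vec, Pi.single_eq_of_ne hk]
      · simp
    rw [this]
    exact (E.δ_holo i j c' c b a).mono fun x hx => ⟨hx.2, h hx.1⟩

variable (E) in
-- It suffices to test on products `φ e` with `e` a frame section. Since `∂̄e = 0`, only `∂̄∂̄φ`
-- remains, and this is zero because twice it is zero.
lemma delbar_mul_delbar : E.delbar * E.delbar = 0 := by
  refine E.sheafEnd_ext_homGen fun W t ht => ?_
  obtain ⟨m, φ, c, i, a, h, hφ, rfl⟩ := ht
  have h0 := delbar_holSec (E.isHolSec_frame c i a h)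
  have h2 := frmDol_frmDol 1 1 φ
  have h3 : frmDol 1 (frmDol 1 φ) = 0 := by
    rw [← two_smul ℂ] at h2
    exact (smul_eq_zero.1 h2).resolve_left two_ne_zero
  rw [SheafEnd.mul_on, E.isDer_delbar W φ _ m hφ, h0, smul_zero', smul_zero, add_zero,
    E.isDer_delbar W _ _ _ (frmDol_lamDeg_one hφ), h0, h3, zero_smul', smul_zero', smul_zero,
    add_zero, SheafEnd.zero_on]

variable (E) in
-- On `φ e` both `e` and `δe` are holomorphic, so both compositions reduce to `∂̄φ · δe`, with
-- opposite signs since `∂̄φ` has degree one more than `φ`.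
lemma delbar_mul_δOp : E.delbar * E.δOp + E.δOp * E.delbar = 0 := by
  refine E.sheafEnd_ext_homGen fun W t ht => ?_
  obtain ⟨m, φ, c, i, a, h, hφ, rfl⟩ := ht
  have h0 := delbar_holSec (E.isHolSec_frame c i a h)
  have h1 := delbar_holSec (δOp_frame_isHolSec (E := E) c i a h)
  rw [SheafEnd.add_on, SheafEnd.mul_on, SheafEnd.mul_on, E.isDer_delbar W φ _ m hφ, h0,
    (mem_AHom.1 E.δOp_mem).2 W φ _ m hφ, SheafEnd.on_zsmul, E.isDer_delbar W φ _ m hφ, h1, smul_zero',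
    smul_zero, add_zero, add_zero, (mem_AHom.1 E.δOp_mem).2 W _ _ _ (frmDol_lamDeg_one hφ),
    SheafEnd.zero_on]
  have h2 : ((0 : ℕ) : ℤ) + (0 : ℕ) + 1 = 1 := by norm_num
  rw [h2, one_mul, one_mul, sg_add, sg_one]
  module

variable (E) in
lemma δOp_mul_δOp : E.δOp * E.δOp = 0 := by
  have h1 : ∀ x (e : E.Tot x), E.δTot x (E.δTot x e) = 0 := fun x e => funext fun k => by
    rw [δTot_apply]
    simp only [δTot_apply, map_sum]
    exact Finset.sum_eq_zero fun j _ => Finset.sum_eq_zero fun i _ =>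
      congrArg (fun f => f (e i)) (E.δ_comp_δ i j k x)
  have h2 : ∀ x (t : E.TotForm x), E.δForm x (E.δForm x t) = 0 := fun x t => by
    induction t using TensorProduct.induction_on with
    | zero => simp
    | tmul θ e => simp [δForm, h1]
    | add t t' h h' => rw [map_add, map_add, h, h', add_zero]
  exact SheafEnd.ext' fun U s => E.sec_ext fun x _ => h2 x _

variable (E) in
lemma dolbeault_mul_self : (E.delbar + E.δOp) * (E.delbar + E.δOp) = 0 := by
  rw [add_mul, mul_add, mul_add, E.delbar_mul_delbar, E.δOp_mul_δOp, zero_add, add_zero,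
    E.delbar_mul_δOp]

end Differentials

/-! ### The `(1,0)`-part `D - ∂̄` of a connection -/

section Connections

variable (D : E.Connection)

/-- Since `∂̄` kills `e`, subtracting it removes the `∂̄φ` part of `dφ` and leaves `D(e)` unchanged.
-/
lemma Connection.on_smul_holSec {U : Opens X} {m r : ℤ} {φ : Frm V U} {e : E.Sec U}
    (hφ : ∀ x, φ.1 x ∈ lamDeg V m) (he : E.IsHolSec r e) :
    (D.D - E.delbar).on U (E.smul φ e) =
      E.smul (frmDol (-1) φ) e + sg m • E.smul φ ((D.D - E.delbar).on U e) := by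
  rw [SheafEnd.sub_on, SheafEnd.sub_on, E.isDer_delbar U φ e m hφ, delbar_holSec he, smul_zero',
    smul_zero, add_zero]
  have h1 : D.D.on U e - 0 = D.D.on U e := by module
  rw [h1]
  refine E.sec_ext fun x hx => sub_eq_iff_eq_add.2 ?_
  change _ = ((frmDol (-1) φ).1 x • e.1 x + sg m • (φ.1 x • (D.D.on U e).1 x)) +
    (frmDol 1 φ).1 x • e.1 x
  rw [D.leibniz U m r φ e hφ he x hx, frmDol_apply _ _ hx, frmDol_apply _ _ hx, add_smul]
  abel

/-- The Leibniz rule is assumed only against holomorphic sections. Any section is locally a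
combination of products `ψ e` with `e` holomorphic, and the rule for the coefficient `φψ`, compared
with the rule for `ψ`, gives the rule for `φ`. -/
lemma Connection.isDer : IsDer (-1) (D.D - E.delbar) := by
  intro U φ t m hφ
  refine E.sec_ext fun x hx => ?_
  obtain ⟨W, hW, hxW, hs⟩ := E.exists_restr_mem_homGen t hx
  set T := D.D - E.delbar
  have hφ' : ∀ y, (frmRestr hW φ).1 y ∈ lamDeg V m := frm_mem fun y hy => by
    rw [frmRestr_apply hW φ hy]; exact hφ y
  have key : ∀ t ∈ Submodule.span ℂ (E.homGen W), T.on W (E.smul (frmRestr hW φ) t) =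
      E.smul (frmDol (-1) (frmRestr hW φ)) t + sg m • E.smul (frmRestr hW φ) (T.on W t) := by
    intro t ht
    induction ht using Submodule.span_induction with
    | mem t ht =>
      obtain ⟨m', ψ, c, i, a, h, hψ, rfl⟩ := ht
      have he := E.isHolSec_frame c i a h
      have hm : ∀ y, (frmMul (frmRestr hW φ) ψ).1 y ∈ lamDeg V (m + m') := frm_mem fun y hy => by
        rw [frmMul_apply _ _ hy]; exact mul_mem_lamDeg (hφ' y) (hψ y)
      -- Here `φ (ψ e) = (φψ) e` and `∂(φψ)` is expanded by the Leibniz rule for forms.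
      rw [smul_frmMul, D.on_smul_holSec hm he, D.on_smul_holSec hψ he, frmDol_frmMul _ hφ',
        add_smul', zsmul_smul', smul_add', smul_frmMul, smul_frmMul, smul_zsmul', smul_frmMul,
        sg_add]
      module
    | zero => simp [smul_zero']
    | add s t _ _ hs ht => rw [smul_add', map_add, hs, ht, smul_add', map_add, smul_add']; module
    | smul r t _ ht => rw [smul_smul', map_smul, ht, smul_smul', map_smul, smul_smul']; module
  have := key _ hs
  rw [← restr_smul, SheafEnd.on_restr, SheafEnd.on_restr, frmDol_frmRestr, ← restr_smul,
    ← restr_smul] at this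
  have h2 := (congrArg (fun s => s.1 x) this).trans (congrArg (fun s => s.1 x)
    (((E.restr hW).map_add _ _).trans (congrArg _ (map_zsmul (E.restr hW) _ _))).symm)
  simpa only [E.restr_apply hW _ hxW] using h2

/-- On `φ e` the two terms are `∂φ · e` and `φ · D(e)`, and each raises the holomorphic form degree
by one while staying in `E^r`. Being of a given type at a point is local and linear, so products
suffice. -/
lemma Connection.hasType : HasType (D.D - E.delbar) 1 0 0 := by
  intro U s c d r hs
  refine E.sec_mem fun x hx => ?_
  obtain ⟨W, hW, hxW, hs'⟩ := E.exists_restr_mem_typGen s hs hx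
  set T := D.D - E.delbar
  have key : ∀ t ∈ Submodule.span ℂ (E.typGen c d r W),
      (T.on W t).1 x ∈ E.formTyp (1 + c) (0 + d) (r + 0) x := by
    intro t ht
    induction ht using Submodule.span_induction with
    | mem t ht =>
      obtain ⟨φ, e, hφ, he, rfl⟩ := ht
      have hφ' : ∀ y, φ.1 y ∈ lamDeg V (c + d) := fun y => typ_le_lamDeg c d rfl (hφ y)
      rw [D.on_smul_holSec hφ' he]
      change (frmDol (-1) φ).1 x • e.1 x + sg _ • (φ.1 x • (T.on W e).1 x) ∈ _
      refine Submodule.add_mem _ ?_ (zsmul_mem ?_ _)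
      · obtain ⟨e', he', -⟩ := he
        rw [(he' x hxW).2, ← smul_tmul_eq, add_comm 1, zero_add, add_zero, frmDol_apply _ _ hxW]
        exact E.tmul_mem_formTyp (dol_hol_mem W.2 hxW fun y _ => hφ y) (he' x hxW).1
      · rw [add_comm 1, add_comm 0, add_zero r]
        refine E.smul_mem_formTyp (hφ x) ?_
        rw [SheafEnd.sub_on, delbar_holSec he]
        have h1 : D.D.on W e - 0 = D.D.on W e := by module
        rw [h1]
        exact D.type W r e he x
    | zero => rw [map_zero]; exact Submodule.zero_mem _
    | add s t _ _ hs ht => rw [map_add]; exact Submodule.add_mem _ hs ht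
    | smul r t _ ht => rw [map_smul]; exact Submodule.smul_mem _ _ ht
  have := key _ hs'
  rwa [SheafEnd.on_restr, E.restr_apply hW _ hxW] at this

end Connections

/-! ### Stability of `A^{*,*}(Hom^*)` under commutators, and the Atiyah cocycle -/

section Closure

lemma comm_mem_AHom {T S : E.SheafEnd} {a b a' b' : ℕ} {n n' : ℤ} (hT : T ∈ E.AHom a b n)
    (hS : S ∈ E.AHom a' b' n') (j k : ℤ) :
    E.comm j k T S ∈ E.AHom (a + a') (b + b') (n + n') := by
  rw [mem_AHom] at *
  refine ⟨hT.1.comm hS.1 j k, ?_⟩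
  convert hT.2.comm hS.2 j k using 1
  push_cast; ring

lemma comm_delbar_mem {T : E.SheafEnd} {a b : ℕ} {n : ℤ} (hT : T ∈ E.AHom a b n) :
    E.comm 1 (a + b + n) E.delbar T ∈ E.AHom a (b + 1) n := by
  rw [mem_AHom] at *
  constructor
  · have := E.hasType_delbar.comm hT.1 1 (a + b + n)
    rwa [zero_add, zero_add, add_comm 1] at this
  · convert E.isDer_delbar.comm_isLin (fun U φ m h => frmDol_lamDeg_one h) hT.2 using 1
    push_cast; ring

lemma comm_connection_mem (D : E.Connection) {T : E.SheafEnd} {a b : ℕ} {n : ℤ}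
    (hT : T ∈ E.AHom a b n) :
    E.comm 1 (a + b + n) (D.D - E.delbar) T ∈ E.AHom (a + 1) b n := by
  rw [mem_AHom] at *
  constructor
  · have := D.hasType.comm hT.1 1 (a + b + n)
    rwa [zero_add, zero_add, add_comm 1] at this
  · convert D.isDer.comm_isLin (fun U φ m h => frmDol_lamDeg_neg_one h) hT.2 using 1
    push_cast; ring

/-- Neither factor is linear over the forms, but both are derivations, over `∂` and over `∂̄`, so
their commutator is linear. This is the `(1,1)`-component of the Atiyah cocycle. -/
lemma comm_connection_delbar_mem (D : E.Connection) :
    E.comm 1 1 (D.D - E.delbar) E.delbar ∈ E.AHom 1 1 0 := by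
  rw [mem_AHom]
  constructor
  · have := D.hasType.comm E.hasType_delbar 1 1
    rwa [zero_add, add_zero, add_zero] at this
  · convert D.isDer.comm_isDer (fun U φ m h => frmDol_lamDeg_neg_one h)
      (fun U φ m h => frmDol_lamDeg_one h) E.isDer_delbar using 1
    norm_num

/-- Replacing `D` by `D - ∂̄` changes the commutator by `[∂̄, ∂̄ + δ]`, which vanishes. The two
summands are the components in `A^{1,1}(Hom^0)` and `A^{1,0}(Hom^1)`. -/
lemma Connection.atiyah_eq (D : E.Connection) :
    D.atiyah = E.comm 1 1 (D.D - E.delbar) E.delbar + E.comm 1 1 (D.D - E.delbar) E.δOp := by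
  have h1 := E.delbar_mul_delbar
  have h2 := E.delbar_mul_δOp
  rw [Connection.atiyah]
  simp only [comm_apply, mul_one, sg_one, neg_smul, one_smul, sub_neg_eq_add, mul_add, add_mul,
    sub_mul, mul_sub, h1]
  rw [← eq_neg_iff_add_eq_zero] at h2
  rw [h2]; abel

lemma Connection.atiyah_mem (D : E.Connection) : D.atiyah ∈ E.AHom 1 1 0 ⊔ E.AHom 1 0 1 := by
  rw [D.atiyah_eq]
  refine Submodule.add_mem_sup (comm_connection_delbar_mem D) ?_
  have := comm_connection_mem D E.δOp_mem
  simpa using this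

end Closure

end HolComplex

end HolCx

/-! ### The product and the cyclic form on `Λ ⊗ End(E_x)` -/

namespace HolCx

universe u v w

variable {V : Type u} [NormedAddCommGroup V] [NormedSpace ℂ V] [FiniteDimensional ℂ V]
  {X : Type v} [TopologicalSpace X] [ChartedSpace V X] [IsManifold 𝓘(ℂ, V) ω X] {p q : ℤ}

namespace HolComplex

variable (E : HolComplex.{u, v, w} V X p q)

/-- The fibre `Λ ⊗ Hom^*(E^*, E^*)_x`. -/
abbrev EndForm (x : X) : Type (max u w) := TensorProduct ℂ (Lam V) (Module.End ℂ (E.Tot x))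

/-- `Λ^{a,b} ⊗ Hom^n(E^*, E^*)_x`. -/
noncomputable def endTyp (a b : ℕ) (n : ℤ) (x : X) : Submodule ℂ (E.EndForm x) :=
  Submodule.map₂ (TensorProduct.mk ℂ (Lam V) (Module.End ℂ (E.Tot x))) (typ V a b) (E.endDeg n x)

/-- Multiplication of forms after passing an operator of degree `n`. -/
noncomputable def mulPar (n : ℤ) : Lam V →ₗ[ℂ] Lam V →ₗ[ℂ] Lam V :=
  (LinearMap.mul ℂ (Lam V)).compl₂ (parPow n).toLinearMap

/-- The product `(φ ⊗ f)(ψ ⊗ g) = (-1)^{n deg ψ} φψ ⊗ fg`, for `f` of degree `n`. -/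
noncomputable def mulForm (n : ℤ) (x : X) :
    E.EndForm x →ₗ[ℂ] E.EndForm x →ₗ[ℂ] E.EndForm x :=
  TensorProduct.map₂ (mulPar n) (LinearMap.mul ℂ (Module.End ℂ (E.Tot x)))

variable {E} in
/-- The extension of the cyclic form, `⟨φ ⊗ f, ψ ⊗ g⟩ = (-1)^{n deg ψ} ⟨f, g⟩ φψ`, for `f` of
degree `n`. -/
noncomputable def CyclicForm.pairForm (B : E.CyclicForm) (n : ℤ) (x : X) :
    E.EndForm x →ₗ[ℂ] E.EndForm x →ₗ[ℂ] Lam V :=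
  (TensorProduct.map₂ (mulPar n) (B.B x)).compr₂ (TensorProduct.rid ℂ (Lam V)).toLinearMap

section Fibre

variable {E} {x : X}

lemma mulForm_tmul (n : ℤ) (φ ψ : Lam V) (f g : Module.End ℂ (E.Tot x)) :
    E.mulForm n x (φ ⊗ₜ f) (ψ ⊗ₜ g) = (φ * parPow n ψ) ⊗ₜ (f * g) := by
  simp [mulForm, TensorProduct.map₂_apply_tmul, mulPar]

lemma CyclicForm.pairForm_tmul (B : E.CyclicForm) (n : ℤ) (φ ψ : Lam V)
    (f g : Module.End ℂ (E.Tot x)) :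
    B.pairForm n x (φ ⊗ₜ f) (ψ ⊗ₜ g) = B.B x f g • (φ * parPow n ψ) := by
  simp [CyclicForm.pairForm, TensorProduct.map₂_apply_tmul, mulPar]

/-- Linear maps that agree on the products `φ ⊗ f` agree on `Λ^{a,b} ⊗ Hom^n`. -/
lemma endTyp_eqOn {N : Type*} [AddCommGroup N] [Module ℂ N] {F G : E.EndForm x →ₗ[ℂ] N} {a b : ℕ}
    {n : ℤ} (h : ∀ φ ∈ typ V a b, ∀ f ∈ E.endDeg n x, F (φ ⊗ₜ f) = G (φ ⊗ₜ f))
    {α : E.EndForm x} (hα : α ∈ E.endTyp a b n x) : F α = G α := by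
  have : E.endTyp a b n x ≤ LinearMap.eqLocus F G :=
    Submodule.map₂_le.2 fun φ hφ f hf => h φ hφ f hf
  exact this hα

lemma endTyp_mem {N : Type*} [AddCommGroup N] [Module ℂ N] {F : E.EndForm x →ₗ[ℂ] N} {a b : ℕ}
    {n : ℤ} {P : Submodule ℂ N} (h : ∀ φ ∈ typ V a b, ∀ f ∈ E.endDeg n x, F (φ ⊗ₜ f) ∈ P)
    {α : E.EndForm x} (hα : α ∈ E.endTyp a b n x) : F α ∈ P := by
  have : E.endTyp a b n x ≤ P.comap F := Submodule.map₂_le.2 fun φ hφ f hf => h φ hφ f hf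
  exact this hα

variable (B : E.CyclicForm) {a b a' b' a'' b'' : ℕ} {n n' n'' : ℤ} {α β γ : E.EndForm x}

lemma CyclicForm.pairForm_eq_zero (hα : α ∈ E.endTyp a b n x) (hβ : β ∈ E.endTyp a' b' n' x)
    (h : n + n' ≠ 0) : B.pairForm n x α β = 0 := by
  refine endTyp_eqOn (F := (B.pairForm n x).flip β) (G := 0) (fun φ _ f hf => ?_) hα
  refine endTyp_eqOn (F := B.pairForm n x (φ ⊗ₜ f)) (G := 0) (fun ψ _ g hg => ?_) hβ
  rw [B.pairForm_tmul, B.degree x n n' f hf g hg h, zero_smul, LinearMap.zero_apply]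

lemma CyclicForm.pairForm_mem (hα : α ∈ E.endTyp a b n x) (hβ : β ∈ E.endTyp a' b' n' x) :
    B.pairForm n x α β ∈ typ V (a + a') (b + b') := by
  refine endTyp_mem (F := (B.pairForm n x).flip β) (fun φ hφ f hf => ?_) hα
  refine endTyp_mem (F := B.pairForm n x (φ ⊗ₜ f)) (fun ψ hψ g hg => ?_) hβ
  rw [B.pairForm_tmul, parPow_of_typ n hψ]
  exact Submodule.smul_mem _ _ (mul_mem_typ hφ (zsmul_mem hψ _))

/-- By bilinearity only pure tensors matter. The sign comes from exchanging the two forms,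
exchanging the two endomorphisms, and moving each endomorphism past a form. -/
lemma CyclicForm.pairForm_symm (hα : α ∈ E.endTyp a b n x) (hβ : β ∈ E.endTyp a' b' n' x) :
    B.pairForm n x α β = sg ((a + b + n) * (a' + b' + n')) • B.pairForm n' x β α := by
  set s := sg ((a + b + n) * (a' + b' + n')) with hs
  have h1 : ∀ (y : Lam V), s • y = (s : ℂ) • y := fun y => (Int.cast_smul_eq_zsmul ℂ s y).symm
  rw [h1]
  refine endTyp_eqOn (F := (B.pairForm n x).flip β) (G := (s : ℂ) • B.pairForm n' x β)
    (fun φ hφ f hf => ?_) hα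
  refine endTyp_eqOn (F := B.pairForm n x (φ ⊗ₜ f))
    (G := (s : ℂ) • (B.pairForm n' x).flip (φ ⊗ₜ f)) (fun ψ hψ g hg => ?_) hβ
  rw [LinearMap.smul_apply, LinearMap.flip_apply, ← h1, B.pairForm_tmul, B.pairForm_tmul,
    parPow_of_typ n hψ, parPow_of_typ n' hφ, mul_smul_comm, mul_smul_comm,
    typ_mul_comm_typ hφ hψ, B.symm x n n' f hf g hg, hs]
  simp only [sg_mul, sg_add]
  rcases sg_eq n with hn | hn <;> rcases sg_eq n' with hn' | hn' <;>
    rcases sg_eq a with ha | ha <;> rcases sg_eq b with hb | hb <;>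
    rcases sg_eq a' with ha' | ha' <;> rcases sg_eq b' with hb' | hb' <;>
    simp [hn, hn', ha, hb, ha', hb']

/-- On pure tensors all terms are multiples of the single form `φψχ`. What remains is the cyclicity
of the form on endomorphisms, multiplied by one Koszul sign. -/
lemma CyclicForm.pairForm_cyclic (hα : α ∈ E.endTyp a b n x) (hβ : β ∈ E.endTyp a' b' n' x)
    (hγ : γ ∈ E.endTyp a'' b'' n'' x) :
    B.pairForm n x α (E.mulForm n' x β γ -
      sg ((a' + b' + n') * (a'' + b'' + n'')) • E.mulForm n'' x γ β) =
    B.pairForm (n + n') x (E.mulForm n x α β -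
      sg ((a + b + n) * (a' + b' + n')) • E.mulForm n' x β α) γ := by
  set s := sg ((a' + b' + n') * (a'' + b'' + n'')) with hs
  set t := sg ((a + b + n) * (a' + b' + n')) with ht
  have h1 : ∀ (s : ℤ) (y : E.EndForm x), s • y = (s : ℂ) • y :=
    fun s y => (Int.cast_smul_eq_zsmul ℂ s y).symm
  rw [h1, h1]
  refine endTyp_eqOn (F := (B.pairForm n x).flip (E.mulForm n' x β γ -
      (s : ℂ) • E.mulForm n'' x γ β)) (G := (B.pairForm (n + n') x).flip γ ∘ₗ
      ((E.mulForm n x).flip β - (t : ℂ) • E.mulForm n' x β)) (fun φ hφ f hf => ?_) hα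
  refine endTyp_eqOn (F := B.pairForm n x (φ ⊗ₜ f) ∘ₗ ((E.mulForm n' x).flip γ -
      (s : ℂ) • E.mulForm n'' x γ)) (G := (B.pairForm (n + n') x).flip γ ∘ₗ
      (E.mulForm n x (φ ⊗ₜ f) - (t : ℂ) • (E.mulForm n' x).flip (φ ⊗ₜ f)))
      (fun ψ hψ g hg => ?_) hβ
  refine endTyp_eqOn (F := B.pairForm n x (φ ⊗ₜ f) ∘ₗ (E.mulForm n' x (ψ ⊗ₜ g) -
      (s : ℂ) • (E.mulForm n'' x).flip (ψ ⊗ₜ g))) (G := B.pairForm (n + n') x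
      (E.mulForm n x (φ ⊗ₜ f) (ψ ⊗ₜ g) - (t : ℂ) • E.mulForm n' x (ψ ⊗ₜ g) (φ ⊗ₜ f)))
      (fun χ hχ h hh => ?_) hγ
  simp only [LinearMap.comp_apply, LinearMap.sub_apply, LinearMap.smul_apply, LinearMap.flip_apply,
    mulForm_tmul, map_sub, map_smul, B.pairForm_tmul, parPow_of_typ _ hφ, parPow_of_typ _ hψ,
    parPow_of_typ _ hχ, map_mul, map_zsmul, smul_mul_assoc, mul_smul_comm]
  -- Both reordered products are brought to the order `φψχ`.
  have c1 : φ * (χ * ψ) = sg ((a' + b') * (a'' + b'')) • (φ * ψ * χ) := by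
    rw [typ_mul_comm_typ hχ hψ, mul_smul_comm, mul_assoc, mul_comm ((a'' : ℤ) + b'')]
  have c2 : ψ * φ * χ = sg ((a + b) * (a' + b')) • (φ * ψ * χ) := by
    rw [typ_mul_comm_typ hψ hφ, smul_mul_assoc, mul_comm ((a' : ℤ) + b')]
  have hc := B.cyclic x n n' n'' f hf g hg h hh
  rw [map_sub, map_sub, LinearMap.sub_apply, map_zsmul, map_zsmul, LinearMap.smul_apply] at hc
  rw [c1, c2, ← mul_assoc]
  generalize φ * ψ * χ = y
  have hc' := congrArg (fun r : ℂ => r • y) hc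
  simp only [sub_smul, smul_assoc] at hc'
  rw [hs, ht]
  simp only [Int.cast_smul_eq_zsmul]
  simp only [sg_mul, sg_add] at hc' ⊢
  have hP := sg_eq (a + b)
  have hP' := sg_eq (a' + b')
  have hP'' := sg_eq (a'' + b'')
  have hN := sg_eq n
  have hN' := sg_eq n'
  have hN'' := sg_eq n''
  rw [sg_add] at hP hP' hP''
  generalize sg (a : ℤ) * sg b = P at *
  generalize sg (a' : ℤ) * sg b' = P' at *
  generalize sg (a'' : ℤ) * sg b'' = P'' at *
  generalize sg n = N at *
  generalize sg n' = N' at *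
  generalize sg n'' = N'' at *
  -- The sign of moving `f` past `ψ` and `χ`, and `g` past `χ`. The identities `e2`, `e3`, `e4` say
  -- that the terms of the goal are the terms of `hc'` multiplied by this common sign.
  set c := sgPair N' P'' * sgPair N P'' * sgPair N P' with hc
  have e2 : sgPair (P' * N') (P'' * N'') * (sgPair N'' P' * sgPair N P' * sgPair N P'' *
      sgPair P' P'') = c * sgPair N' N'' := by
    rcases hP' with rfl | rfl <;> rcases hP'' with rfl | rfl <;> rcases hN with rfl | rfl <;>
      rcases hN' with rfl | rfl <;> rcases hN'' with rfl | rfl <;> decide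
  have e3 : sgPair (N * N') P'' * sgPair N P' = c := by
    rcases hP' with rfl | rfl <;> rcases hP'' with rfl | rfl <;> rcases hN with rfl | rfl <;>
      rcases hN' with rfl | rfl <;> decide
  have e4 : sgPair (P * N) (P' * N') * (sgPair (N * N') P'' * sgPair N' P * sgPair P P') =
      c * sgPair N N' := by
    rcases hP with rfl | rfl <;> rcases hP' with rfl | rfl <;> rcases hP'' with rfl | rfl <;>
      rcases hN with rfl | rfl <;> rcases hN' with rfl | rfl <;> decide
  have hcc := congrArg (fun y => c • y) hc'
  simp only [smul_sub] at hcc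
  have m : ∀ (u v : ℤ) (r : ℂ), u • r • v • y = (u * v) • r • y := fun u v r => by module
  have m' : ∀ (v : ℤ) (r : ℂ), r • v • y = v • r • y := fun v r => smul_comm _ _ _
  simp only [smul_smul (M := ℤ)] at hcc ⊢
  rw [← e2, ← e4] at hcc
  rw [m, m, m', m', e3]
  simpa only [hc, mul_assoc] using hcc

end Fibre
end HolComplex

end HolCx

namespace HolCx

universe u v w

variable {V : Type u} [NormedAddCommGroup V] [NormedSpace ℂ V] [FiniteDimensional ℂ V]
  {X : Type v} [TopologicalSpace X] [ChartedSpace V X] [IsManifold 𝓘(ℂ, V) ω X] {p q : ℤ}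

namespace HolComplex

variable {E : HolComplex.{u, v, w} V X p q}

lemma sum_sigma_comm {ι κ : Type*} [Fintype ι] [Fintype κ] {α : ι → Type*} {β : κ → Type*}
    [∀ i, Fintype (α i)] [∀ j, Fintype (β j)] {N : Type*} [AddCommMonoid N]
    (f : ∀ i, α i → ∀ j, β j → N) :
    ∑ j, ∑ b, ∑ i, ∑ a, f i a j b = ∑ i, ∑ a, ∑ j, ∑ b, f i a j b := by
  have h1 : ∀ (j : κ) (b : β j), ∑ i, ∑ a, f i a j b = ∑ y : Σ i, α i, f y.1 y.2 j b :=
    fun j b => (Fintype.sum_sigma' (fun i a => f i a j b)).symm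
  have h2 : ∀ (i : ι) (a : α i), ∑ j, ∑ b, f i a j b = ∑ z : Σ j, β j, f i a z.1 z.2 :=
    fun i a => (Fintype.sum_sigma' (fun j b => f i a j b)).symm
  simp only [h1, h2]
  rw [← Fintype.sum_sigma' (fun j b => ∑ y : Σ i, α i, f y.1 y.2 j b),
    ← Fintype.sum_sigma' (fun i a => ∑ z : Σ j, β j, f i a z.1 z.2)]
  exact Finset.sum_comm

/-! ### Operators linear over the forms and their values on frames -/

section KeyFormula

/-- Linearity is stated for homogeneous coefficients only. Decomposing the coefficient turns the
degree-dependent signs into the automorphism `parPow k`. -/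
lemma IsLin.on_smul {T : E.SheafEnd} {k : ℤ} (hT : IsLin T k) {U : Opens X} (φ : Frm V U)
    (s : E.Sec U) (x : X) : (T.on U (E.smul φ s)).1 x = parPow k (φ.1 x) • (T.on U s).1 x := by
  obtain ⟨N, hN⟩ := exists_sum_frmProj φ
  have h1 : T.on U (E.smul φ s) =
      ∑ m ∈ Finset.range N, sg (k * m) • E.smul (frmProj m φ) (T.on U s) := by
    conv_lhs => rw [hN]
    rw [sum_smul', map_sum]
    exact Finset.sum_congr rfl fun m _ => hT U _ s m (frmProj_mem m φ)
  have h2 : φ.1 x = ∑ m ∈ Finset.range N, (frmProj m φ).1 x := by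
    conv_lhs => rw [hN]
    rw [Submodule.coe_sum, Finset.sum_apply]
  rw [h1, Submodule.coe_sum, Finset.sum_apply, h2, map_sum, Finset.sum_smul]
  refine Finset.sum_congr rfl fun m _ => ?_
  rw [parPow_of_lamDeg k (frmProj_mem m φ x)]
  change sg (k * m) • ((frmProj m φ).1 x • (T.on U s).1 x) = _
  exact (smul_assoc _ _ _).symm

/-- The value of an operator that is linear over the forms, in terms of its values on a frame. -/
lemma IsLin.apply_eq_sum {T : E.SheafEnd} {k : ℤ} (hT : IsLin T k) {U : Opens X} (s : E.Sec U)
    {c x : X} (hxU : x ∈ U) (hx : x ∈ E.frameDom c) :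
    (T.on U s).1 x = ∑ i, ∑ a, parPow k (E.coef c i a x (s.1 x)) •
      (T.on ((E.bdl i).dom c) (E.frameSec c i a)).1 x := by
  have hW : ∀ i, U ⊓ E.frameDom c ≤ (E.bdl i).dom c := fun i =>
    inf_le_right.trans (E.frameDom_le c i)
  have hxW : x ∈ U ⊓ E.frameDom c := ⟨hxU, hx⟩
  rw [← E.restr_apply inf_le_left _ hxW, ← SheafEnd.on_restr,
    E.restr_eq_sum c inf_le_left hW s, map_sum, Submodule.coe_sum, Finset.sum_apply]
  refine Finset.sum_congr rfl fun i _ => ?_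
  rw [map_sum, Submodule.coe_sum, Finset.sum_apply]
  refine Finset.sum_congr rfl fun a _ => ?_
  rw [hT.on_smul, E.coefFrm_apply c i a inf_le_left (hW i) s hxW, SheafEnd.on_restr,
    E.restr_apply _ _ hxW]

end KeyFormula

/-! ### Matrices of operators -/

section Matrices

/-- The value at `x` of `T` on the frame vector `a` of `E^i` around `c`. -/
noncomputable def frameVal (T : E.SheafEnd) (c : X) (i : Finset.Icc p q)
    (a : Fin ((E.bdl i).rank c)) (x : X) : E.TotForm x :=
  (T.on ((E.bdl i).dom c) (E.frameSec c i a)).1 x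

/-- The tensor product of a form with values in `E^*` with a functional on the fibre. -/
noncomputable def dyad {x : X} (l : E.Tot x →ₗ[ℂ] ℂ) : E.TotForm x →ₗ[ℂ] E.EndForm x :=
  (LinearMap.smulRightₗ l).lTensor (Lam V)

lemma dyad_tmul {x : X} (l : E.Tot x →ₗ[ℂ] ℂ) (η : Lam V) (e : E.Tot x) :
    dyad l (η ⊗ₜ[ℂ] e) = η ⊗ₜ l.smulRight e := by
  simp only [dyad, LinearMap.lTensor_tmul]; rfl

lemma dyad_sum {κ : Type*} (t : Finset κ) {x : X} (r : κ → ℂ) (l : κ → E.Tot x →ₗ[ℂ] ℂ)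
    (s : E.TotForm x) : dyad (∑ k ∈ t, r k • l k) s = ∑ k ∈ t, r k • dyad (l k) s := by
  simp only [dyad, map_sum, map_smul]
  induction s using TensorProduct.induction_on with
  | zero => simp
  | tmul η e => simp [LinearMap.lTensor_tmul, TensorProduct.tmul_sum, TensorProduct.tmul_smul,
      LinearMap.sum_apply]
  | add s s' h h' => simp only [map_add, h, h', smul_add, Finset.sum_add_distrib]

/-- The matrix of `T` in the frame around `c`, as an element of the fibre at `x`. -/
noncomputable def fibreAt (T : E.SheafEnd) (c x : X) : E.EndForm x :=
  ∑ j, ∑ b, dyad (E.covec c j b x) (frameVal T c j b x)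

lemma fibreAt_eq_sum (T : E.SheafEnd) {c x : X} (hx : x ∈ E.frameDom c) :
    fibreAt T c x = ∑ i, ∑ a, ∑ j, ∑ b,
      E.coef c i a x (frameVal T c j b x) ⊗ₜ[ℂ] E.elem c i a j b x := by
  have h : ∀ j b, dyad (E.covec c j b x) (frameVal T c j b x) = ∑ i, ∑ a,
      E.coef c i a x (frameVal T c j b x) ⊗ₜ[ℂ] E.elem c i a j b x := by
    intro j b
    conv_lhs => rw [← E.sum_coef (fun i => E.frameDom_le c i hx) (frameVal T c j b x)]
    simp only [map_sum, dyad_tmul]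
    rfl
  simp only [fibreAt, h]
  exact sum_sigma_comm fun i a j b =>
    E.coef c i a x (frameVal T c j b x) ⊗ₜ[ℂ] E.elem c i a j b x

lemma frameVal_mem {T : E.SheafEnd} {a b : ℕ} {n : ℤ} (hT : HasType T a b n) (c : X)
    (i : Finset.Icc p q) (k : Fin ((E.bdl i).rank c)) (x : X) :
    frameVal T c i k x ∈ E.formTyp a b (i + n) x := by
  refine hT _ _ 0 0 _ (fun y => ?_) x
  refine E.sec_mem (P := fun y => E.formTyp 0 0 i y) (fun y hy => ?_) y
  rw [E.frameSec_apply hy]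
  exact E.tmul_mem_formTyp one_mem_typ (E.vec_mem_totDeg c i k y)

lemma dyad_mem {a b : ℕ} {n : ℤ} {c x : X} {j : Finset.Icc p q} (k : Fin ((E.bdl j).rank c))
    {t : E.TotForm x} (ht : t ∈ E.formTyp a b (j + n) x) :
    dyad (E.covec c j k x) t ∈ E.endTyp a b n x := by
  have : E.formTyp a b (j + n) x ≤ (E.endTyp a b n x).comap (dyad (E.covec c j k x)) := by
    refine Submodule.map₂_le.2 fun η hη e he => ?_
    rw [Submodule.mem_comap, TensorProduct.mk_apply, dyad_tmul]
    refine Submodule.apply_mem_map₂ _ hη fun r e' he' => ?_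
    rw [LinearMap.smulRight_apply]
    by_cases hr : (j : ℤ) = r
    · rw [← hr]; exact Submodule.smul_mem _ _ he
    · rw [E.covec_of_totDeg k hr he', zero_smul]; exact Submodule.zero_mem _
  exact this ht

lemma fibreAt_mem {T : E.SheafEnd} {a b : ℕ} {n : ℤ} (hT : HasType T a b n) (c x : X) :
    fibreAt T c x ∈ E.endTyp a b n x :=
  Submodule.sum_mem _ fun j _ => Submodule.sum_mem _ fun k _ => dyad_mem k (frameVal_mem hT c j k x)

lemma sum_covec_smul {c' x : X} (hx : x ∈ E.frameDom c') (l : E.Tot x →ₗ[ℂ] ℂ) :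
    ∑ j, ∑ b, l (E.vec c' j b x) • E.covec c' j b x = l := by
  refine LinearMap.ext fun e => ?_
  conv_rhs => rw [← E.sum_covec (fun i => E.frameDom_le c' i hx) e]
  simp only [LinearMap.sum_apply, LinearMap.smul_apply, map_sum, map_smul, smul_eq_mul, mul_comm]

/-- The matrix of an operator that is linear over the forms does not depend on the frame. -/
lemma IsLin.fibreAt_eq {T : E.SheafEnd} {k : ℤ} (hT : IsLin T k) {c c' x : X}
    (hx : x ∈ E.frameDom c) (hx' : x ∈ E.frameDom c') : fibreAt T c x = fibreAt T c' x := by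
  have h1 : ∀ j b, frameVal T c' j b x =
      ∑ i, ∑ a, E.covec c i a x (E.vec c' j b x) • frameVal T c i a x := by
    intro j b
    rw [frameVal, hT.apply_eq_sum _ (E.frameDom_le c' j hx') hx]
    refine Finset.sum_congr rfl fun i _ => Finset.sum_congr rfl fun a _ => ?_
    rw [E.frameSec_apply (E.frameDom_le c' j hx'), coef_tmul, map_smul, map_one, smul_assoc,
      one_smul]
    rfl
  simp only [fibreAt, h1, map_sum, map_smul]
  refine Eq.trans ?_ (sum_sigma_comm fun i a j b => E.covec c i a x (E.vec c' j b x) •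
    dyad (E.covec c' j b x) (frameVal T c i a x)).symm
  refine Finset.sum_congr rfl fun i _ => Finset.sum_congr rfl fun a _ => ?_
  conv_lhs => rw [← sum_covec_smul hx' (E.covec c i a x)]
  have := dyad_sum (Finset.univ : Finset (Σ j, Fin ((E.bdl j).rank c')))
    (fun J => E.covec c i a x (E.vec c' J.1 J.2 x)) (fun J => E.covec c' J.1 J.2 x)
    (frameVal T c i a x)
  rwa [Fintype.sum_sigma, Fintype.sum_sigma] at this

/-- A rank-one composition. Moving `ψ` to the left of a form of type `(a, b)` accounts for the
parity `a + b`, and passing the endomorphism of degree `n` accounts for the rest of `parPow (a + b +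
n)`. -/
lemma mulForm_dyad {a b : ℕ} {n r : ℤ} {x : X} (l l' : E.Tot x →ₗ[ℂ] ℂ) (ψ : Lam V)
    (e : E.Tot x) {t : E.TotForm x} (ht : t ∈ E.formTyp a b r x) :
    E.mulForm n x (dyad l t) (ψ ⊗ₜ l'.smulRight e) = l e • dyad l' (parPow (a + b + n) ψ • t) := by
  have : E.formTyp a b r x ≤ LinearMap.eqLocus
      ((E.mulForm n x).flip (ψ ⊗ₜ l'.smulRight e) ∘ₗ dyad l)
      (l e • dyad l' ∘ₗ (Algebra.lsmul ℂ ℂ (E.TotForm x) (parPow (a + b + n) ψ))) := by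
    refine Submodule.map₂_le.2 fun η hη e' _ => ?_
    rw [LinearMap.mem_eqLocus]
    simp only [LinearMap.comp_apply, LinearMap.smul_apply, LinearMap.flip_apply,
      TensorProduct.mk_apply, Algebra.lsmul_coe]
    change _ = l e • dyad l' (parPow (a + b + n) ψ • (η ⊗ₜ[ℂ] e'))
    rw [dyad_tmul, mulForm_tmul, typ_mul_comm hη, ← parPow_add, TensorProduct.smul_tmul',
      dyad_tmul, smul_eq_mul, ← TensorProduct.tmul_smul]
    refine congrArg (fun f => _ ⊗ₜ[ℂ] f) (LinearMap.ext fun v => ?_)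
    simp [smul_smul, mul_comm]
  exact this ht

/-- Expand `S` of a frame vector in the frame and pull the coefficients out of `T`, at the cost of
`parPow` of the total degree of `T`. By `mulForm_dyad` this is the signed product of matrices, so
composition of operators is computed in the fibre. -/
lemma fibreAt_mul {T : E.SheafEnd} {a b : ℕ} {n : ℤ} (hT : T ∈ E.AHom a b n) (S : E.SheafEnd)
    {c x : X} (hx : x ∈ E.frameDom c) :
    fibreAt (T * S) c x = E.mulForm n x (fibreAt T c x) (fibreAt S c x) := by
  have hx' := fun i => E.frameDom_le c i hx
  have hS : fibreAt S c x = ∑ j, ∑ b, ∑ i, ∑ a,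
      E.coef c i a x (frameVal S c j b x) ⊗ₜ[ℂ] (E.covec c j b x).smulRight (E.vec c i a x) := by
    rw [fibreAt_eq_sum S hx]
    exact (sum_sigma_comm fun i a j b =>
      E.coef c i a x (frameVal S c j b x) ⊗ₜ[ℂ] E.elem c i a j b x).symm
  rw [hS, map_sum]
  refine Finset.sum_congr rfl fun j _ => ?_
  rw [map_sum]
  refine Finset.sum_congr rfl fun k _ => ?_
  have h1 : frameVal (T * S) c j k x = ∑ i, ∑ l, parPow (a + b + n)
      (E.coef c i l x (frameVal S c j k x)) • frameVal T c i l x :=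
    (mem_AHom.1 hT).2.apply_eq_sum _ (hx' j) hx
  rw [h1, map_sum, map_sum]
  refine Finset.sum_congr rfl fun i _ => ?_
  rw [map_sum, map_sum]
  refine Finset.sum_congr rfl fun l _ => ?_
  simp only [fibreAt, map_sum, LinearMap.sum_apply]
  rw [Finset.sum_eq_single i, Finset.sum_eq_single l]
  · rw [mulForm_dyad _ _ _ _ (frameVal_mem hT.1 c i l x), covec_vec, (E.bdl i).coord_frame c x (hx' i),
      Pi.single_eq_same, one_smul]
  · intro l' _ hl
    rw [mulForm_dyad _ _ _ _ (frameVal_mem hT.1 c i l' x), covec_vec,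
      (E.bdl i).coord_frame c x (hx' i), Pi.single_eq_of_ne hl, zero_smul]
  · simp
  · intro i' _ hi
    refine Finset.sum_eq_zero fun l' _ => ?_
    rw [mulForm_dyad _ _ _ _ (frameVal_mem hT.1 c i' l' x), E.covec_vec_ne c c hi, zero_smul]
  · simp

lemma fibreAt_add (T S : E.SheafEnd) (c x : X) :
    fibreAt (T + S) c x = fibreAt T c x + fibreAt S c x := by
  simp only [fibreAt, ← Finset.sum_add_distrib, ← map_add]; rfl

lemma fibreAt_smul (r : ℂ) (T : E.SheafEnd) (c x : X) :
    fibreAt (r • T) c x = r • fibreAt T c x := by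
  simp only [fibreAt, Finset.smul_sum, ← map_smul]; rfl

lemma fibreAt_comm {T S : E.SheafEnd} {a b a' b' : ℕ} {n n' : ℤ} (hT : T ∈ E.AHom a b n)
    (hS : S ∈ E.AHom a' b' n') (j k : ℤ) {c x : X} (hx : x ∈ E.frameDom c) :
    fibreAt (E.comm j k T S) c x = E.mulForm n x (fibreAt T c x) (fibreAt S c x) -
      sg (j * k) • E.mulForm n' x (fibreAt S c x) (fibreAt T c x) := by
  have h : E.comm j k T S = T * S + (-(sg (j * k)) : ℂ) • (S * T) := by
    rw [comm_apply, neg_smul, ← sub_eq_add_neg, Int.cast_smul_eq_zsmul]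
  rw [h, fibreAt_add, fibreAt_smul, fibreAt_mul hT S hx, fibreAt_mul hS T hx, neg_smul,
    ← sub_eq_add_neg]
  congr 1

end Matrices

/-! ### The extension of the cyclic form to operators -/

section Pairing

variable (B : E.CyclicForm)

lemma CyclicForm.pairForm_fibreAt (n : ℤ) (T S : E.SheafEnd) {c x : X} (hx : x ∈ E.frameDom c) :
    B.pairForm n x (fibreAt T c x) (fibreAt S c x) =
      ∑ i, ∑ a, ∑ j, ∑ b, ∑ k, ∑ a', ∑ l, ∑ b',
        B.B x (E.elem c i a j b x) (E.elem c k a' l b' x) •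
          (E.coef c i a x (frameVal T c j b x) *
            parPow n (E.coef c k a' x (frameVal S c l b' x))) := by
  rw [fibreAt_eq_sum T hx]
  simp only [map_sum, LinearMap.sum_apply]
  simp only [fibreAt_eq_sum S hx, map_sum, B.pairForm_tmul]

variable {B} in
-- In `CyclicForm.pair` the sign is taken entry by entry from the degree `i - j` of the elementary
-- endomorphism. For an operator of pure type only the entries with `i - j = n` are nonzero, so a
-- single sign operator serves for all of them.
lemma CyclicForm.pair_eq {T S : E.SheafEnd} {a b : ℕ} {n : ℤ} (hT : HasType T a b n) (x : X) :
    B.pair T S x = B.pairForm n x (fibreAt T x x) (fibreAt S x x) := by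
  rw [B.pairForm_fibreAt n T S (E.mem_frameDom x), CyclicForm.pair]
  refine Finset.sum_congr rfl fun i _ => Finset.sum_congr rfl fun k _ =>
    Finset.sum_congr rfl fun j _ => Finset.sum_congr rfl fun l _ =>
    Finset.sum_congr rfl fun i' _ => Finset.sum_congr rfl fun k' _ =>
    Finset.sum_congr rfl fun j' _ => Finset.sum_congr rfl fun l' _ => ?_
  change _ • (E.coef x i k x (frameVal T x j l x) *
    par^[_] (E.coef x i' k' x (frameVal S x j' l' x))) = _
  rw [par_iterate]
  by_cases h : (i : ℤ) = j + n
  · have : (i : ℤ) - j = n := by omega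
    rw [this]
  · rw [E.coef_eq_zero k h (frameVal_mem hT x j l x), zero_mul, zero_mul]

lemma CyclicForm.pair_add_left (T T' S : E.SheafEnd) (x : X) :
    B.pair (T + T') S x = B.pair T S x + B.pair T' S x := by
  have h : ∀ i a j b, E.entry (T + T') i x a j b = E.entry T i x a j b + E.entry T' i x a j b :=
    fun i a j b => map_add (E.coef x i a x) _ _
  simp only [CyclicForm.pair, h, add_mul, smul_add, Finset.sum_add_distrib]

lemma CyclicForm.pair_smul_left (r : ℂ) (T S : E.SheafEnd) (x : X) :
    B.pair (r • T) S x = r • B.pair T S x := by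
  have h : ∀ i a j b, E.entry (r • T) i x a j b = r • E.entry T i x a j b :=
    fun i a j b => map_smul (E.coef x i a x) _ _
  simp only [CyclicForm.pair, h, smul_mul_assoc, Finset.smul_sum]
  simp only [smul_comm r]

lemma CyclicForm.pair_add_right (T S S' : E.SheafEnd) (x : X) :
    B.pair T (S + S') x = B.pair T S x + B.pair T S' x := by
  have h : ∀ i a j b, E.entry (S + S') i x a j b = E.entry S i x a j b + E.entry S' i x a j b :=
    fun i a j b => map_add (E.coef x i a x) _ _
  simp only [CyclicForm.pair, h, par_iterate, map_add, mul_add, smul_add, Finset.sum_add_distrib]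

lemma CyclicForm.pair_smul_right (r : ℂ) (T S : E.SheafEnd) (x : X) :
    B.pair T (r • S) x = r • B.pair T S x := by
  have h : ∀ i a j b, E.entry (r • S) i x a j b = r • E.entry S i x a j b :=
    fun i a j b => map_smul (E.coef x i a x) _ _
  simp only [CyclicForm.pair, h, par_iterate, map_smul, mul_smul_comm, Finset.smul_sum]
  simp only [smul_comm r]

variable {B} {T S R : E.SheafEnd} {a b a' b' a'' b'' : ℕ} {n n' n'' : ℤ}

lemma CyclicForm.pair_symm (hT : T ∈ E.AHom a b n) (hS : S ∈ E.AHom a' b' n') (x : X) :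
    B.pair T S x = sg ((a + b + n) * (a' + b' + n')) • B.pair S T x := by
  rw [pair_eq hT.1, pair_eq hS.1]
  exact B.pairForm_symm (fibreAt_mem hT.1 x x) (fibreAt_mem hS.1 x x)

lemma CyclicForm.pair_cyclic (hT : T ∈ E.AHom a b n) (hS : S ∈ E.AHom a' b' n')
    (hR : R ∈ E.AHom a'' b'' n'') (x : X) :
    B.pair T (E.comm (a' + b' + n') (a'' + b'' + n'') S R) x =
      B.pair (E.comm (a + b + n) (a' + b' + n') T S) R x := by
  rw [pair_eq hT.1, pair_eq (comm_mem_AHom hT hS _ _).1, fibreAt_comm hS hR _ _ (E.mem_frameDom x),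
    fibreAt_comm hT hS _ _ (E.mem_frameDom x)]
  exact B.pairForm_cyclic (fibreAt_mem hT.1 x x) (fibreAt_mem hS.1 x x) (fibreAt_mem hR.1 x x)

lemma CyclicForm.pair_eq_zero (hT : T ∈ E.AHom a b n) (hS : S ∈ E.AHom a' b' n')
    (h : n + n' ≠ 0) (x : X) : B.pair T S x = 0 := by
  rw [pair_eq hT.1]
  exact B.pairForm_eq_zero (fibreAt_mem hT.1 x x) (fibreAt_mem hS.1 x x) h

lemma CyclicForm.pair_mem (hT : T ∈ E.AHom a b n) (hS : S ∈ E.AHom a' b' n') (x : X) :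
    B.pair T S x ∈ typ V (a + a') (b + b') := by
  rw [pair_eq hT.1]
  exact B.pairForm_mem (fibreAt_mem hT.1 x x) (fibreAt_mem hS.1 x x)

lemma smoothOn_coef_frameVal (T : E.SheafEnd) (c : X) (i : Finset.Icc p q)
    (a : Fin ((E.bdl i).rank c)) (j : Finset.Icc p q) (b : Fin ((E.bdl j).rank c)) :
    SmoothOn (fun x => E.coef c i a x (frameVal T c j b x)) (E.frameDom c : Set X) :=
  ((T.on ((E.bdl j).dom c) (E.frameSec c j b)).2.2 c i a).mono fun _ hx =>
    ⟨E.frameDom_le c j hx, E.frameDom_le c i hx⟩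

lemma SmoothOn.parPow' (n : ℤ) {η : X → Lam V} {U : Set X} (h : SmoothOn η U) :
    SmoothOn (fun x => parPow n (η x)) U := by
  rcases sg_eq n with hn | hn
  · exact h.congr fun x _ => parPow_of_even hn _
  · exact h.par.congr fun x _ => parPow_of_odd hn _

/-- The pairing is defined at each `x` by the frame centred at `x`, which does not vary smoothly
with `x`. Near `c` the fixed frame around `c` gives the same value, and there all ingredients are
smooth. -/
lemma CyclicForm.smoothOn_pair (hT : T ∈ E.AHom a b n) (hS : S ∈ E.AHom a' b' n') :
    SmoothOn (B.pair T S) (Set.univ : Set X) := by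
  refine smoothOn_of_local fun c _ =>
    ⟨E.frameDom c, (E.frameDom c).2, E.mem_frameDom c, ?_⟩
  rw [Set.univ_inter]
  have h : ∀ x ∈ (E.frameDom c : Set X), B.pair T S x =
      ∑ i, ∑ a, ∑ j, ∑ b, ∑ k, ∑ a', ∑ l, ∑ b',
        algebraMap ℂ (Lam V) (B.B x (E.elem c i a j b x) (E.elem c k a' l b' x)) *
          (E.coef c i a x (frameVal T c j b x) *
            parPow n (E.coef c k a' x (frameVal S c l b' x))) := by
    intro x hx
    -- Change from the frame around `x` to the frame around `c`; this uses linearity over the forms.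
    rw [pair_eq hT.1, (mem_AHom.1 hT).2.fibreAt_eq (E.mem_frameDom x) hx, (mem_AHom.1 hS).2.fibreAt_eq (E.mem_frameDom x) hx,
      B.pairForm_fibreAt n T S hx]
    simp only [Algebra.smul_def]
  refine SmoothOn.congr ?_ h
  refine SmoothOn.sum _ fun i _ => SmoothOn.sum _ fun k _ => SmoothOn.sum _ fun j _ =>
    SmoothOn.sum _ fun l _ => SmoothOn.sum _ fun i' _ => SmoothOn.sum _ fun k' _ =>
    SmoothOn.sum _ fun j' _ => SmoothOn.sum _ fun l' _ => ?_
  refine SmoothOn.mul ?_ ((smoothOn_coef_frameVal T c i k j l).mul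
    (SmoothOn.parPow' n (smoothOn_coef_frameVal S c i' k' j' l')))
  exact HolOn.smooth ((B.holo c i k j l i' k' j' l').mono fun x hx i => E.frameDom_le c i hx)

end Pairing

end HolComplex

end HolCx

namespace HolCx

universe u v w

variable {V : Type u} [NormedAddCommGroup V] [NormedSpace ℂ V] [FiniteDimensional ℂ V]
  {X : Type v} [TopologicalSpace X] [ChartedSpace V X] [IsManifold 𝓘(ℂ, V) ω X] {p q : ℤ}

namespace HolComplex

variable {E : HolComplex.{u, v, w} V X p q}

/-! ### Formal identities of graded commutators -/

section FormalIdentities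

lemma comm_skew (i j : ℤ) (f g : E.SheafEnd) :
    E.comm i j f g = -(sg (i * j) • E.comm j i g f) := by
  simp only [comm_apply, mul_comm j i]
  rcases sg_eq (i * j) with h | h <;> rw [h] <;> module

/-- This and the skew symmetry hold for arbitrary integer labels, since they only use associativity
and the bimultiplicativity of the signs. They may therefore be applied to `D` and `∂̄`, which are
not in `A^{*,*}(Hom^*)`. -/
lemma comm_jacobi (i j k : ℤ) (f g h : E.SheafEnd) :
    E.comm i (j + k) f (E.comm j k g h) =
      E.comm (i + j) k (E.comm i j f g) h + sg (i * j) • E.comm j (i + k) g (E.comm i k f h) := by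
  have h1 : sg (i * (j + k)) = sg (i * j) * sg (i * k) := by rw [← sg_add]; congr 1; ring
  have h2 : sg ((i + j) * k) = sg (i * k) * sg (j * k) := by rw [← sg_add]; congr 1; ring
  have h3 : sg (j * (i + k)) = sg (i * j) * sg (j * k) := by rw [← sg_add]; congr 1; ring
  simp only [comm_apply, h1, h2, h3, mul_sub, sub_mul, mul_smul_comm, smul_mul_assoc, mul_assoc]
  rcases sg_eq (i * j) with h | h <;> rcases sg_eq (i * k) with h' | h' <;>
    rcases sg_eq (j * k) with h'' | h'' <;> rw [h, h', h''] <;> module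

lemma comm_comm_of_square_zero {d : E.SheafEnd} (hd : d * d = 0) (i : ℤ) (f : E.SheafEnd) :
    E.comm 1 (i + 1) d (E.comm 1 i d f) = 0 := by
  have h1 : d * (d * f) = 0 := by rw [← mul_assoc, hd, zero_mul]
  simp only [comm_apply, one_mul, sg_add, sg_one, mul_sub, sub_mul, mul_smul_comm, smul_mul_assoc,
    mul_assoc, h1, hd, mul_zero]
  rcases sg_eq i with h | h <;> rw [h] <;> module

end FormalIdentities

/-! ### Total degree with fixed holomorphic form degree -/

section TotalDegree

variable (E) in
/-- The part of total degree `k` of `A^{a,*}(Hom^*(E^*, E^*))`. -/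
noncomputable def HomDeg (a : ℕ) (k : ℤ) : Submodule ℂ E.SheafEnd :=
  ⨆ (b : ℕ) (n : ℤ) (_ : a + b + n = k), E.AHom a b n

lemma AHom_le_HomDeg {a b : ℕ} {n k : ℤ} (h : a + b + n = k) : E.AHom a b n ≤ E.HomDeg a k :=
  le_iSup_of_le b (le_iSup_of_le n (le_iSup_of_le h le_rfl))

lemma HomDeg_le {a : ℕ} {k : ℤ} {P : Submodule ℂ E.SheafEnd}
    (h : ∀ (b : ℕ) (n : ℤ), a + b + n = k → E.AHom a b n ≤ P) : E.HomDeg a k ≤ P :=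
  iSup_le fun b => iSup_le fun n => iSup_le fun e => h b n e

lemma HomDeg_induction {a : ℕ} {k : ℤ} {C : E.SheafEnd → Prop}
    (h : ∀ (b : ℕ) (n : ℤ), a + b + n = k → ∀ T ∈ E.AHom a b n, C T) (h0 : C 0)
    (ha : ∀ T T', C T → C T' → C (T + T')) {T : E.SheafEnd} (hT : T ∈ E.HomDeg a k) : C T := by
  refine Submodule.iSup_induction _ (motive := C) hT (fun b T hT => ?_) h0 ha
  refine Submodule.iSup_induction _ (motive := C) hT (fun n T hT => ?_) h0 ha
  exact Submodule.iSup_induction _ (motive := C) hT (fun e T hT => h b n e T hT) h0 ha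

lemma A0HomDeg_eq (k : ℤ) : E.A0HomDeg k = E.HomDeg 0 k := by
  simp [A0HomDeg, HomDeg]

lemma HomDeg_le_AHomDeg (a : ℕ) (k : ℤ) : E.HomDeg a k ≤ E.AHomDeg k :=
  HomDeg_le fun b n e =>
    le_iSup_of_le a (le_iSup_of_le b (le_iSup_of_le n (le_iSup_of_le e le_rfl)))

lemma comm_mem_HomDeg {a a' : ℕ} {i j : ℤ} {f g : E.SheafEnd} (hf : f ∈ E.HomDeg a i)
    (hg : g ∈ E.HomDeg a' j) (k l : ℤ) : E.comm k l f g ∈ E.HomDeg (a + a') (i + j) := by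
  have h1 : E.HomDeg a i ≤ (E.HomDeg (a + a') (i + j)).comap ((E.comm k l).flip g) := by
    refine HomDeg_le fun b n e f hf => ?_
    have h2 : E.HomDeg a' j ≤ (E.HomDeg (a + a') (i + j)).comap (E.comm k l f) := by
      refine HomDeg_le fun b' n' e' g hg => ?_
      exact AHom_le_HomDeg (by push_cast; omega) (comm_mem_AHom hf hg k l)
    exact h2 hg
  exact h1 hf

lemma comm_delbar_mem_HomDeg {a : ℕ} {i : ℤ} {f : E.SheafEnd} (hf : f ∈ E.HomDeg a i) :
    E.comm 1 i E.delbar f ∈ E.HomDeg a (i + 1) := by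
  have h1 : E.HomDeg a i ≤ (E.HomDeg a (i + 1)).comap (E.comm 1 i E.delbar) := by
    refine HomDeg_le fun b n e f hf => ?_
    refine AHom_le_HomDeg (b := b + 1) (n := n) (by push_cast; omega) ?_
    have := comm_delbar_mem hf
    rwa [e] at this
  exact h1 hf

lemma δOp_mem_HomDeg : E.δOp ∈ E.HomDeg 0 1 := AHom_le_HomDeg (by simp) E.δOp_mem

lemma comm_dolbeault_mem_HomDeg {a : ℕ} {i : ℤ} {f : E.SheafEnd} (hf : f ∈ E.HomDeg a i) :
    E.comm 1 i (E.delbar + E.δOp) f ∈ E.HomDeg a (i + 1) := by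
  rw [map_add, LinearMap.add_apply]
  refine Submodule.add_mem _ (comm_delbar_mem_HomDeg hf) ?_
  have := comm_mem_HomDeg δOp_mem_HomDeg hf 1 i
  rwa [zero_add, add_comm 1] at this

lemma Connection.nabla_mem_HomDeg (D : E.Connection) {a : ℕ} {i : ℤ} {f : E.SheafEnd}
    (hf : f ∈ E.HomDeg a i) : D.nabla i f ∈ E.HomDeg (a + 1) (i + 1) := by
  have h1 : E.HomDeg a i ≤ (E.HomDeg (a + 1) (i + 1)).comap (D.nabla i) := by
    refine HomDeg_le fun b n e f hf => ?_
    refine AHom_le_HomDeg (b := b) (n := n) (by push_cast; omega) ?_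
    have := comm_connection_mem D hf
    rwa [e] at this
  exact h1 hf

lemma Connection.atiyah_mem_HomDeg (D : E.Connection) : D.atiyah ∈ E.HomDeg 1 2 := by
  have h : E.AHom 1 1 0 ⊔ E.AHom 1 0 1 ≤ E.HomDeg 1 2 :=
    sup_le (AHom_le_HomDeg (by norm_num)) (AHom_le_HomDeg (by norm_num))
  exact h D.atiyah_mem

variable (E) in
/-- The subspace `A^{*,*}(Hom^*(E^*, E^*))`. -/
noncomputable def HomTot : Submodule ℂ E.SheafEnd := ⨆ (a : ℕ) (k : ℤ), E.HomDeg a k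

lemma HomDeg_le_HomTot (a : ℕ) (k : ℤ) : E.HomDeg a k ≤ E.HomTot :=
  le_iSup_of_le a (le_iSup_of_le k le_rfl)

lemma HomTot_induction {C : E.SheafEnd → Prop}
    (h : ∀ (a b : ℕ) (n : ℤ), ∀ T ∈ E.AHom a b n, C T) (h0 : C 0)
    (ha : ∀ T T', C T → C T' → C (T + T')) {T : E.SheafEnd} (hT : T ∈ E.HomTot) : C T := by
  refine Submodule.iSup_induction _ (motive := C) hT (fun a T hT => ?_) h0 ha
  refine Submodule.iSup_induction _ (motive := C) hT (fun k T hT => ?_) h0 ha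
  exact HomDeg_induction (fun b n _ => h a b n) h0 ha hT

variable (E) in
-- The pairing is a smooth form only on `A^{*,*}(Hom^*)`, whereas the components of an `L_∞`
-- morphism are multilinear maps on the ambient space. A complement of the subspace bridges the gap;
-- its choice does not affect values on `A^{*,*}(Hom^*)`.
lemma exists_homProj : ∃ π : E.SheafEnd →ₗ[ℂ] E.HomTot, ∀ T (h : T ∈ E.HomTot), π T = ⟨T, h⟩ := by
  obtain ⟨π, hπ⟩ := LinearMap.exists_leftInverse_of_injective E.HomTot.subtype
    (Submodule.ker_subtype _)
  exact ⟨π, fun T h => congrArg (fun f => f ⟨T, h⟩) hπ⟩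

variable (E) in
/-- A linear projection to `A^{*,*}(Hom^*(E^*, E^*))`. -/
noncomputable def homProj : E.SheafEnd →ₗ[ℂ] E.HomTot := Classical.choose E.exists_homProj

lemma homProj_apply {T : E.SheafEnd} (h : T ∈ E.HomTot) : E.homProj T = ⟨T, h⟩ :=
  Classical.choose_spec E.exists_homProj T h

end TotalDegree

/-! ### The pairing with values in `A^{*,*} / A^{≥ 2,*}`, and its differential -/

section PairingOfForms

variable (B : E.CyclicForm)

lemma CyclicForm.pair_zero_left (S : E.SheafEnd) (x : X) : B.pair 0 S x = 0 := by
  have := B.pair_smul_left 0 0 S x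
  rwa [zero_smul, zero_smul] at this

lemma CyclicForm.pair_zero_right (T : E.SheafEnd) (x : X) : B.pair T 0 x = 0 := by
  have := B.pair_smul_right 0 T 0 x
  rwa [zero_smul, zero_smul] at this

lemma CyclicForm.smoothOn_pair_of_mem {T S : E.SheafEnd} (hT : T ∈ E.HomTot)
    (hS : S ∈ E.HomTot) : SmoothOn (B.pair T S) (Set.univ : Set X) := by
  refine HomTot_induction (C := fun T => SmoothOn (B.pair T S) (Set.univ : Set X))
    (fun a b n T hT => ?_) ((smoothOn_zero _).congr fun x _ => B.pair_zero_left S x)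
    (fun T T' h h' => (h.add h').congr fun x _ => B.pair_add_left T T' S x) hT
  exact HomTot_induction (C := fun S => SmoothOn (B.pair T S) (Set.univ : Set X))
    (fun a' b' n' S hS => CyclicForm.smoothOn_pair hT hS)
    ((smoothOn_zero _).congr fun x _ => B.pair_zero_right T x)
    (fun S S' h h' => (h.add h').congr fun x _ => B.pair_add_right T S S' x) hS

/-- The extension of the cyclic form to `A^{*,*}(Hom^*(E^*, E^*))`. -/
noncomputable def CyclicForm.pairX : E.HomTot →ₗ[ℂ] E.HomTot →ₗ[ℂ] Frm V (⊤ : Opens X) :=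
  LinearMap.mk₂ ℂ (fun T S => ⟨B.pair T.1 S.1, fun _ hx => absurd trivial hx,
      B.smoothOn_pair_of_mem T.2 S.2⟩)
    (fun T T' S => Subtype.ext <| funext fun x => B.pair_add_left T.1 T'.1 S.1 x)
    (fun r T S => Subtype.ext <| funext fun x => B.pair_smul_left r T.1 S.1 x)
    (fun T S S' => Subtype.ext <| funext fun x => B.pair_add_right T.1 S.1 S'.1 x)
    (fun r T S => Subtype.ext <| funext fun x => B.pair_smul_right r T.1 S.1 x)

lemma CyclicForm.pairX_apply (T S : E.HomTot) (x : X) :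
    (B.pairX T S).1 x = B.pair T.1 S.1 x := rfl

/-- The class of `⟨T, S⟩` modulo `A^{≥ 2,*}`, extended by linearity to all endomorphisms. -/
noncomputable def CyclicForm.pairQ : E.SheafEnd →ₗ[ℂ] E.SheafEnd →ₗ[ℂ] TruncX V X :=
  (B.pairX.compl₁₂ E.homProj E.homProj).compr₂ (filtX V X 2).mkQ

lemma CyclicForm.pairQ_apply {T S : E.SheafEnd} (hT : T ∈ E.HomTot) (hS : S ∈ E.HomTot) :
    B.pairQ T S = (filtX V X 2).mkQ (B.pairX ⟨T, hT⟩ ⟨S, hS⟩) := by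
  simp [CyclicForm.pairQ, homProj_apply hT, homProj_apply hS]

variable {B} {a a' a'' : ℕ} {i j k : ℤ} {T S R : E.SheafEnd}

lemma CyclicForm.pair_symm_HomDeg (hT : T ∈ E.HomDeg a i) (hS : S ∈ E.HomDeg a' j) (x : X) :
    B.pair T S x = sg (i * j) • B.pair S T x := by
  refine HomDeg_induction (C := fun T => B.pair T S x = sg (i * j) • B.pair S T x)
    (fun b n e T hT => ?_) (by rw [B.pair_zero_left, B.pair_zero_right, smul_zero])
    (fun T T' h h' => by rw [B.pair_add_left, B.pair_add_right, h, h', smul_add]) hT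
  refine HomDeg_induction (C := fun S => B.pair T S x = sg (i * j) • B.pair S T x)
    (fun b' n' e' S hS => ?_) (by rw [B.pair_zero_left, B.pair_zero_right, smul_zero])
    (fun S S' h h' => by rw [B.pair_add_left, B.pair_add_right, h, h', smul_add]) hS
  have := CyclicForm.pair_symm (B := B) hT hS x
  rwa [e, e'] at this

lemma CyclicForm.pairQ_symm (hT : T ∈ E.HomDeg a i) (hS : S ∈ E.HomDeg a' j) :
    B.pairQ T S = sg (i * j) • B.pairQ S T := by
  have hT' := HomDeg_le_HomTot a i hT
  have hS' := HomDeg_le_HomTot a' j hS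
  rw [B.pairQ_apply hT' hS', B.pairQ_apply hS' hT', ← map_zsmul]
  exact congrArg _ (Subtype.ext <| funext fun x => CyclicForm.pair_symm_HomDeg hT hS x)

lemma CyclicForm.pairQ_cyclic (hT : T ∈ E.HomDeg a i) (hS : S ∈ E.HomDeg a' j)
    (hR : R ∈ E.HomDeg a'' k) :
    B.pairQ T (E.comm j k S R) = B.pairQ (E.comm i j T S) R := by
  refine HomDeg_induction
    (C := fun T => B.pairQ T (E.comm j k S R) = B.pairQ (E.comm i j T S) R)
    (fun b n e T hT => ?_) (by simp only [map_zero, LinearMap.zero_apply])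
    (fun T T' h h' => by simp only [map_add, LinearMap.add_apply, h, h']) hT
  refine HomDeg_induction
    (C := fun S => B.pairQ T (E.comm j k S R) = B.pairQ (E.comm i j T S) R)
    (fun b' n' e' S hS => ?_) (by simp only [map_zero, LinearMap.zero_apply])
    (fun S S' h h' => by simp only [map_add, LinearMap.add_apply, h, h']) hS
  refine HomDeg_induction
    (C := fun R => B.pairQ T (E.comm j k S R) = B.pairQ (E.comm i j T S) R)
    (fun b'' n'' e'' R hR => ?_) (by simp only [map_zero])
    (fun R R' h h' => by simp only [map_add, h, h']) hR
  have hT' := HomDeg_le_HomTot a i (AHom_le_HomDeg e hT)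
  have hR' := HomDeg_le_HomTot a'' k (AHom_le_HomDeg e'' hR)
  have h4 := HomDeg_le_HomTot _ _ (AHom_le_HomDeg rfl (comm_mem_AHom hS hR j k))
  have h5 := HomDeg_le_HomTot _ _ (AHom_le_HomDeg rfl (comm_mem_AHom hT hS i j))
  rw [B.pairQ_apply hT' h4, B.pairQ_apply h5 hR']
  refine congrArg _ (Subtype.ext <| funext fun x => ?_)
  have := CyclicForm.pair_cyclic (B := B) hT hS hR x
  rwa [e, e', e''] at this

/-- `⟨T, S⟩` is of type `(a + a', *)` and of total degree `i + j`. -/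
lemma CyclicForm.pairX_mem (hT : T ∈ E.HomDeg a i) (hS : S ∈ E.HomDeg a' j) :
    B.pairX ⟨T, HomDeg_le_HomTot a i hT⟩ ⟨S, HomDeg_le_HomTot a' j hS⟩ ∈
      ⨆ (c : ℕ) (_ : ((a + a' : ℕ) : ℤ) + c = i + j), typX V X (a + a') c := by
  set P := ⨆ (c : ℕ) (_ : ((a + a' : ℕ) : ℤ) + c = i + j), typX V X (a + a') c
  have h0 : ∀ {T S : E.SheafEnd} (hT : T ∈ E.HomTot) (hS : S ∈ E.HomTot),
      B.pairX (E.homProj T) (E.homProj S) = B.pairX ⟨T, hT⟩ ⟨S, hS⟩ :=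
    fun hT hS => by rw [homProj_apply hT, homProj_apply hS]
  rw [← h0]
  refine HomDeg_induction (C := fun T => B.pairX (E.homProj T) (E.homProj S) ∈ P)
    (fun b n e T hT => ?_) (by simp only [map_zero, LinearMap.zero_apply]; exact P.zero_mem)
    (fun T T' h h' => by simp only [map_add, LinearMap.add_apply]; exact P.add_mem h h') hT
  refine HomDeg_induction (C := fun S => B.pairX (E.homProj T) (E.homProj S) ∈ P)
    (fun b' n' e' S hS => ?_) (by simp only [map_zero]; exact P.zero_mem)
    (fun T T' h h' => by simp only [map_add]; exact P.add_mem h h') hS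
  have hT' := HomDeg_le_HomTot a i (AHom_le_HomDeg e hT)
  have hS' := HomDeg_le_HomTot a' j (AHom_le_HomDeg e' hS)
  rw [h0 hT' hS']
  by_cases h : n + n' = 0
  · refine Submodule.mem_iSup_of_mem (b + b') (Submodule.mem_iSup_of_mem ?_ ?_)
    · push_cast; omega
    · exact fun x => CyclicForm.pair_mem hT hS x
  · have : B.pairX ⟨T, hT'⟩ ⟨S, hS'⟩ = 0 :=
      Subtype.ext <| funext fun x => CyclicForm.pair_eq_zero hT hS h x
    rw [this]; exact P.zero_mem

lemma typX_le_filtX {a b r : ℕ} (h : r ≤ a) : typX V X a b ≤ filtX V X r := fun _ hη x =>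
  Submodule.mem_iSup_of_mem a (Submodule.mem_iSup_of_mem b (Submodule.mem_iSup_of_mem h (hη x)))

/-- The pairing adds holomorphic form degrees, so such a pairing lies in `A^{≥ 2,*}`. All
cancellations special to the truncated target come from here. -/
lemma CyclicForm.pairQ_eq_zero (hT : T ∈ E.HomDeg a i) (hS : S ∈ E.HomDeg a' j)
    (h : 2 ≤ a + a') : B.pairQ T S = 0 := by
  rw [B.pairQ_apply (HomDeg_le_HomTot a i hT) (HomDeg_le_HomTot a' j hS), Submodule.mkQ_apply,
    Submodule.Quotient.mk_eq_zero]
  have : (⨆ (c : ℕ) (_ : ((a + a' : ℕ) : ℤ) + c = i + j), typX V X (a + a') c) ≤ filtX V X 2 :=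
    iSup_le fun c => iSup_le fun _ => typX_le_filtX h
  exact this (CyclicForm.pairX_mem hT hS)

lemma CyclicForm.pairQ_mem_gr (hT : T ∈ E.HomDeg a i) (hS : S ∈ E.HomDeg a' j) {m : ℤ}
    (hm : i + j = m + 2) : B.pairQ T S ∈ (truncDGLie V X).gr m := by
  rw [B.pairQ_apply (HomDeg_le_HomTot a i hT) (HomDeg_le_HomTot a' j hS)]
  have : (⨆ (c : ℕ) (_ : ((a + a' : ℕ) : ℤ) + c = i + j), typX V X (a + a') c) ≤
      ((truncDGLie V X).gr m).comap (filtX V X 2).mkQ :=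
    iSup_le fun c => iSup_le fun e η hη =>
      Submodule.mem_iSup_of_mem (a + a') (Submodule.mem_iSup_of_mem c
        (Submodule.mem_iSup_of_mem (e.trans hm) ⟨η, hη, rfl⟩))
  exact this (CyclicForm.pairX_mem hT hS)

variable {D : E.Connection}

/-- The differential of `⟨T, S⟩` for a cyclic form compatible with the connection. -/
lemma Connection.IsCompatible.truncD_pairQ (hD : D.IsCompatible B) (hT : T ∈ E.HomDeg a i)
    (hS : S ∈ E.HomDeg a' j) :
    truncD V X (B.pairQ T S) =
      B.pairQ (D.nabla i T) S + B.pairQ (E.comm 1 i (E.delbar + E.δOp) T) S +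
      sg i • (B.pairQ T (D.nabla j S) + B.pairQ T (E.comm 1 j (E.delbar + E.δOp) S)) := by
  -- Invariance of the form under `[δ, -]`, a consequence of cyclicity. It allows the `δ`-terms to
  -- be inserted into the compatibility relation, which only contains `D`.
  have hδ : B.pairQ T (E.comm 1 j E.δOp S) = -(sg i • B.pairQ (E.comm 1 i E.δOp T) S) := by
    rw [CyclicForm.pairQ_cyclic hT δOp_mem_HomDeg hS, comm_skew, mul_one, map_neg, map_zsmul]
    rfl
  have hN : ∀ {a : ℕ} {i : ℤ} {T : E.SheafEnd}, T ∈ E.HomDeg a i →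
      E.comm 1 i D.D T = D.nabla i T + E.comm 1 i E.delbar T := fun {a i T} hT => by
    rw [Connection.nabla, map_sub]
    simp
  have hm : ∀ {a : ℕ} {i : ℤ} {T : E.SheafEnd}, T ∈ E.HomDeg a i →
      E.comm 1 i D.D T ∈ E.HomTot := fun {a i T} hT => by
    rw [hN hT]
    exact Submodule.add_mem _ (HomDeg_le_HomTot _ _ (D.nabla_mem_HomDeg hT))
      (HomDeg_le_HomTot _ _ (comm_delbar_mem_HomDeg hT))
  -- The compatibility relation, passed to the quotient.
  have key : truncD V X (B.pairQ T S) =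
      B.pairQ (E.comm 1 i D.D T) S + sg i • B.pairQ T (E.comm 1 j D.D S) := by
    have hT' := HomDeg_le_HomTot a i hT
    have hS' := HomDeg_le_HomTot a' j hS
    rw [B.pairQ_apply hT' hS', B.pairQ_apply (hm hT) hS', B.pairQ_apply hT' (hm hS), truncD,
      Submodule.mkQ_apply, Submodule.mapQ_apply, ← map_zsmul, ← map_add]
    refine congrArg (filtX V X 2).mkQ (Subtype.ext <| funext fun x => ?_)
    exact (hD i j T (HomDeg_le_AHomDeg a i hT) S (HomDeg_le_AHomDeg a' j hS) x).symm
  rw [key, hN hT, hN hS]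
  simp only [map_add, LinearMap.add_apply, hδ]
  rcases sg_eq i with h | h <;> rw [h] <;> module

end PairingOfForms

end HolComplex

end HolCx

/-! ### Independence of the degrees via scaling, and the source DG-Lie algebra -/

namespace HolCx

universe u v w

variable {V : Type u} [NormedAddCommGroup V] [NormedSpace ℂ V] [FiniteDimensional ℂ V]
  {X : Type v} [TopologicalSpace X] [ChartedSpace V X] [IsManifold 𝓘(ℂ, V) ω X] {p q : ℤ}

lemma two_zpow_injective : Function.Injective fun k : ℤ => (2 : ℂ) ^ k := fun i j h => by
  have h' : ((2 : ℝ) ^ i : ℝ) = 2 ^ j := by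
    have : (((2 : ℝ) ^ i : ℝ) : ℂ) = (((2 : ℝ) ^ j : ℝ) : ℂ) := by push_cast; exact h
    exact_mod_cast this
  exact zpow_right_injective₀ two_pos (by norm_num) h'

/-- Eigenspaces for distinct eigenvalues are independent, and the powers of `2` are distinct. The
shift `c` accommodates the shifted grading of the target. -/
lemma iSupIndep_of_eigenspaces {W : Type*} [AddCommGroup W] [Module ℂ W] (f : Module.End ℂ W)
    (c : ℤ) {P : ℤ → Submodule ℂ W} (h : ∀ k, ∀ w ∈ P k, f w = (2 : ℂ) ^ (k + c) • w) :
    iSupIndep P := by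
  refine (f.eigenspaces_iSupIndep.comp (f := fun k : ℤ => (2 : ℂ) ^ (k + c))
    fun i j e => ?_).mono fun k w hw => Module.End.mem_eigenspace_iff.2 (h k w hw)
  exact add_right_cancel (two_zpow_injective e)

/-- Independence makes the map from the direct sum injective, and over a field it has a linear left
inverse. The sign is applied componentwise after that inverse; off the span of the `P k` the values
are arbitrary. -/
lemma exists_sign_of_iSupIndep {W : Type*} [AddCommGroup W] [Module ℂ W]
    {P : ℤ → Submodule ℂ W} (h : iSupIndep P) :
    ∃ α : W →ₗ[ℂ] W, ∀ k, ∀ w ∈ P k, α w = sg k • w := by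
  classical
  obtain ⟨π, hπ⟩ := LinearMap.exists_leftInverse_of_injective
    (DirectSum.coeLinearMap P) (LinearMap.ker_eq_bot.2 h.dfinsupp_lsum_injective)
  refine ⟨DirectSum.toModule ℂ ℤ W (fun k => (sg k : ℂ) • (P k).subtype) ∘ₗ π, fun k w hw => ?_⟩
  have h1 : π w = DirectSum.lof ℂ ℤ (fun k => P k) k ⟨w, hw⟩ := by
    have := congrArg (fun f => f (DirectSum.lof ℂ ℤ (fun k => P k) k ⟨w, hw⟩)) hπ
    simpa using this
  simp [h1, DirectSum.toModule_lof, Int.cast_smul_eq_zsmul]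

namespace HolComplex

variable (E : HolComplex.{u, v, w} V X p q)

/-- Multiplication by `t ^ r` on `E^r_x`. -/
noncomputable def totScale (t : ℝ) (x : X) : E.Tot x →ₗ[ℂ] E.Tot x :=
  LinearMap.pi fun i => ((t : ℂ) ^ (i : ℤ)) • LinearMap.proj i

lemma totScale_of_totDeg (t : ℝ) {x : X} {r : ℤ} {e : E.Tot x} (he : e ∈ E.totDeg r x) :
    E.totScale t x e = (t : ℂ) ^ r • e := by
  funext i
  change (t : ℂ) ^ (i : ℤ) • e i = (t : ℂ) ^ r • e i
  by_cases h : (i : ℤ) = r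
  · rw [h]
  · rw [he i h, smul_zero, smul_zero]

/-- Multiplication by `t ^ (a + b + r)` on the forms of type `(a, b)` with values in `E^r`. -/
noncomputable def formScale (t : ℝ) (x : X) : E.TotForm x →ₗ[ℂ] E.TotForm x :=
  TensorProduct.map (pull (scaleMap t)).toLinearMap (E.totScale t x)

lemma coef_formScale (t : ℝ) (c : X) (i : Finset.Icc p q) (a : Fin ((E.bdl i).rank c)) (x : X)
    (s : E.TotForm x) : E.coef c i a x (E.formScale t x s) =
      (t : ℂ) ^ (i : ℤ) • pull (scaleMap t) (E.coef c i a x s) := by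
  induction s using TensorProduct.induction_on with
  | zero => simp
  | tmul η e =>
    rw [formScale, TensorProduct.map_tmul, coef_tmul, coef_tmul, map_smul, smul_smul]
    congr 1
    change (E.bdl i).coord c x ((t : ℂ) ^ (i : ℤ) • e i) a = _
    rw [map_smul]; rfl
  | add s s' h h' => rw [map_add, map_add, map_add, map_add, smul_add, h, h']

lemma formScale_smul (t : ℝ) {x : X} (η : Lam V) (s : E.TotForm x) :
    E.formScale t x (η • s) = pull (scaleMap t) η • E.formScale t x s := by
  induction s using TensorProduct.induction_on with
  | zero => simp
  | tmul θ e =>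
    rw [TensorProduct.smul_tmul', formScale, TensorProduct.map_tmul, TensorProduct.map_tmul,
      TensorProduct.smul_tmul', smul_eq_mul, smul_eq_mul]
    exact congrArg (· ⊗ₜ[ℂ] _) (map_mul (pull (scaleMap t)) η θ)
  | add s s' h h' => rw [smul_add, map_add, map_add, smul_add, h, h']

lemma formScale_formTyp {t : ℝ} (ht : t ≠ 0) {x : X} {a b : ℕ} {r : ℤ} {s : E.TotForm x}
    (hs : s ∈ E.formTyp a b r x) : E.formScale t x s = (t : ℂ) ^ (a + b + r) • s := by
  have : E.formTyp a b r x ≤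
      LinearMap.eqLocus (E.formScale t x) ((t : ℂ) ^ (a + b + r) • LinearMap.id) := by
    refine Submodule.map₂_le.2 fun η hη e he => ?_
    change E.formScale t x (η ⊗ₜ e) = (t : ℂ) ^ (a + b + r) • (η ⊗ₜ e)
    rw [formScale, TensorProduct.map_tmul, E.totScale_of_totDeg t he, TensorProduct.tmul_smul]
    change (t : ℂ) ^ r • (pull (scaleMap t) η ⊗ₜ[ℂ] e) = _
    rw [pull_scaleMap_typ t hη, ← TensorProduct.smul_tmul', smul_smul,
      zpow_add₀ (by exact_mod_cast ht), mul_comm]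
    norm_cast
  exact this hs

lemma formScale_inv {t : ℝ} (ht : t ≠ 0) {x : X} (s : E.TotForm x) :
    E.formScale t x (E.formScale t⁻¹ x s) = s := by
  have h : (t : ℂ) ≠ 0 := by exact_mod_cast ht
  induction s using TensorProduct.induction_on with
  | zero => simp
  | tmul η e =>
    rw [formScale, formScale, TensorProduct.map_tmul, TensorProduct.map_tmul]
    congr 1
    · change pull (scaleMap t) (pull (scaleMap t⁻¹) η) = η
      rw [pull_pull]
      have e : (scaleMap t⁻¹).comp (scaleMap t) = ContinuousLinearMap.id ℂ V := by
        ext v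
        change ((t⁻¹ : ℝ) : ℂ) • (t : ℂ) • v = v
        rw [Complex.ofReal_inv, inv_smul_smul₀ h]
      rw [e, pull_id]
    · funext i
      change (t : ℂ) ^ (i : ℤ) • ((t⁻¹ : ℝ) : ℂ) ^ (i : ℤ) • e i = e i
      rw [smul_smul, ← mul_zpow]
      simp [h]
  | add s s' h h' => rw [map_add, map_add, h, h']

/-- Multiplication by `t ^ (a + b + r)` on `A^{a,b}(E^r)`. -/
noncomputable def scaleOp (t : ℝ) : E.SheafEnd :=
  ⟨fun U =>
    { toFun := fun s => ⟨fun x => E.formScale t x (s.1 x), fun x hx => by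
          change E.formScale t x (s.1 x) = 0
          rw [s.2.1 x hx, map_zero], fun c i a => by
          simp only [coef_formScale]
          exact ((s.2.2 c i a).comp_linear (pull (scaleMap t)).toLinearMap
            fun A x => pull_scaleMap_comm t A x).smul _⟩
      map_add' := fun s s' => Subtype.ext <| funext fun x => map_add (E.formScale t x) _ _
      map_smul' := fun r s => Subtype.ext <| funext fun x => map_smul (E.formScale t x) _ _ },
    fun U W hWU s s' e x hx => by
      change E.formScale t x _ = E.formScale t x _
      rw [e x hx]⟩

variable {E}

lemma scaleOp_mul_inv {t : ℝ} (ht : t ≠ 0) : E.scaleOp t * E.scaleOp t⁻¹ = 1 :=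
  SheafEnd.ext' fun _ s => Subtype.ext <| funext fun x => E.formScale_inv ht (s.1 x)

lemma scaleOp_on_formTyp {t : ℝ} (ht : t ≠ 0) {U : Opens X} {s : E.Sec U} {a b : ℕ} {r : ℤ}
    (hs : ∀ x, s.1 x ∈ E.formTyp a b r x) :
    (E.scaleOp t).on U s = (t : ℂ) ^ (a + b + r) • s :=
  Subtype.ext <| funext fun x => E.formScale_formTyp ht (hs x)

lemma pull_scaleMap_lamDeg (t : ℝ) {m : ℤ} {η : Lam V} (h : η ∈ lamDeg V m) :
    pull (scaleMap t) η = (t : ℂ) ^ m • η := by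
  have : lamDeg V m ≤
      LinearMap.eqLocus (pull (scaleMap t)).toLinearMap ((t : ℂ) ^ m • LinearMap.id) :=
    lamDeg_le fun a b e η hη => by
      change pull (scaleMap t) η = (t : ℂ) ^ m • η
      rw [pull_scaleMap_typ t hη, ← e]
      norm_cast
  exact this h

lemma scaleOp_smul (t : ℝ) {U : Opens X} {m : ℤ} {φ : Frm V U}
    (hφ : ∀ x, φ.1 x ∈ lamDeg V m) (s : E.Sec U) :
    (E.scaleOp t).on U (E.smul φ s) = (t : ℂ) ^ m • E.smul φ ((E.scaleOp t).on U s) :=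
  Subtype.ext <| funext fun x => by
    change E.formScale t x (φ.1 x • s.1 x) = (t : ℂ) ^ m • (φ.1 x • E.formScale t x (s.1 x))
    rw [formScale_smul, pull_scaleMap_lamDeg t (hφ x), smul_assoc]

/-- Compared on `φ e` with `e` a frame section of `E^i`: the form contributes the same power of `t`
on both sides, while `T e` has total degree `i + a + b + n` instead of `i`. -/
lemma scaleOp_mul {t : ℝ} (ht : t ≠ 0) {T : E.SheafEnd} {a b : ℕ} {n : ℤ}
    (hT : T ∈ E.AHom a b n) :
    E.scaleOp t * T = (t : ℂ) ^ (a + b + n) • (T * E.scaleOp t) := by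
  have h0 : (t : ℂ) ≠ 0 := by exact_mod_cast ht
  refine E.sheafEnd_ext_homGen fun W s ⟨m, φ, c, i, k, hW, hφ, hs⟩ => ?_
  set e := E.restr hW (E.frameSec c i k)
  have he : ∀ x, e.1 x ∈ E.formTyp 0 0 i x := E.sec_mem fun x hx => by
    rw [E.restr_apply hW _ hx, E.frameSec_apply (hW hx)]
    exact tmul_mem_formTyp E one_mem_typ (E.vec_mem_totDeg c i k x)
  have hTe := hT.1 W e 0 0 i he
  rw [hs, SheafEnd.smul_on, SheafEnd.mul_on, SheafEnd.mul_on, hT.2 W φ e m hφ,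
    scaleOp_smul t hφ, scaleOp_on_formTyp ht he, smul_smul', SheafEnd.on_zsmul,
    scaleOp_smul t hφ, scaleOp_on_formTyp ht hTe, smul_smul', LinearMap.map_smul,
    LinearMap.map_smul, hT.2 W φ e m hφ]
  have h1 : (t : ℂ) ^ ((a + 0 : ℕ) + (b + 0 : ℕ) + ((i : ℤ) + n)) =
      t ^ (a + b + n) * t ^ (((0 : ℕ) : ℤ) + ((0 : ℕ) : ℤ) + (i : ℤ)) := by
    rw [← zpow_add₀ h0]; congr 1; push_cast; ring
  rw [h1]
  module

variable (E) in
/-- The conjugation by `scaleOp t`, which is multiplication by `t ^ k` on endomorphisms of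
degree `k`. -/
noncomputable def conjScale (t : ℝ) : Module.End ℂ E.SheafEnd :=
  LinearMap.mulLeft ℂ (E.scaleOp t) ∘ₗ LinearMap.mulRight ℂ (E.scaleOp t⁻¹)

lemma conjScale_apply {t : ℝ} (ht : t ≠ 0) {T : E.SheafEnd} {a : ℕ} {k : ℤ}
    (hT : T ∈ E.HomDeg a k) : E.conjScale t T = (t : ℂ) ^ k • T := by
  refine HomDeg_induction (C := fun T => E.conjScale t T = (t : ℂ) ^ k • T)
    (fun b n e T hT => ?_) (by rw [map_zero, smul_zero])
    (fun T T' h h' => by rw [map_add, h, h', smul_add]) hT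
  rw [conjScale, LinearMap.comp_apply, LinearMap.mulRight_apply, LinearMap.mulLeft_apply,
    ← mul_assoc, scaleOp_mul ht hT, e, smul_mul_assoc, mul_assoc, scaleOp_mul_inv ht, mul_one]

/-- Conjugation by the scaling operator with `t = 2` has eigenvalue `2 ^ k` in degree `k`. -/
lemma iSupIndep_A0HomDeg : iSupIndep E.A0HomDeg :=
  iSupIndep_of_eigenspaces (E.conjScale 2) 0 fun k T hT => by
    rw [A0HomDeg_eq] at hT
    rw [conjScale_apply two_ne_zero hT, add_zero, Complex.ofReal_ofNat]

theorem isDGLie_dolbeaultDGLie : E.dolbeaultDGLie.IsDGLie where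
  indep := iSupIndep_A0HomDeg
  d_mem i f hf := by
    change f ∈ E.A0HomDeg i at hf
    change E.comm 1 i _ f ∈ E.A0HomDeg (i + 1)
    rw [A0HomDeg_eq] at hf ⊢
    exact comm_dolbeault_mem_HomDeg hf
  d_d i f _ := comm_comm_of_square_zero E.dolbeault_mul_self i f
  br_mem i j f hf g hg := by
    change f ∈ E.A0HomDeg i at hf
    change g ∈ E.A0HomDeg j at hg
    change E.comm i j f g ∈ E.A0HomDeg (i + j)
    rw [A0HomDeg_eq] at hf hg ⊢
    exact comm_mem_HomDeg hf hg i j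
  skew i j f _ g _ := comm_skew i j f g
  -- The Leibniz rule is the Jacobi identity with `∂̄ + δ`, of degree one, as first argument.
  leibniz i j f _ g _ := by
    have := comm_jacobi 1 i j (E.delbar + E.δOp) f g
    rw [one_mul, add_comm 1 i, add_comm 1 j] at this
    exact this
  jacobi i j k f _ g _ h _ := comm_jacobi i j k f g h

end HolComplex

/-! ### The target DG-Lie algebra -/

section Truncation

variable (V X)

/-- The pull-back of global forms by the homothety `t` of the tangent spaces. -/
noncomputable def frmScale (t : ℝ) : Frm V (⊤ : Opens X) →ₗ[ℂ] Frm V (⊤ : Opens X) where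
  toFun η := ⟨fun x => pull (scaleMap t) (η.1 x), fun _ hx => absurd trivial hx,
    η.2.2.comp_linear (pull (scaleMap t)).toLinearMap fun A x => pull_scaleMap_comm t A x⟩
  map_add' η θ := Subtype.ext <| funext fun x => map_add (pull (scaleMap t)) (η.1 x) (θ.1 x)
  map_smul' r η := Subtype.ext <| funext fun x => map_smul (pull (scaleMap t)) r (η.1 x)

lemma frmScale_filtX (t : ℝ) (r : ℕ) : filtX V X r ≤ (filtX V X r).comap (frmScale V X t) :=
  fun _ h x => pull_filt (scaleMap t) r (h x)

/-- Separates the degrees in the quotient: for `t = 2` it is multiplication by `2 ^ (k + 2)` on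
classes of degree `k`. -/
noncomputable def truncScale (t : ℝ) : Module.End ℂ (TruncX V X) :=
  (filtX V X 2).mapQ (filtX V X 2) (frmScale V X t) (frmScale_filtX V X t 2)

variable {V X}

/-- To prove a linear condition on classes of degree `k`, consider those of type `(a, b)`. -/
lemma truncDGLie_induction {k : ℤ} {C : TruncX V X → Prop}
    (h : ∀ (a b : ℕ), (a : ℤ) + b = k + 2 → ∀ η ∈ typX V X a b, C ((filtX V X 2).mkQ η)) (h0 : C 0)
    (ha : ∀ y z, C y → C z → C (y + z)) {y : TruncX V X} (hy : y ∈ (truncDGLie V X).gr k) :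
    C y := by
  refine Submodule.iSup_induction _ (motive := C) hy (fun a y hy => ?_) h0 ha
  refine Submodule.iSup_induction _ (motive := C) hy (fun b y hy => ?_) h0 ha
  refine Submodule.iSup_induction _ (motive := C) hy (fun e y hy => ?_) h0 ha
  obtain ⟨η, hη, rfl⟩ := hy
  exact h a b e η hη

lemma mkQ_mem_truncDGLie {a b : ℕ} {k : ℤ} (h : (a : ℤ) + b = k + 2) {η : Frm V (⊤ : Opens X)}
    (hη : η ∈ typX V X a b) : (filtX V X 2).mkQ η ∈ (truncDGLie V X).gr k :=
  Submodule.mem_iSup_of_mem a (Submodule.mem_iSup_of_mem b (Submodule.mem_iSup_of_mem h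
    ⟨η, hη, rfl⟩))

lemma truncScale_apply {k : ℤ} {y : TruncX V X} (hy : y ∈ (truncDGLie V X).gr k) :
    truncScale V X 2 y = (2 : ℂ) ^ (k + 2) • y := by
  refine truncDGLie_induction (C := fun y => truncScale V X 2 y = (2 : ℂ) ^ (k + 2) • y)
    (fun a b e η hη => ?_) (by rw [map_zero, smul_zero])
    (fun y z h h' => by rw [map_add, h, h', smul_add]) hy
  rw [truncScale, Submodule.mkQ_apply, Submodule.mapQ_apply, ← Submodule.mkQ_apply,
    ← Submodule.mkQ_apply, ← map_smul]
  refine congrArg (filtX V X 2).mkQ (Subtype.ext <| funext fun x => ?_)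
  change pull (scaleMap 2) (η.1 x) = (2 : ℂ) ^ (k + 2) • η.1 x
  rw [pull_scaleMap_typ 2 (hη x), ← e]
  norm_cast

lemma truncD_mem {k : ℤ} {y : TruncX V X} (hy : y ∈ (truncDGLie V X).gr k) :
    truncD V X y ∈ (truncDGLie V X).gr (k + 1) := by
  refine truncDGLie_induction (C := fun y => truncD V X y ∈ (truncDGLie V X).gr (k + 1))
    (fun a b e η hη => ?_) (by rw [map_zero]; exact Submodule.zero_mem _)
    (fun y z h h' => by rw [map_add]; exact Submodule.add_mem _ h h') hy
  have h : truncD V X ((filtX V X 2).mkQ η) =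
      (filtX V X 2).mkQ (dolX V X (-1) η) + (filtX V X 2).mkQ (dolX V X 1 η) := by
    rw [truncD, Submodule.mkQ_apply, Submodule.mapQ_apply, ← Submodule.mkQ_apply,
      LinearMap.add_apply, map_add]
  rw [h]
  refine Submodule.add_mem _ (mkQ_mem_truncDGLie (a := a + 1) (b := b) (by push_cast; omega) ?_)
    (mkQ_mem_truncDGLie (a := a) (b := b + 1) (by push_cast; omega) ?_)
  · exact fun x => dol_hol_mem isOpen_univ (Set.mem_univ x) fun y _ => hη y
  · exact fun x => dol_anti_mem isOpen_univ (Set.mem_univ x) fun y _ => hη y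

lemma truncD_truncD (y : TruncX V X) : truncD V X (truncD V X y) = 0 := by
  obtain ⟨η, rfl⟩ := Submodule.mkQ_surjective _ y
  have hd : ∀ s s', dolX V X s (dolX V X s' η) + dolX V X s' (dolX V X s η) = 0 := fun s s' =>
    Subtype.ext <| funext fun x => dol_dol s s' isOpen_univ η.2.2 (Set.mem_univ x)
  have hs : ∀ s, dolX V X s (dolX V X s η) = 0 := fun s => by
    have h := hd s s
    rw [← two_smul ℂ] at h
    exact (smul_eq_zero.1 h).resolve_left two_ne_zero
  rw [truncD, Submodule.mkQ_apply, Submodule.mapQ_apply, Submodule.mapQ_apply,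
    ← Submodule.mkQ_apply]
  simp only [LinearMap.add_apply, map_add, hs, zero_add, add_zero]
  rw [← map_add, hd, map_zero]

theorem isDGLie_truncDGLie : (truncDGLie V X).IsDGLie where
  indep := iSupIndep_of_eigenspaces (truncScale V X 2) 2 fun _ _ hy => truncScale_apply hy
  d_mem _ _ hy := truncD_mem hy
  d_d _ y _ := truncD_truncD y
  br_mem _ _ _ _ _ _ := Submodule.zero_mem _
  skew i j f _ g _ := by change (0 : TruncX V X) = -(sg (i * j) • 0); simp
  leibniz i j f _ g _ := by
    change truncD V X 0 = 0 + sg i • (0 : TruncX V X)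
    simp
  jacobi i j k f _ g _ h _ := by
    change (0 : TruncX V X) = 0 + sg (i * j) • 0
    simp

end Truncation

end HolCx

namespace HolCx

universe u v w

variable {V : Type u} [NormedAddCommGroup V] [NormedSpace ℂ V] [FiniteDimensional ℂ V]
  {X : Type v} [TopologicalSpace X] [ChartedSpace V X] [IsManifold 𝓘(ℂ, V) ω X] {p q : ℤ}

namespace HolComplex

variable {E : HolComplex.{u, v, w} V X p q}

/-! ### The Bianchi identity and the curvature formula -/

section Derivations

variable (E) in
/-- The differential `[∂̄ + δ, -]` on elements of degree `i`. -/
noncomputable def dolb (i : ℤ) : E.SheafEnd →ₗ[ℂ] E.SheafEnd := E.comm 1 i (E.delbar + E.δOp)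

lemma dolb_mem {a : ℕ} {i : ℤ} {f : E.SheafEnd} (hf : f ∈ E.HomDeg a i) :
    E.dolb i f ∈ E.HomDeg a (i + 1) := comm_dolbeault_mem_HomDeg hf

lemma comm_one_comm (T : E.SheafEnd) (i j : ℤ) (f g : E.SheafEnd) :
    E.comm 1 (i + j) T (E.comm i j f g) =
      E.comm (i + 1) j (E.comm 1 i T f) g + sg i • E.comm i (j + 1) f (E.comm 1 j T g) := by
  have := comm_jacobi 1 i j T f g
  rwa [one_mul, add_comm 1 i, add_comm 1 j] at this

lemma dolb_comm (i j : ℤ) (f g : E.SheafEnd) : E.dolb (i + j) (E.comm i j f g) =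
    E.comm (i + 1) j (E.dolb i f) g + sg i • E.comm i (j + 1) f (E.dolb j g) :=
  comm_one_comm _ i j f g

lemma Connection.nabla_comm (D : E.Connection) (i j : ℤ) (f g : E.SheafEnd) :
    D.nabla (i + j) (E.comm i j f g) =
      E.comm (i + 1) j (D.nabla i f) g + sg i • E.comm i (j + 1) f (D.nabla j g) :=
  comm_one_comm _ i j f g

lemma Connection.atiyah_eq_comm (D : E.Connection) :
    D.atiyah = E.comm 1 1 (D.D - E.delbar) (E.delbar + E.δOp) := by
  rw [D.atiyah_eq, map_add]

/-- The Jacobi identity for the two odd operators `D - ∂̄` and `∂̄ + δ`, whose commutator is the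
Atiyah cocycle. -/
lemma Connection.dolb_nabla (D : E.Connection) (i : ℤ) (f : E.SheafEnd) :
    E.dolb (i + 1) (D.nabla i f) = -D.nabla (i + 1) (E.dolb i f) + E.comm 2 i D.atiyah f := by
  have := comm_jacobi 1 1 i (D.D - E.delbar) (E.delbar + E.δOp) f
  rw [← D.atiyah_eq_comm, add_comm 1 i, mul_one, sg_one, neg_smul, one_smul,
    one_add_one_eq_two] at this
  rw [dolb, dolb, Connection.nabla, Connection.nabla, this]
  abel

/-- The Bianchi identity: `u` is itself a commutator with the square-zero operator `∂̄ + δ`. -/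
lemma Connection.dolb_atiyah (D : E.Connection) : E.dolb 2 D.atiyah = 0 := by
  have h := comm_comm_of_square_zero E.dolbeault_mul_self 1 (D.D - E.delbar)
  have h2 : D.atiyah = E.comm 1 1 (E.delbar + E.δOp) (D.D - E.delbar) := by
    rw [D.atiyah_eq_comm, comm_skew, mul_one, sg_one, neg_smul, one_smul, neg_neg]
  rw [h2]
  exact h

end Derivations

/-! ### The differential of each component -/

section Identities

variable {B : E.CyclicForm} {D : E.Connection} {i j k l : ℤ} {T S f g h m : E.SheafEnd}

lemma Connection.IsCompatible.truncD_zero_zero (hD : D.IsCompatible B) (hf : f ∈ E.HomDeg 0 i)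
    (hg : g ∈ E.HomDeg 0 j) : truncD V X (B.pairQ f g) =
      B.pairQ (D.nabla i f) g + B.pairQ (E.dolb i f) g +
        sg i • (B.pairQ f (D.nabla j g) + B.pairQ f (E.dolb j g)) :=
  hD.truncD_pairQ hf hg

/-- Applying `∇` to either argument produces a pairing of holomorphic form degree two, which is zero
in the quotient. -/
lemma Connection.IsCompatible.truncD_one_zero (hD : D.IsCompatible B) (hT : T ∈ E.HomDeg 1 i)
    (hg : g ∈ E.HomDeg 0 j) : truncD V X (B.pairQ T g) =
      B.pairQ (E.dolb i T) g + sg i • B.pairQ T (E.dolb j g) := by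
  rw [hD.truncD_pairQ hT hg, CyclicForm.pairQ_eq_zero (D.nabla_mem_HomDeg hT) hg (by norm_num),
    CyclicForm.pairQ_eq_zero hT (D.nabla_mem_HomDeg hg) (by norm_num), zero_add, zero_add]
  rfl

lemma Connection.IsCompatible.truncD_zero_one (hD : D.IsCompatible B) (hf : f ∈ E.HomDeg 0 i)
    (hS : S ∈ E.HomDeg 1 j) : truncD V X (B.pairQ f S) =
      B.pairQ (E.dolb i f) S + sg i • B.pairQ f (E.dolb j S) := by
  rw [hD.truncD_pairQ hf hS, CyclicForm.pairQ_eq_zero (D.nabla_mem_HomDeg hf) hS (by norm_num),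
    CyclicForm.pairQ_eq_zero hf (D.nabla_mem_HomDeg hS) (by norm_num), zero_add, zero_add]
  rfl

lemma Connection.IsCompatible.truncD_pairQ_atiyah (hD : D.IsCompatible B)
    (hf : f ∈ E.HomDeg 0 i) :
    truncD V X (B.pairQ D.atiyah f) = B.pairQ D.atiyah (E.dolb i f) := by
  rw [hD.truncD_one_zero D.atiyah_mem_HomDeg hf, D.dolb_atiyah]
  simp

variable (B D) in
/-- `(⟨∇f, g⟩ - (-1)^{deg f} ⟨f, ∇g⟩) / 2` for `f`, `g` of degree `i`, `j`. -/
noncomputable def pairNabla (i j : ℤ) (f g : E.SheafEnd) : TruncX V X :=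
  (2⁻¹ : ℂ) • (B.pairQ (D.nabla i f) g - sg i • B.pairQ f (D.nabla j g))

lemma pairNabla_skew (hf : f ∈ E.HomDeg 0 i) (hg : g ∈ E.HomDeg 0 j) :
    pairNabla B D j i g f = -(sg (i * j) • pairNabla B D i j f g) := by
  rw [pairNabla, pairNabla, CyclicForm.pairQ_symm (D.nabla_mem_HomDeg hg) hf,
    CyclicForm.pairQ_symm hg (D.nabla_mem_HomDeg hf)]
  simp only [sg_mul, sg_add, sg_one]
  rcases sg_eq i with hi | hi <;> rcases sg_eq j with hj | hj <;> rw [hi, hj] <;>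
    simp only [sgPair_one, sgPair_neg_one, mul_neg, mul_one, neg_neg] <;> module

/-- Differentiating a pairing with one `∇` leaves only `[∂̄ + δ, -]` on the arguments. Commuting it
past `∇` gives the terms with `∇[∂̄ + δ, -]` and two curvature terms; by cyclicity these agree, and
with the factor `1/2` they add up to one pairing with `u`. This is the relation for `n = 2`. -/
lemma Connection.IsCompatible.truncD_pairNabla (hD : D.IsCompatible B) (hf : f ∈ E.HomDeg 0 i)
    (hg : g ∈ E.HomDeg 0 j) : truncD V X (pairNabla B D i j f g) =
      -(pairNabla B D (i + 1) j (E.dolb i f) g -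
        sg (i * j) • pairNabla B D (j + 1) i (E.dolb j g) f) + B.pairQ D.atiyah (E.comm i j f g) := by
  have hu := D.atiyah_mem_HomDeg
  have h1 := CyclicForm.pairQ_cyclic (B := B) hu hf hg
  have h2 := CyclicForm.pairQ_cyclic (B := B) hf hu hg
  have h3 : E.comm i 2 f D.atiyah = -E.comm 2 i D.atiyah f := by
    rw [comm_skew, sg_even (even_two.mul_left i), one_smul]
  rw [pairNabla, LinearMap.map_smul, map_sub, map_zsmul,
    hD.truncD_one_zero (D.nabla_mem_HomDeg hf) hg, hD.truncD_zero_one hf (D.nabla_mem_HomDeg hg),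
    D.dolb_nabla, D.dolb_nabla]
  rw [pairNabla_skew hf (dolb_mem hg), pairNabla, pairNabla]
  simp only [map_add, map_neg, LinearMap.add_apply, LinearMap.neg_apply, h1, h2, h3]
  simp only [sg_mul, sg_add, sg_one]
  rcases sg_eq i with hi | hi <;> rcases sg_eq j with hj | hj <;> rw [hi, hj] <;>
    simp only [sgPair_one, sgPair_neg_one, mul_neg, mul_one, neg_neg] <;> module

lemma CyclicForm.pairQ_comm_skew (i j : ℤ) (T f g : E.SheafEnd) :
    B.pairQ T (E.comm i j f g) = -(sg (i * j) • B.pairQ T (E.comm j i g f)) := by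
  rw [comm_skew, map_neg, map_zsmul]

/-- The relation for `n = 3`. No `∇` is present in the pairing beforehand, so `d` yields both
`∇`-terms and `[∂̄ + δ, -]`-terms. Up to sign the `∇`-terms are `⟨∇f, [g, h]⟩`, `⟨f, [∇g, h]⟩`, `⟨f,
[g, ∇h]⟩`; each occurs in all three `pairNabla` of brackets, twice with the sign required and once
with the opposite one. -/
lemma Connection.IsCompatible.truncD_pairQ_comm (hD : D.IsCompatible B) (hf : f ∈ E.HomDeg 0 i)
    (hg : g ∈ E.HomDeg 0 j) (hh : h ∈ E.HomDeg 0 k) :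
    -((2⁻¹ : ℂ) • truncD V X (B.pairQ f (E.comm j k g h))) =
      -((2⁻¹ : ℂ) • (B.pairQ (E.dolb i f) (E.comm j k g h) -
        sg (i * j) • B.pairQ (E.dolb j g) (E.comm i k f h) +
        sg (i * k) • sg (j * k) • B.pairQ (E.dolb k h) (E.comm i j f g))) -
      (pairNabla B D (i + j) k (E.comm i j f g) h -
        sg (j * k) • pairNabla B D (i + k) j (E.comm i k f h) g +
        sg (i * j) • sg (i * k) • pairNabla B D (j + k) i (E.comm j k g h) f) := by
  have hgh := comm_mem_HomDeg hg hh j k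
  have hfg := comm_mem_HomDeg hf hg i j
  have hfh := comm_mem_HomDeg hf hh i k
  have nf := D.nabla_mem_HomDeg hf
  have ng := D.nabla_mem_HomDeg hg
  have nh := D.nabla_mem_HomDeg hh
  have df := dolb_mem hf
  have dg := dolb_mem hg
  have dh := dolb_mem hh
  rw [hD.truncD_zero_zero hf hgh]
  -- `e1` and `e2` rewrite the terms with a differentiated `g` or `h` so that `f` is the first
  -- entry, as in `d⟨f, [g, h]⟩`.
  have e1 : B.pairQ (E.dolb j g) (E.comm i k f h) =
      -(sg (i * (j + 1)) • B.pairQ f (E.comm (j + 1) k (E.dolb j g) h)) := by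
    rw [CyclicForm.pairQ_cyclic dg hf hh, CyclicForm.pairQ_cyclic hf dg hh, comm_skew, mul_comm,
      map_neg, map_zsmul]; rfl
  have e2 : B.pairQ (E.dolb k h) (E.comm i j f g) =
      sg ((k + 1) * (i + j)) • B.pairQ f (E.comm j (k + 1) g (E.dolb k h)) := by
    rw [CyclicForm.pairQ_symm dh hfg, CyclicForm.pairQ_cyclic hf hg dh]
  -- `c2` to `c9` bring all terms with `∇` on an argument to three normal forms, `⟨∇f, [g, h]⟩`,
  -- `⟨f, [∇g, h]⟩` and `⟨[f, g], ∇h⟩`; afterwards only signs remain.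
  have c2 : B.pairQ f (E.comm j (k + 1) g (D.nabla k h)) =
      B.pairQ (E.comm i j f g) (D.nabla k h) := CyclicForm.pairQ_cyclic hf hg nh
  have c3 : B.pairQ (E.comm (i + 1) j (D.nabla i f) g) h =
      B.pairQ (D.nabla i f) (E.comm j k g h) := (CyclicForm.pairQ_cyclic nf hg hh).symm
  have c4 : B.pairQ (E.comm i (j + 1) f (D.nabla j g)) h =
      B.pairQ f (E.comm (j + 1) k (D.nabla j g) h) := (CyclicForm.pairQ_cyclic hf ng hh).symm
  have c5 : B.pairQ (E.comm (i + 1) k (D.nabla i f) h) g =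
      -(sg (k * j) • B.pairQ (D.nabla i f) (E.comm j k g h)) := by
    rw [← CyclicForm.pairQ_cyclic nf hh hg, CyclicForm.pairQ_comm_skew]
  have c6 : B.pairQ (E.comm i (k + 1) f (D.nabla k h)) g =
      -(sg ((k + 1) * j) • B.pairQ (E.comm i j f g) (D.nabla k h)) := by
    rw [← CyclicForm.pairQ_cyclic hf nh hg, CyclicForm.pairQ_comm_skew, c2]
  have c7 : B.pairQ (E.comm i k f h) (D.nabla j g) =
      -(sg (k * (j + 1)) • B.pairQ f (E.comm (j + 1) k (D.nabla j g) h)) := by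
    rw [← CyclicForm.pairQ_cyclic hf hh ng, CyclicForm.pairQ_comm_skew]
  have c8 : B.pairQ (E.comm j k g h) (D.nabla i f) =
      sg ((j + k) * (i + 1)) • B.pairQ (D.nabla i f) (E.comm j k g h) :=
    CyclicForm.pairQ_symm hgh nf
  have c9 : B.pairQ (D.nabla (j + k) (E.comm j k g h)) f =
      sg ((j + k + 1) * i) • B.pairQ f (D.nabla (j + k) (E.comm j k g h)) :=
    CyclicForm.pairQ_symm (D.nabla_mem_HomDeg hgh) hf
  simp only [pairNabla, c9, c8, c7, e1, e2]
  simp only [D.nabla_comm, dolb_comm, map_add, map_zsmul, LinearMap.add_apply,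
    LinearMap.smul_apply, c2, c3, c4, c5, c6]
  simp only [sg_mul, sg_add, sg_one]
  rcases sg_eq i with hi | hi <;> rcases sg_eq j with hj | hj <;> rcases sg_eq k with hk | hk <;>
    rw [hi, hj, hk] <;>
    simp only [sgPair_one, sgPair_neg_one, mul_neg, mul_one, neg_neg] <;> module

/-- Cyclicity writes each pairing of brackets as `f` paired with a double bracket of `g`, `h`, `m`;
the relation is then the Jacobi identity for these three. -/
lemma CyclicForm.pairQ_comm_comm (hf : f ∈ E.HomDeg 0 i) (hg : g ∈ E.HomDeg 0 j)
    (hh : h ∈ E.HomDeg 0 k) (hm : m ∈ E.HomDeg 0 l) :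
    B.pairQ (E.comm i j f g) (E.comm k l h m) =
      sg (j * k) • B.pairQ (E.comm i k f h) (E.comm j l g m) -
        sg (j * l) • sg (k * l) • B.pairQ (E.comm i l f m) (E.comm j k g h) := by
  rw [← CyclicForm.pairQ_cyclic hf hg (comm_mem_HomDeg hh hm k l),
    ← CyclicForm.pairQ_cyclic hf hh (comm_mem_HomDeg hg hm j l),
    ← CyclicForm.pairQ_cyclic hf hm (comm_mem_HomDeg hg hh j k), comm_jacobi,
    comm_skew l (j + k) m, map_add, map_zsmul, map_neg, map_zsmul]
  simp only [sg_mul, sg_add]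
  rcases sg_eq j with hj | hj <;> rcases sg_eq k with hk | hk <;> rcases sg_eq l with hl | hl <;>
    rw [hj, hk, hl] <;>
    simp only [sgPair_one, sgPair_neg_one, mul_neg, mul_one, neg_neg] <;> module

end Identities

end HolComplex

end HolCx

namespace HolCx

/-! ### Koszul signs and shuffles for at most four arguments -/

section Combinatorics

/-- The contribution of the pair `(a, b)` of consecutive positions to the Koszul sign. -/
def inversionSign {n : ℕ} (k : Fin n → ℤ) (a b : Fin n) : ℤ := if b < a then -sg (k a * k b) else 1

/-- As a product over all pairs of positions, the Koszul sign depends on `σ` only through its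
values. In low arity it can then be evaluated along an explicit list of shuffles. -/
lemma koszul_eq {n : ℕ} (k : Fin n → ℤ) (σ : Equiv.Perm (Fin n)) :
    koszul k σ = ∏ i, ∏ j, if i < j then inversionSign k (σ i) (σ j) else 1 := by
  rw [koszul, Finset.prod_filter, Fintype.prod_prod_type]
  refine Finset.prod_congr rfl fun i _ => Finset.prod_congr rfl fun j _ => ?_
  by_cases h : i < j <;> simp [h, inversionSign]

lemma koszul_one (k : Fin 1 → ℤ) (σ : Equiv.Perm (Fin 1)) : koszul k σ = 1 := by
  simp [koszul_eq]

lemma koszul_two (k : Fin 2 → ℤ) (σ : Equiv.Perm (Fin 2)) :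
    koszul k σ = inversionSign k (σ 0) (σ 1) := by
  simp [koszul_eq, Fin.prod_univ_two]

lemma koszul_three (k : Fin 3 → ℤ) (σ : Equiv.Perm (Fin 3)) : koszul k σ =
    inversionSign k (σ 0) (σ 1) * inversionSign k (σ 0) (σ 2) * inversionSign k (σ 1) (σ 2) := by
  simp [koszul_eq, Fin.prod_univ_three]

lemma koszul_four (k : Fin 4 → ℤ) (σ : Equiv.Perm (Fin 4)) : koszul k σ =
    inversionSign k (σ 0) (σ 1) * inversionSign k (σ 0) (σ 2) * inversionSign k (σ 0) (σ 3) *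
      (inversionSign k (σ 1) (σ 2) * inversionSign k (σ 1) (σ 3)) *
        inversionSign k (σ 2) (σ 3) := by
  simp [koszul_eq, Fin.prod_univ_four]

lemma perm_two_cases (σ : Equiv.Perm (Fin 2)) : (σ 0 = 0 ∧ σ 1 = 1) ∨ (σ 0 = 1 ∧ σ 1 = 0) := by
  revert σ; decide

lemma perm_three_cases (σ : Equiv.Perm (Fin 3)) :
    (σ 0 = 0 ∧ σ 1 = 1 ∧ σ 2 = 2) ∨ (σ 0 = 0 ∧ σ 1 = 2 ∧ σ 2 = 1) ∨
    (σ 0 = 1 ∧ σ 1 = 0 ∧ σ 2 = 2) ∨ (σ 0 = 1 ∧ σ 1 = 2 ∧ σ 2 = 0) ∨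
    (σ 0 = 2 ∧ σ 1 = 0 ∧ σ 2 = 1) ∨ (σ 0 = 2 ∧ σ 1 = 1 ∧ σ 2 = 0) := by
  revert σ; decide

variable {M : Type*} [AddCommGroup M]

/-- In this and the following sums the summand depends on `σ` only through its values, so the
shuffles can be enumerated by decision once and for all. -/
lemma sum_shuffles_two_one (F : Fin 2 → Fin 2 → M) :
    ∑ σ ∈ shuffles 2 1, F (σ 0) (σ 1) = F 0 1 + F 1 0 := by
  have h : shuffles 2 1 = {1, Equiv.swap 0 1} := by decide
  rw [h, Finset.sum_insert (by decide), Finset.sum_singleton]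
  rfl

lemma sum_shuffles_two_two (F : Fin 2 → Fin 2 → M) :
    ∑ σ ∈ shuffles 2 2, F (σ 0) (σ 1) = F 0 1 := by
  have h : shuffles 2 2 = {1} := by decide
  rw [h, Finset.sum_singleton]
  rfl

lemma sum_shuffles_three_one (F : Fin 3 → Fin 3 → Fin 3 → M) :
    ∑ σ ∈ shuffles 3 1, F (σ 0) (σ 1) (σ 2) = F 0 1 2 + (F 1 0 2 + F 2 0 1) := by
  have h : shuffles 3 1 = {1, Equiv.swap 0 1, (finRotate 3).symm} := by decide
  rw [h, Finset.sum_insert (by decide), Finset.sum_insert (by decide), Finset.sum_singleton]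
  rfl

lemma sum_shuffles_three_two (F : Fin 3 → Fin 3 → Fin 3 → M) :
    ∑ σ ∈ shuffles 3 2, F (σ 0) (σ 1) (σ 2) = F 0 1 2 + (F 0 2 1 + F 1 2 0) := by
  have h : shuffles 3 2 = {1, Equiv.swap 1 2, finRotate 3} := by decide
  rw [h, Finset.sum_insert (by decide), Finset.sum_insert (by decide), Finset.sum_singleton]
  rfl

lemma sum_shuffles_four_two (F : Fin 4 → Fin 4 → Fin 4 → Fin 4 → M) :
    ∑ σ ∈ shuffles 4 2, F (σ 0) (σ 1) (σ 2) (σ 3) = F 0 1 2 3 + (F 0 2 1 3 + (F 0 3 1 2 +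
      (F 1 2 0 3 + (F 1 3 0 2 + F 2 3 0 1)))) := by
  have h : shuffles 4 2 = {1, Equiv.swap 1 2, Equiv.swap 1 2 * Equiv.swap 1 3,
      Equiv.swap 0 1 * Equiv.swap 1 2, Equiv.swap 0 1 * Equiv.swap 1 2 * Equiv.swap 1 3,
      Equiv.swap 0 2 * Equiv.swap 1 3} := by decide
  rw [h, Finset.sum_insert (by decide), Finset.sum_insert (by decide),
    Finset.sum_insert (by decide), Finset.sum_insert (by decide), Finset.sum_insert (by decide),
    Finset.sum_singleton]
  rfl

end Combinatorics

/-! ### Multilinear maps in one, two and three arguments -/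

section Multilinear

variable {W Y : Type*} [AddCommGroup W] [Module ℂ W] [AddCommGroup Y] [Module ℂ Y]

/-- A linear map as a multilinear map of one argument. -/
def multilinearOne (F : W →ₗ[ℂ] Y) : MultilinearMap ℂ (fun _ : Fin 1 => W) Y where
  toFun m := F (m 0)
  map_update_add' m i x y := by fin_cases i; simp
  map_update_smul' m i r x := by fin_cases i; simp

/-- A bilinear map as a multilinear map of two arguments. -/
def multilinearTwo (F : W →ₗ[ℂ] W →ₗ[ℂ] Y) : MultilinearMap ℂ (fun _ : Fin 2 => W) Y where
  toFun m := F (m 0) (m 1)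
  map_update_add' m i x y := by fin_cases i <;> simp
  map_update_smul' m i r x := by fin_cases i <;> simp

/-- A trilinear map as a multilinear map of three arguments. -/
def multilinearThree (F : W →ₗ[ℂ] W →ₗ[ℂ] W →ₗ[ℂ] Y) :
    MultilinearMap ℂ (fun _ : Fin 3 => W) Y :=
  MultilinearMap.mk' (fun m => F (m 0) (m 1) (m 2))
    (fun m i x y => by fin_cases i <;> simp) (fun m i r x => by fin_cases i <;> simp)

end Multilinear

universe u v w

variable {V : Type u} [NormedAddCommGroup V] [NormedSpace ℂ V] [FiniteDimensional ℂ V]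
  {X : Type v} [TopologicalSpace X] [ChartedSpace V X] [IsManifold 𝓘(ℂ, V) ω X] {p q : ℤ}

namespace HolComplex

variable {E : HolComplex.{u, v, w} V X p q}

/-! ### The components as multilinear maps on all endomorphisms -/

section Linear

variable (E) in
-- Makes degree-dependent signs linear in the argument, which the multilinearity of the components
-- requires.
lemma exists_homSign :
    ∃ α : E.SheafEnd →ₗ[ℂ] E.SheafEnd, ∀ k, ∀ f ∈ E.HomDeg 0 k, α f = sg k • f := by
  obtain ⟨α, hα⟩ := exists_sign_of_iSupIndep (iSupIndep_A0HomDeg (E := E))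
  exact ⟨α, fun k f hf => hα k f (by rwa [A0HomDeg_eq])⟩

variable (E) in
/-- A linear map that is `(-1)^k` on `A^{0,*}(Hom^*(E^*, E^*))` in degree `k`. -/
noncomputable def homSign : E.SheafEnd →ₗ[ℂ] E.SheafEnd := Classical.choose E.exists_homSign

lemma homSign_apply {k : ℤ} {f : E.SheafEnd} (hf : f ∈ E.HomDeg 0 k) : E.homSign f = sg k • f :=
  Classical.choose_spec E.exists_homSign k f hf

variable (E) in
/-- The graded commutator as a bilinear map. -/
noncomputable def superComm : E.SheafEnd →ₗ[ℂ] E.SheafEnd →ₗ[ℂ] E.SheafEnd :=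
  LinearMap.mul ℂ E.SheafEnd - (2⁻¹ : ℂ) • ((LinearMap.mul ℂ E.SheafEnd).flip +
    (LinearMap.mul ℂ E.SheafEnd).flip ∘ₗ E.homSign +
    (LinearMap.mul ℂ E.SheafEnd).flip.compl₂ E.homSign -
    (LinearMap.mul ℂ E.SheafEnd).flip.compl₁₂ E.homSign E.homSign)

/-- The bilinear definition rests on the identity `(-1)^{ij} = (1 + (-1)^i + (-1)^j - (-1)^i (-1)^j)
/ 2`, which replaces the sign of a product by separate signs. -/
lemma superComm_apply {i j : ℤ} {f g : E.SheafEnd} (hf : f ∈ E.HomDeg 0 i)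
    (hg : g ∈ E.HomDeg 0 j) : E.superComm f g = E.comm i j f g := by
  have h : E.superComm f g = f * g - (2⁻¹ : ℂ) • (g * f + g * E.homSign f + E.homSign g * f -
    E.homSign g * E.homSign f) := rfl
  rw [h, homSign_apply hf, homSign_apply hg, comm_apply, sg_mul]
  rcases sg_eq i with hi | hi <;> rcases sg_eq j with hj | hj <;> rw [hi, hj] <;>
    simp only [sgPair_one, sgPair_neg_one, one_smul, neg_smul, mul_neg, neg_mul] <;> module

/-- The operator `∇ = [D - ∂̄, -]` as a linear map. -/
noncomputable def Connection.nablaMap (D : E.Connection) : E.SheafEnd →ₗ[ℂ] E.SheafEnd :=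
  LinearMap.mulLeft ℂ (D.D - E.delbar) - LinearMap.mulRight ℂ (D.D - E.delbar) ∘ₗ E.homSign

lemma Connection.nablaMap_apply (D : E.Connection) {i : ℤ} {f : E.SheafEnd}
    (hf : f ∈ E.HomDeg 0 i) : D.nablaMap f = D.nabla i f := by
  have h : D.nablaMap f = (D.D - E.delbar) * f - E.homSign f * (D.D - E.delbar) := rfl
  rw [h, homSign_apply hf, Connection.nabla, comm_apply, one_mul, smul_mul_assoc]

variable (B : E.CyclicForm) (D : E.Connection)

/-- The bilinear map `(⟨∇f, g⟩ - (-1)^{deg f} ⟨f, ∇g⟩) / 2`. -/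
noncomputable def pairNablaMap : E.SheafEnd →ₗ[ℂ] E.SheafEnd →ₗ[ℂ] TruncX V X :=
  (2⁻¹ : ℂ) • (B.pairQ ∘ₗ D.nablaMap - (B.pairQ ∘ₗ E.homSign).compl₂ D.nablaMap)

lemma pairNablaMap_apply {i j : ℤ} {f g : E.SheafEnd} (hf : f ∈ E.HomDeg 0 i)
    (hg : g ∈ E.HomDeg 0 j) : pairNablaMap B D f g = pairNabla B D i j f g := by
  have h : pairNablaMap B D f g =
    (2⁻¹ : ℂ) • (B.pairQ (D.nablaMap f) g - B.pairQ (E.homSign f) (D.nablaMap g)) := rfl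
  rw [h, D.nablaMap_apply hf, D.nablaMap_apply hg, homSign_apply hf, map_zsmul,
    LinearMap.smul_apply, pairNabla]

/-- The trilinear map `-⟨f, [g, h]⟩ / 2`. -/
noncomputable def pairCommMap :
    E.SheafEnd →ₗ[ℂ] E.SheafEnd →ₗ[ℂ] E.SheafEnd →ₗ[ℂ] TruncX V X where
  toFun f := E.superComm.compr₂ (((-2⁻¹ : ℂ) • B.pairQ) f)
  map_add' f f' := LinearMap.ext₂ fun g h =>
    LinearMap.map_add₂ ((-2⁻¹ : ℂ) • B.pairQ) f f' (E.superComm g h)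
  map_smul' r f := LinearMap.ext₂ fun g h =>
    LinearMap.map_smul₂ ((-2⁻¹ : ℂ) • B.pairQ) r f (E.superComm g h)

lemma pairCommMap_apply {j k : ℤ} (f : E.SheafEnd) {g h : E.SheafEnd}
    (hg : g ∈ E.HomDeg 0 j) (hh : h ∈ E.HomDeg 0 k) :
    pairCommMap B f g h = -((2⁻¹ : ℂ) • B.pairQ f (E.comm j k g h)) := by
  have e : pairCommMap B f g h = (-2⁻¹ : ℂ) • B.pairQ f (E.superComm g h) := rfl
  rw [e, superComm_apply hg hh, neg_smul]

/-- The components of the `L_∞` morphism attached to a cyclic form and a connection. -/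
noncomputable def cyclicMap :
    ∀ n : ℕ, MultilinearMap ℂ (fun _ : Fin n => E.SheafEnd) (TruncX V X)
  | 0 => 0
  | 1 => multilinearOne (B.pairQ D.atiyah)
  | 2 => multilinearTwo (pairNablaMap B D)
  | 3 => multilinearThree (pairCommMap B)
  | _ + 4 => 0

lemma cyclicMap_one (f : Fin 1 → E.SheafEnd) :
    cyclicMap B D 1 f = B.pairQ D.atiyah (f 0) := rfl

lemma cyclicMap_two (f : Fin 2 → E.SheafEnd) :
    cyclicMap B D 2 f = pairNablaMap B D (f 0) (f 1) := rfl

lemma cyclicMap_three (f : Fin 3 → E.SheafEnd) :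
    cyclicMap B D 3 f = pairCommMap B (f 0) (f 1) (f 2) := rfl

lemma cyclicMap_of_three_lt {n : ℕ} (h : 3 < n) : cyclicMap B D n = 0 := by
  obtain ⟨m, rfl⟩ := Nat.exists_eq_add_of_le' h
  rfl

end Linear

end HolComplex

end HolCx

/-! ### Symmetry, degrees and the `L_∞` relations -/

namespace HolCx

universe u v w

variable {V : Type u} [NormedAddCommGroup V] [NormedSpace ℂ V] [FiniteDimensional ℂ V]
  {X : Type v} [TopologicalSpace X] [ChartedSpace V X] [IsManifold 𝓘(ℂ, V) ω X] {p q : ℤ}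

namespace HolComplex

variable {E : HolComplex.{u, v, w} V X p q} {B : E.CyclicForm} {D : E.Connection}

/-- Cyclicity moves the bracket onto the first two arguments, where skew symmetry of the commutator
applies. Together with the exchange of the last two arguments this generates all permutations. -/
lemma pairCommMap_swap_left {i j k : ℤ} {f g h : E.SheafEnd} (hf : f ∈ E.HomDeg 0 i)
    (hg : g ∈ E.HomDeg 0 j) (hh : h ∈ E.HomDeg 0 k) :
    pairCommMap B g f h = -(sg (i * j) • pairCommMap B f g h) := by
  rw [pairCommMap_apply B g hf hh, pairCommMap_apply B f hg hh, CyclicForm.pairQ_cyclic hg hf hh,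
    CyclicForm.pairQ_cyclic hf hg hh, comm_skew j i, map_neg, map_zsmul, LinearMap.neg_apply,
    LinearMap.smul_apply, mul_comm j i]
  module

lemma pairCommMap_swap_right {j k : ℤ} (f : E.SheafEnd) {g h : E.SheafEnd}
    (hg : g ∈ E.HomDeg 0 j) (hh : h ∈ E.HomDeg 0 k) :
    pairCommMap B f h g = -(sg (j * k) • pairCommMap B f g h) := by
  rw [pairCommMap_apply B f hh hg, pairCommMap_apply B f hg hh, CyclicForm.pairQ_comm_skew,
    mul_comm k j]
  module

lemma pairNablaMap_skew {i j : ℤ} {f g : E.SheafEnd} (hf : f ∈ E.HomDeg 0 i)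
    (hg : g ∈ E.HomDeg 0 j) :
    pairNablaMap B D g f = -(sg (i * j) • pairNablaMap B D f g) := by
  rw [pairNablaMap_apply B D hg hf, pairNablaMap_apply B D hf hg, pairNabla_skew hf hg]

/-- In arity three each of the six permutations is a product of adjacent exchanges, whose signs are
the inversion factors of the Koszul sign. -/
lemma cyclicMap_skew {n : ℕ} {k : Fin n → ℤ} {f : Fin n → E.SheafEnd}
    (hf : ∀ i, f i ∈ E.HomDeg 0 (k i)) (σ : Equiv.Perm (Fin n)) :
    cyclicMap B D n (fun i => f (σ i)) = koszul k σ • cyclicMap B D n f := by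
  match n with
  | 0 => simp [cyclicMap]
  | 1 =>
    rw [koszul_one, one_smul]
    congr 1; funext i; congr 1; exact Subsingleton.elim _ _
  | 2 =>
    rw [cyclicMap_two, cyclicMap_two, koszul_two]
    rcases perm_two_cases σ with ⟨h0, h1⟩ | ⟨h0, h1⟩ <;> rw [h0, h1]
    · simp [inversionSign]
    · rw [pairNablaMap_skew (hf 0) (hf 1)]
      simp [inversionSign, mul_comm]
  | 3 =>
    have s1 := fun a b c => pairCommMap_swap_left (B := B) (hf a) (hf b) (hf c)
    have s2 := fun a b c => pairCommMap_swap_right (B := B) (f a) (hf b) (hf c)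
    have i1 : inversionSign k 0 1 = 1 := by simp [inversionSign]
    have i2 : inversionSign k 0 2 = 1 := by simp [inversionSign]
    have i3 : inversionSign k 1 2 = 1 := by simp [inversionSign]
    have i4 : inversionSign k 1 0 = -sg (k 0 * k 1) := by simp [inversionSign, mul_comm]
    have i5 : inversionSign k 2 0 = -sg (k 0 * k 2) := by simp [inversionSign, mul_comm]
    have i6 : inversionSign k 2 1 = -sg (k 1 * k 2) := by simp [inversionSign, mul_comm]
    rw [cyclicMap_three, cyclicMap_three, koszul_three]
    rcases perm_three_cases σ with ⟨h0, h1, h2⟩ | ⟨h0, h1, h2⟩ | ⟨h0, h1, h2⟩ | ⟨h0, h1, h2⟩ |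
      ⟨h0, h1, h2⟩ | ⟨h0, h1, h2⟩ <;> rw [h0, h1, h2]
    · rw [i1, i2, i3]; module
    · rw [s2 0 1 2, i1, i2, i6]; module
    · rw [s1 0 1 2, i2, i3, i4]; module
    · rw [s2 1 0 2, s1 0 1 2, i3, i4, i5]; module
    · rw [s1 0 2 1, s2 0 1 2, i1, i5, i6]; module
    · rw [s1 1 2 0, s2 1 0 2, s1 0 1 2, i4, i5, i6]; module
  | n + 4 => simp [cyclicMap]

/-- The target is shifted by two: `u` has degree two, `∇` degree one and the commutator degree zero,
which gives the degrees `0`, `-1` and `-2` of the three components. -/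
lemma cyclicMap_mem {n : ℕ} {k : Fin n → ℤ} {f : Fin n → E.SheafEnd}
    (hf : ∀ i, f i ∈ E.HomDeg 0 (k i)) :
    cyclicMap B D n f ∈ (truncDGLie V X).gr (∑ i, k i + 1 - n) := by
  match n with
  | 0 => exact Submodule.zero_mem _
  | 1 =>
    refine CyclicForm.pairQ_mem_gr D.atiyah_mem_HomDeg (hf 0) ?_
    simp; ring
  | 2 =>
    rw [cyclicMap_two, pairNablaMap_apply B D (hf 0) (hf 1), pairNabla]
    refine Submodule.smul_mem _ _ (Submodule.sub_mem _ ?_ (zsmul_mem ?_ _))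
    · refine CyclicForm.pairQ_mem_gr (D.nabla_mem_HomDeg (hf 0)) (hf 1) ?_
      simp [Fin.sum_univ_two]; ring
    · refine CyclicForm.pairQ_mem_gr (hf 0) (D.nabla_mem_HomDeg (hf 1)) ?_
      simp [Fin.sum_univ_two]; ring
  | 3 =>
    rw [cyclicMap_three, pairCommMap_apply B _ (hf 1) (hf 2)]
    refine Submodule.neg_mem _ (Submodule.smul_mem _ _ ?_)
    refine CyclicForm.pairQ_mem_gr (hf 0) (comm_mem_HomDeg (hf 1) (hf 2) _ _) ?_
    simp [Fin.sum_univ_three]; ring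
  | n + 4 => exact Submodule.zero_mem _

lemma Connection.IsCompatible.cyclicMap_rel_two (hD : D.IsCompatible B) {k : Fin 2 → ℤ}
    {f : Fin 2 → E.SheafEnd} (hf : ∀ i, f i ∈ E.HomDeg 0 (k i)) :
    truncD V X (cyclicMap B D 2 f) =
      sg 1 • ∑ σ ∈ shuffles 2 1, koszul k σ •
        cyclicMap B D 2 (Fin.cons (E.dolb (k (σ 0)) (f (σ 0))) fun i : Fin 1 => f (σ i.succ)) +
      sg 0 • ∑ σ ∈ shuffles 2 2, koszul k σ •
        cyclicMap B D 1 (Fin.cons (E.comm (k (σ 0)) (k (σ 1)) (f (σ 0)) (f (σ 1)))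
          fun i : Fin 0 => f (σ i.succ.succ)) := by
  have e1 := sum_shuffles_two_one fun a b => inversionSign k a b •
    pairNablaMap B D (E.dolb (k a) (f a)) (f b)
  have e2 := sum_shuffles_two_two fun a b => inversionSign k a b •
    B.pairQ D.atiyah (E.comm (k a) (k b) (f a) (f b))
  simp only [koszul_two, cyclicMap_two, cyclicMap_one]
  refine Eq.trans ?_ (congrArg₂ (fun x y => sg 1 • x + sg 0 • y) e1 e2).symm
  have i1 : inversionSign k 0 1 = 1 := by simp [inversionSign]
  have i2 : inversionSign k 1 0 = -sg (k 0 * k 1) := by simp [inversionSign, mul_comm]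
  rw [pairNablaMap_apply B D (hf 0) (hf 1), pairNablaMap_apply B D (dolb_mem (hf 0)) (hf 1),
    pairNablaMap_apply B D (dolb_mem (hf 1)) (hf 0), hD.truncD_pairNabla (hf 0) (hf 1),
    i1, i2, sg_zero, sg_one]
  module

lemma Connection.IsCompatible.cyclicMap_rel_three (hD : D.IsCompatible B) {k : Fin 3 → ℤ}
    {f : Fin 3 → E.SheafEnd} (hf : ∀ i, f i ∈ E.HomDeg 0 (k i)) :
    truncD V X (cyclicMap B D 3 f) =
      sg 2 • ∑ σ ∈ shuffles 3 1, koszul k σ •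
        cyclicMap B D 3 (Fin.cons (E.dolb (k (σ 0)) (f (σ 0))) fun i : Fin 2 => f (σ i.succ)) +
      sg 1 • ∑ σ ∈ shuffles 3 2, koszul k σ •
        cyclicMap B D 2 (Fin.cons (E.comm (k (σ 0)) (k (σ 1)) (f (σ 0)) (f (σ 1)))
          fun i : Fin 1 => f (σ i.succ.succ)) := by
  have e1 := sum_shuffles_three_one fun a b c =>
    (inversionSign k a b * inversionSign k a c * inversionSign k b c) •
      pairCommMap B (E.dolb (k a) (f a)) (f b) (f c)
  have e2 := sum_shuffles_three_two fun a b c =>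
    (inversionSign k a b * inversionSign k a c * inversionSign k b c) •
      pairNablaMap B D (E.comm (k a) (k b) (f a) (f b)) (f c)
  simp only [koszul_three, cyclicMap_three, cyclicMap_two]
  refine Eq.trans ?_ (congrArg₂ (fun x y => sg 2 • x + sg 1 • y) e1 e2).symm
  have hc := fun a b => comm_mem_HomDeg (hf a) (hf b) (k a) (k b)
  have i1 : inversionSign k 0 1 = 1 := by simp [inversionSign]
  have i2 : inversionSign k 0 2 = 1 := by simp [inversionSign]
  have i3 : inversionSign k 1 2 = 1 := by simp [inversionSign]
  have i4 : inversionSign k 1 0 = -sg (k 0 * k 1) := by simp [inversionSign, mul_comm]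
  have i5 : inversionSign k 2 0 = -sg (k 0 * k 2) := by simp [inversionSign, mul_comm]
  have i6 : inversionSign k 2 1 = -sg (k 1 * k 2) := by simp [inversionSign, mul_comm]
  rw [pairCommMap_apply B _ (hf 1) (hf 2), pairCommMap_apply B _ (hf 1) (hf 2),
    pairCommMap_apply B _ (hf 0) (hf 2), pairCommMap_apply B _ (hf 0) (hf 1),
    pairNablaMap_apply B D (hc 0 1) (hf 2), pairNablaMap_apply B D (hc 0 2) (hf 1),
    pairNablaMap_apply B D (hc 1 2) (hf 0), map_neg, LinearMap.map_smul,
    hD.truncD_pairQ_comm (hf 0) (hf 1) (hf 2), i1, i2, i3, i4, i5, i6, sg_two, sg_one]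
  module

set_option maxHeartbeats 800000 in
-- Of the six shuffles, complementary ones give equal contributions by symmetry of the form. The
-- three remaining pairings of brackets cancel by the Jacobi identity `CyclicForm.pairQ_comm_comm`.
lemma cyclicMap_rel_four {k : Fin 4 → ℤ} {f : Fin 4 → E.SheafEnd}
    (hf : ∀ i, f i ∈ E.HomDeg 0 (k i)) :
    ∑ σ ∈ shuffles 4 2, koszul k σ •
      cyclicMap B D 3 (Fin.cons (E.comm (k (σ 0)) (k (σ 1)) (f (σ 0)) (f (σ 1)))
        fun i : Fin 2 => f (σ i.succ.succ)) = 0 := by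
  have e1 := sum_shuffles_four_two fun a b c d =>
    (inversionSign k a b * inversionSign k a c * inversionSign k a d *
      (inversionSign k b c * inversionSign k b d) * inversionSign k c d) •
      pairCommMap B (E.comm (k a) (k b) (f a) (f b)) (f c) (f d)
  simp only [koszul_four, cyclicMap_three]
  refine e1.trans ?_
  have hc := fun a b => comm_mem_HomDeg (hf a) (hf b) (k a) (k b)
  have i1 : inversionSign k 0 1 = 1 := by simp [inversionSign]
  have i2 : inversionSign k 0 2 = 1 := by simp [inversionSign]
  have i3 : inversionSign k 0 3 = 1 := by simp [inversionSign]
  have i4 : inversionSign k 1 2 = 1 := by simp [inversionSign]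
  have i5 : inversionSign k 1 3 = 1 := by simp [inversionSign]
  have i6 : inversionSign k 2 3 = 1 := by simp [inversionSign]
  have j1 : inversionSign k 1 0 = -sg (k 0 * k 1) := by simp [inversionSign, mul_comm]
  have j2 : inversionSign k 2 0 = -sg (k 0 * k 2) := by simp [inversionSign, mul_comm]
  have j3 : inversionSign k 3 0 = -sg (k 0 * k 3) := by simp [inversionSign, mul_comm]
  have j4 : inversionSign k 2 1 = -sg (k 1 * k 2) := by simp [inversionSign, mul_comm]
  have j5 : inversionSign k 3 1 = -sg (k 1 * k 3) := by simp [inversionSign, mul_comm]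
  have j6 : inversionSign k 3 2 = -sg (k 2 * k 3) := by simp [inversionSign, mul_comm]
  have r := CyclicForm.pairQ_comm_comm (B := B) (hf 0) (hf 1) (hf 2) (hf 3)
  rw [pairCommMap_apply B _ (hf 2) (hf 3), pairCommMap_apply B _ (hf 1) (hf 3),
    pairCommMap_apply B _ (hf 1) (hf 2), pairCommMap_apply B _ (hf 0) (hf 3),
    pairCommMap_apply B _ (hf 0) (hf 2), pairCommMap_apply B _ (hf 0) (hf 1),
    CyclicForm.pairQ_symm (hc 1 2) (hc 0 3), CyclicForm.pairQ_symm (hc 1 3) (hc 0 2),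
    CyclicForm.pairQ_symm (hc 2 3) (hc 0 1), r, i1, i2, i3, i4, i5, i6, j1, j2, j3, j4, j5, j6]
  generalize B.pairQ (E.comm (k 0) (k 2) (f 0) (f 2)) (E.comm (k 1) (k 3) (f 1) (f 3)) = y
  generalize B.pairQ (E.comm (k 0) (k 3) (f 0) (f 3)) (E.comm (k 1) (k 2) (f 1) (f 2)) = z
  simp only [sg_mul, sg_add]
  rcases sg_eq (k 0) with h0 | h0 <;> rcases sg_eq (k 1) with h1 | h1 <;>
    rcases sg_eq (k 2) with h2 | h2 <;> rcases sg_eq (k 3) with h3 | h3 <;>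
    rw [h0, h1, h2, h3] <;>
    simp only [sgPair_one, sgPair_neg_one, mul_neg, mul_one, neg_neg] <;> module

/-- The `L_∞` morphism attached to a cyclic form compatible with a connection. -/
noncomputable def Connection.IsCompatible.cyclicMorphism (hD : D.IsCompatible B) :
    LInftyMorphism E.dolbeaultDGLie (truncDGLie V X) where
  g := cyclicMap B D
  skew n k f _ hf σ := cyclicMap_skew (fun i => by rw [← A0HomDeg_eq]; exact hf i) σ
  degree n k f _ hf := cyclicMap_mem fun i => by rw [← A0HomDeg_eq]; exact hf i
  chain k f hf := by
    replace hf : f ∈ E.A0HomDeg k := hf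
    rw [A0HomDeg_eq] at hf
    exact (hD.truncD_pairQ_atiyah hf).symm
  rel m k f hf := by
    replace hf : ∀ i, f i ∈ E.HomDeg 0 (k i) := fun i => by rw [← A0HomDeg_eq]; exact hf i
    -- The bracket of the target is zero, so the whole quadratic part of the relation disappears.
    have hbr : ∀ i j, (truncDGLie V X).br i j = 0 := fun _ _ => rfl
    simp only [hbr, LinearMap.zero_apply, smul_zero, Finset.sum_const_zero, zero_add]
    match m with
    | 0 => exact hD.cyclicMap_rel_two hf
    | 1 => exact hD.cyclicMap_rel_three hf
    | 2 =>
      -- For four arguments `g_4 = 0`, so both differential terms vanish and only `g_3` of brackets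
      -- is left.
      have h := cyclicMap_rel_four (B := B) (D := D) hf
      have h4 : cyclicMap B D (2 + 2) = 0 := cyclicMap_of_three_lt B D (by norm_num)
      rw [h4]
      simp only [zero_apply, smul_zero, Finset.sum_const_zero, map_zero, zero_add]
      exact (smul_eq_zero_of_right _ h).symm
    | m + 3 =>
      -- For five or more arguments both components in the relation are zero.
      have h5 : cyclicMap B D (m + 3 + 2) = 0 := cyclicMap_of_three_lt B D (by omega)
      have h4 : cyclicMap B D (m + 3 + 1) = 0 := cyclicMap_of_three_lt B D (by omega)
      rw [h5, h4]
      simp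

lemma pairX_mem_typX {a a' r : ℕ} {i j : ℤ} {T S : E.SheafEnd} (hT : T ∈ E.HomDeg a i)
    (hS : S ∈ E.HomDeg a' j) (h : a + a' = r) :
    B.pairX ⟨T, HomDeg_le_HomTot a i hT⟩ ⟨S, HomDeg_le_HomTot a' j hS⟩ ∈ ⨆ b, typX V X r b := by
  subst h
  have h : (⨆ (c : ℕ) (_ : ((a + a' : ℕ) : ℤ) + c = i + j), typX V X (a + a') c) ≤
      ⨆ b, typX V X (a + a') b := iSup_mono fun b => iSup_le fun _ => le_rfl
  exact h (CyclicForm.pairX_mem hT hS)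

end HolComplex

end HolCx

/-! ### The theorem -/

open HolComplex

theorem theorem3p5 {V : Type*} [NormedAddCommGroup V] [NormedSpace ℂ V] [FiniteDimensional ℂ V]
    {X : Type*} [TopologicalSpace X] [ChartedSpace V X] [IsManifold 𝓘(ℂ, V) ω X] {p q : ℤ}
    (E : HolComplex V X p q) (B : E.CyclicForm) (D : E.Connection) (hD : D.IsCompatible B) :
    E.dolbeaultDGLie.IsDGLie ∧ (truncDGLie V X).IsDGLie ∧
    D.atiyah ∈ E.AHom 1 1 0 ⊔ E.AHom 1 0 1 ∧
    (∀ b n, ∀ f ∈ E.AHom 0 b n, D.nabla (b + n) f ∈ E.AHom 1 b n) ∧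
    ∃ g : LInftyMorphism E.dolbeaultDGLie (truncDGLie V X),
      (∀ i, ∀ f ∈ E.A0HomDeg i, ∃ η ∈ ⨆ b, typX V X 1 b,
        (∀ x, η.1 x = B.pair D.atiyah f x) ∧ (∀ x, η.1 x = B.pair f D.atiyah x) ∧
        g.g 1 ![f] = (filtX V X 2).mkQ η) ∧
      (∀ i j, ∀ f ∈ E.A0HomDeg i, ∀ h ∈ E.A0HomDeg j, ∃ η ∈ ⨆ b, typX V X 1 b,
        (∀ x, η.1 x = (2⁻¹ : ℂ) •
          (B.pair (D.nabla i f) h x - sg (i * j) • B.pair (D.nabla j h) f x)) ∧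
        g.g 2 ![f, h] = (filtX V X 2).mkQ η) ∧
      (∀ i j k, ∀ f ∈ E.A0HomDeg i, ∀ h ∈ E.A0HomDeg j, ∀ l ∈ E.A0HomDeg k,
        ∃ η ∈ ⨆ b, typX V X 0 b,
        (∀ x, η.1 x = -((2⁻¹ : ℂ) • B.pair f (E.comm j k h l) x)) ∧
        g.g 3 ![f, h, l] = (filtX V X 2).mkQ η) ∧
      ∀ n, 3 < n → g.g n = 0 := by
  refine ⟨isDGLie_dolbeaultDGLie, isDGLie_truncDGLie, D.atiyah_mem, fun b n f hf => ?_,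
    hD.cyclicMorphism, fun i f hf => ?_, fun i j f hf h hh => ?_,
    fun i j k f hf h hh l hl => ?_, fun n hn => cyclicMap_of_three_lt B D hn⟩
  · have := comm_connection_mem D hf
    simp only [Nat.cast_zero, zero_add] at this
    exact this
  · rw [A0HomDeg_eq] at hf
    have hu := D.atiyah_mem_HomDeg
    refine ⟨_, pairX_mem_typX (B := B) hu hf rfl, fun x => rfl, fun x => ?_, ?_⟩
    -- The Atiyah cocycle has total degree two, so exchanging it with `f` costs no sign.
    · rw [CyclicForm.pairX_apply, CyclicForm.pair_symm_HomDeg hu hf,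
        sg_even (even_two.mul_right i), one_smul]
    · exact B.pairQ_apply (HomDeg_le_HomTot _ _ hu) (HomDeg_le_HomTot _ _ hf)
  · rw [A0HomDeg_eq] at hf hh
    have nf := D.nabla_mem_HomDeg hf
    have nh := D.nabla_mem_HomDeg hh
    refine ⟨_, Submodule.smul_mem _ (2⁻¹ : ℂ) (Submodule.sub_mem _
      (pairX_mem_typX (B := B) nf hh rfl) (zsmul_mem (pairX_mem_typX (B := B) nh hf rfl)
        (sg (i * j)))), fun x => rfl, ?_⟩
    refine (pairNablaMap_apply B D hf hh).trans ?_
    rw [pairNabla, map_smul, map_sub, map_zsmul, ← B.pairQ_apply, ← B.pairQ_apply,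
      CyclicForm.pairQ_symm hf nh, smul_smul, ← sg_add]
    -- The construction uses `(-1)^i ⟨f, ∇h⟩`, the theorem `(-1)^{ij} ⟨∇h, f⟩`. Symmetry of the form
    -- contributes `(-1)^{i(j+1)}`, which reconciles the two.
    have e : sg (i + i * (j + 1)) = sg (i * j) := by
      rw [mul_add, mul_one, sg_add, sg_add, mul_comm, mul_assoc, sg_mul_self, mul_one]
    rw [e]
  · rw [A0HomDeg_eq] at hf hh hl
    have hc := comm_mem_HomDeg hh hl j k
    refine ⟨_, Submodule.neg_mem _ (Submodule.smul_mem _ (2⁻¹ : ℂ)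
      (pairX_mem_typX (B := B) hf hc rfl)), fun x => rfl, ?_⟩
    refine (pairCommMap_apply B f hh hl).trans ?_
    rw [map_neg, map_smul, ← B.pairQ_apply]
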